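/- An *extended welded link diagram* is an immersion in $\mathbb R^2$ of finitely many disjoint oriented circles whose multiple points are transverse double points, each decorated as a positive, negative or welded crossing, together with an even number of marked points (wen marks) on each circle, away from the double points. The *real crossings* are the positive and negative ones. A diagram $L$ is *braided* (around a point $O\in\mathbb R^2$) if it avoids $O$, every component runs monotonically (with positive angular speed) anti-clockwise around $O$, and distinct real crossings lie on distinct rays from $O$. *Braiding process.* Let $K$ be an extended welded link diagram. Deform $K$ by an isotopy of $\mathbb R^2$ to a diagram $K_1$ such that the real crossings have regular neighbourhoods $N_c$ which avoid a point $O$, are seen from $O$ in pairwise disjoint sets of directions, and in which the two strands of $K_1$ run monotonically anti-clockwise around $O$. Then replace the part of $K_1$ outside $\bigcup_c N_c$ arbitrarily so that the result $L$ is braided around $O$; here "replace" means: $L$ and $K_1$ are equal in every $N_c$; $L$ has no real crossings outside $\bigcup_c N_c$; the arcs of $K_1$ and of $L$ outside $\bigcup_c N_c$ are in one-to-one correspondence preserving end points, orientation and the parity of the number of wen marks; and so are the closed loops of $K_1$ and of $L$ outside $\bigcup_c N_c$ (with no further condition). *Moves.* The extended welded braid group $WB^{ext}_n$ has generators $\sigma_i,\rho_i$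 ($1\le i\le n-1$), $\tau_i$ ($1\le i\le n$) and relations: $\sigma_i\sigma_j=\sigma_j\sigma_i$, $\rho_i\rho_j=\rho_j\rho_i$, $\rho_i\sigma_j=\sigma_j\rho_i$ for $|i-j|>1$; $\sigma_i\sigma_{i+1}\sigma_i=\sigma_{i+1}\sigma_i\sigma_{i+1}$, $\rho_i\rho_{i+1}\rho_i=\rho_{i+1}\rho_i\rho_{i+1}$, $\rho_{i+1}\rho_i\sigma_{i+1}=\sigma_i\rho_{i+1}\rho_i$, $\sigma_{i+1}\sigma_i\rho_{i+1}=\rho_i\sigma_{i+1}\sigma_i$ for $1\le i\le n-2$; $\rho_i^2=1$, $\tau_i^2=1$; $\tau_i\tau_j=\tau_j\tau_i$ for $i\ne j$; $\sigma_i\tau_j=\tau_j\sigma_i$, $\rho_i\tau_j=\tau_j\rho_i$ for $j\ne i,i+1$; $\tau_i\rho_i=\rho_i\tau_{i+1}$, $\tau_i\sigma_i=\sigma_i\tau_{i+1}$, $\tau_{i+1}\sigma_i=\rho_i\sigma_i^{-1}\rho_i\tau_i$. A braid diagram on $n$ strands is a word in $\sigma_i^{\pm1},\rho_i,\tau_i$,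 read from top to bottom ($\sigma_i$ a positive, $\sigma_i^{-1}$ a negative, $\rho_i$ a welded crossing, $\tau_i$ a wen mark). A braided link diagram is the closure of a braid diagram, obtained by cutting it open along a ray from $O$; the choice of the ray changes the word only by $b_1b_2\leftrightarrow b_2b_1$ (and by the order of simultaneous distant letters). On closures of braid diagrams one has the extended Markov moves - $(M0)$: replace $b$ by a braid diagram that represents the same element of $WB^{ext}_n$; - $(M2)$: replace a braid diagram $b$ on $n\ge 1$ strands by $\iota(b)\sigma_n$, $\iota(b)\sigma_n^{-1}$ or $\iota(b)\rho_n$, where $\iota(b)$ is $b$ with a trivial strand added on the right, or the inverse of this. **Corollary.** Let $K$ be an extended welded link diagram. If $L$ and $L'$ are two braided diagrams obtained from $K$ by the braiding process, then $L$ and $L'$ are related by a finite sequence of moves $(M0)$ and $(M2)$: they are closures of braid diagrams $b$ and $b'$ that are connected by a finite sequence of moves $(M0)$ and $(M2)$ and changes $b_1b_2\leftrightarrow b_2b_1$ of the ray along which the closed braid is cut. -/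

import Mathlib

open scoped ContDiff Topology

namespace ExtWelded

/-! ### Extended welded link diagrams in the plane

The plane `ℝ²` is identified with `ℂ`. -/

/-- The determinant of two plane vectors; it is positive iff `(a, b)` is a positive frame. -/
def cross (a b : ℂ) : ℝ := a.re * b.im - a.im * b.re

/-- The three decorations of a double point. A classical crossing is positive when
(direction of the over-strand, direction of the under-strand) is a positive frame of the plane,
and negative otherwise, so the decoration together with the orientations of the two strands
determines which strand passes over. -/
inductive Decoration where
  | pos
  | neg
  | welded

/-- Parameters `(j, s)` and `(k, t)` on a family of closed curves, each parametrized by `ℝ` with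
period `1`, that name the same point of the underlying closed `1`-manifold. -/
def SamePoint {m : ℕ} (x y : Fin m × ℝ) : Prop := x.1 = y.1 ∧ ∃ k : ℤ, y.2 = x.2 + k

/-- The double points in the plane of a family of closed curves of period `1`. -/
def doublePointsOf {m : ℕ} (curve : Fin m → ℝ → ℂ) : Set ℂ :=
  {p | ∃ x y : Fin m × ℝ, ¬ SamePoint x y ∧ curve x.1 x.2 = p ∧ curve y.1 y.2 = p}

/-- An extended welded link diagram: an immersion in the plane of finitely many disjoint oriented
circles whose only multiple points are transverse double points, each of them decorated, together
with an even number of wen marks on each circle (away from the double points). Each circle is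
parametrized by `ℝ` with period `1`, in the direction of its orientation. -/
structure LinkDiagram where
  /-- number of components -/
  numComp : ℕ
  /-- the immersed circles -/
  curve : Fin numComp → ℝ → ℂ
  smooth : ∀ j, ContDiff ℝ ∞ (curve j)
  periodic : ∀ j t, curve j (t + 1) = curve j t
  immersed : ∀ j t, deriv (curve j) t ≠ 0
  transverse : ∀ x y : Fin numComp × ℝ, ¬ SamePoint x y → curve x.1 x.2 = curve y.1 y.2 →
    cross (deriv (curve x.1) x.2) (deriv (curve y.1) y.2) ≠ 0
  no_triple : ∀ x y z : Fin numComp × ℝ, ¬ SamePoint x y → ¬ SamePoint y z → ¬ SamePoint x z →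
    ¬ (curve x.1 x.2 = curve y.1 y.2 ∧ curve y.1 y.2 = curve z.1 z.2)
  /-- automatic from compactness and the two previous fields, recorded for convenience -/
  finite_double : (doublePointsOf curve).Finite
  /-- the decoration of a double point; the values at other points of the plane play no role -/
  deco : ℂ → Decoration
  /-- the parameters of the wen marks -/
  wen : Fin numComp → Set ℝ
  wen_periodic : ∀ j t, t + 1 ∈ wen j ↔ t ∈ wen j
  wen_finite : ∀ j, (wen j ∩ Set.Ico 0 1).Finite
  wen_not_double : ∀ j, ∀ t ∈ wen j, curve j t ∉ doublePointsOf curve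
  wen_even : ∀ j, Even (wen j ∩ Set.Ico 0 1).ncard

namespace LinkDiagram

variable (K : LinkDiagram)

/-- The double points of the diagram. -/
def doublePoints : Set ℂ := doublePointsOf K.curve

/-- The real crossings: the double points decorated positive or negative. -/
def realCrossings : Set ℂ := {p | p ∈ K.doublePoints ∧ K.deco p ≠ Decoration.welded}

/-- The positions in the plane of the wen marks. -/
def wenPoints : Set ℂ := {p | ∃ j, ∃ t ∈ K.wen j, K.curve j t = p}

/-- The oriented arcs of the part of the diagram that lies outside small neighbourhoods of the real
crossings: the arc runs on the component `j` from the crossing at parameter `s` to the next real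
crossing met, at parameter `s'`. The branch `(j, s)` of the first crossing and the branch `(j, s')`
of the second one determine the two end points of the arc on the boundaries of the
neighbourhoods. -/
def IsArc (j : Fin K.numComp) (s s' : ℝ) : Prop :=
  s < s' ∧ K.curve j s ∈ K.realCrossings ∧ K.curve j s' ∈ K.realCrossings ∧
    ∀ t, s < t → t < s' → K.curve j t ∉ K.realCrossings

/-- The number of wen marks on the arc of the component `j` between the parameters `s` and `s'`. -/
noncomputable def wensBetween (j : Fin K.numComp) (s s' : ℝ) : ℕ := (K.wen j ∩ Set.Ioo s s').ncard

/-- The closed loops of the part of the diagram outside small neighbourhoods of the real crossings: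
the components without real crossings. -/
def loops : Set (Fin K.numComp) := {j | ∀ t, K.curve j t ∉ K.realCrossings}

end LinkDiagram

/-! ### Isotopy of the plane -/

/-- A smooth isotopy of the plane, starting at the identity. -/
structure PlaneIsotopy where
  toFun : ℝ → ℂ → ℂ
  inv : ℝ → ℂ → ℂ
  smooth : ContDiff ℝ ∞ (fun p : ℝ × ℂ => toFun p.1 p.2)
  smooth_inv : ∀ τ, ContDiff ℝ ∞ (inv τ)
  left_inv : ∀ τ, Function.LeftInverse (inv τ) (toFun τ)
  right_inv : ∀ τ, Function.RightInverse (inv τ) (toFun τ)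
  zero : ∀ z, toFun 0 z = z

/-- `K'` is the image of `K` at time `1` of an isotopy of the plane. -/
def Isotopic (K K' : LinkDiagram) : Prop :=
  ∃ (Φ : PlaneIsotopy) (e : Fin K.numComp ≃ Fin K'.numComp),
    (∀ j t, K'.curve (e j) t = Φ.toFun 1 (K.curve j t)) ∧
    (∀ p ∈ K.doublePoints, K'.deco (Φ.toFun 1 p) = K.deco p) ∧
    (∀ j, K'.wen (e j) = K.wen j)

/-! ### Replacing a diagram outside neighbourhoods of its real crossings -/

/-- The branch of `K` at the point `x` and the branch of `K'` at the point `y` are equal near that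
point, as oriented curves (that is, up to a change of parameter). -/
def SameBranch (K K' : LinkDiagram) (x : Fin K.numComp × ℝ) (y : Fin K'.numComp × ℝ) : Prop :=
  ∃ φ : ℝ → ℝ, φ x.2 = y.2 ∧ ContDiffAt ℝ ∞ φ x.2 ∧ 0 < deriv φ x.2 ∧
    ∀ᶠ u in 𝓝 x.2, K'.curve y.1 (φ u) = K.curve x.1 u

/-- `K'` is obtained from `K` by replacing the part of `K` outside (small) neighbourhoods of its
real crossings. -/
structure IsReplacement (K K' : LinkDiagram) : Prop where
  /-- `K'` has no real crossings outside the neighbourhoods of the real crossings of `K`. -/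
  crossings : K'.realCrossings = K.realCrossings
  /-- `K` and `K'` are equal in these neighbourhoods: the real crossings have the same signs... -/
  signs : ∀ c ∈ K.realCrossings, K'.deco c = K.deco c
  /-- ... and each oriented branch of `K` through a real crossing is a branch of `K'`. -/
  branches : ∀ j s, K.curve j s ∈ K.realCrossings → ∃ y, SameBranch K K' (j, s) y
  /-- Arcs correspond, with end points, orientation and parity of the number of wen marks. (Each
  real crossing has two branches in `K` and two in `K'`, which are matched, and exactly one arc
  leaves along each branch, so this is a one-to-one correspondence.) -/
  arcs : ∀ j s s', K.IsArc j s s' → ∀ k t, SameBranch K K' (j, s) (k, t) →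
    ∃ t', K'.IsArc k t t' ∧ SameBranch K K' (j, s') (k, t') ∧
      (K'.wensBetween k t t' : ZMod 2) = (K.wensBetween j s s' : ZMod 2)
  /-- Loops are in one-to-one correspondence. -/
  loops : Nonempty (K.loops ≃ K'.loops)

/-! ### Braided diagrams and the braiding process -/

/-- The diagram is braided around the point `O`: it avoids `O`, it runs monotonically (with positive
angular speed) anti-clockwise around `O`, and distinct real crossings are seen from `O` in distinct
directions. -/
structure LinkDiagram.IsBraidedAround (L : LinkDiagram) (O : ℂ) : Prop where
  avoids : ∀ j t, L.curve j t ≠ O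
  monotone : ∀ j t, 0 < cross (L.curve j t - O) (deriv (L.curve j) t)
  injective : ∀ c ∈ L.realCrossings, ∀ c' ∈ L.realCrossings, SameRay ℝ (c - O) (c' - O) → c = c'

/-- `L` is a result of the braiding process applied to `K`: deform `K` by an isotopy of the plane
into a diagram `K₁`, and replace the part of `K₁` outside neighbourhoods `N_c` of its real crossings
arbitrarily so that the result `L` is braided around some point `O`. The requirements made
of `K₁` (for small `N_c`: they avoid `O`, are seen from `O` in disjoint sets of directions, and
the strands of `K₁` inside them run monotonically anti-clockwise around `O`) hold
automatically, because they hold for `L`, which is equal to `K₁` near the real crossings. -/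
def BraidingProcess (K L : LinkDiagram) : Prop :=
  ∃ (K₁ : LinkDiagram) (O : ℂ), Isotopic K K₁ ∧ IsReplacement K₁ L ∧ L.IsBraidedAround O

/-! ### Extended welded braids -/

/-- Generators of the extended welded braid group on `n` strands (indices start at `0`). -/
inductive Gen (n : ℕ) where
  | sigma (i : Fin (n - 1))
  | rho (i : Fin (n - 1))
  | tau (i : Fin n)

section Presentation

variable {n : ℕ}

/-- The generator `σ i` in the free group. -/
def fσ (i : Fin (n - 1)) : FreeGroup (Gen n) := FreeGroup.of (Gen.sigma i)
/-- The generator `ρ i` in the free group. -/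
def fρ (i : Fin (n - 1)) : FreeGroup (Gen n) := FreeGroup.of (Gen.rho i)
/-- The generator `τ i` in the free group. -/
def fτ (i : Fin n) : FreeGroup (Gen n) := FreeGroup.of (Gen.tau i)

/-- `i` and `j` differ by more than one. -/
def Far (i j : ℕ) : Prop := i + 1 < j ∨ j + 1 < i

/-- The defining relations of the extended welded braid group. -/
inductive BraidRelation (n : ℕ) : FreeGroup (Gen n) → FreeGroup (Gen n) → Prop
  | sigma_comm (i j : Fin (n - 1)) (h : Far i j) : BraidRelation n (fσ i * fσ j) (fσ j * fσ i)
  | sigma_braid (i j : Fin (n - 1)) (h : (j : ℕ) = i + 1) :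
      BraidRelation n (fσ i * fσ j * fσ i) (fσ j * fσ i * fσ j)
  | rho_comm (i j : Fin (n - 1)) (h : Far i j) : BraidRelation n (fρ i * fρ j) (fρ j * fρ i)
  | rho_braid (i j : Fin (n - 1)) (h : (j : ℕ) = i + 1) :
      BraidRelation n (fρ i * fρ j * fρ i) (fρ j * fρ i * fρ j)
  | rho_sq (i : Fin (n - 1)) : BraidRelation n (fρ i * fρ i) 1
  | rho_sigma_comm (i j : Fin (n - 1)) (h : Far i j) :
      BraidRelation n (fρ i * fσ j) (fσ j * fρ i)
  | mixed (i j : Fin (n - 1)) (h : (j : ℕ) = i + 1) :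
      BraidRelation n (fρ j * fρ i * fσ j) (fσ i * fρ j * fρ i)
  | welded (i j : Fin (n - 1)) (h : (j : ℕ) = i + 1) :
      BraidRelation n (fσ j * fσ i * fρ j) (fρ i * fσ j * fσ i)
  | tau_comm (i j : Fin n) (h : i ≠ j) : BraidRelation n (fτ i * fτ j) (fτ j * fτ i)
  | tau_sq (i : Fin n) : BraidRelation n (fτ i * fτ i) 1
  | sigma_tau_comm (i : Fin (n - 1)) (j : Fin n) (h : (j : ℕ) ≠ i) (h' : (j : ℕ) ≠ i + 1) :
      BraidRelation n (fσ i * fτ j) (fτ j * fσ i)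
  | rho_tau_comm (i : Fin (n - 1)) (j : Fin n) (h : (j : ℕ) ≠ i) (h' : (j : ℕ) ≠ i + 1) :
      BraidRelation n (fρ i * fτ j) (fτ j * fρ i)
  | tau_rho (i : Fin (n - 1)) (a b : Fin n) (ha : (a : ℕ) = i) (hb : (b : ℕ) = i + 1) :
      BraidRelation n (fτ a * fρ i) (fρ i * fτ b)
  | tau_sigma (i : Fin (n - 1)) (a b : Fin n) (ha : (a : ℕ) = i) (hb : (b : ℕ) = i + 1) :
      BraidRelation n (fτ a * fσ i) (fσ i * fτ b)
  | tau_sigma_succ (i : Fin (n - 1)) (a b : Fin n) (ha : (a : ℕ) = i) (hb : (b : ℕ) = i + 1) :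
      BraidRelation n (fτ b * fσ i) (fρ i * (fσ i)⁻¹ * fρ i * fτ a)

end Presentation

/-- The extended welded braid group on `n` strands. -/
abbrev WBE (n : ℕ) : Type :=
  PresentedGroup {x : FreeGroup (Gen n) | ∃ a b, BraidRelation n a b ∧ x = a * b⁻¹}

/-- The elementary braid diagrams on `n` strands: the positive crossing `σ i`, in which the
strand at position `i + 1` passes over the strand at position `i`, the negative
crossing, inverse to `σ i`, the welded crossing `ρ i`, and a wen mark `τ i` on the strand at
position `i`. Positions `0, 1, …` are counted from left to right, strands run downwards. -/
inductive Letter (n : ℕ) where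
  | sigma (i : Fin (n - 1))
  | sigmaInv (i : Fin (n - 1))
  | rho (i : Fin (n - 1))
  | tau (i : Fin n)

/-- An extended welded braid diagram on `n` strands, with its double points and wen marks at
different heights: the elementary diagrams are listed from top to bottom. -/
abbrev BraidDiagram (n : ℕ) : Type := List (Letter n)

/-- The element of the braid group represented by an elementary diagram. -/
def Letter.toGroup {n : ℕ} : Letter n → WBE n
  | .sigma i => PresentedGroup.of (Gen.sigma i)
  | .sigmaInv i => (PresentedGroup.of (Gen.sigma i))⁻¹
  | .rho i => PresentedGroup.of (Gen.rho i)
  | .tau i => PresentedGroup.of (Gen.tau i)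

/-- The extended welded braid represented by a braid diagram. -/
def BraidDiagram.toGroup {n : ℕ} (b : BraidDiagram n) : WBE n := (b.map Letter.toGroup).prod

/-- The same elementary diagram with a trivial strand added on the right. -/
def Letter.addStrand {n : ℕ} : Letter n → Letter (n + 1)
  | .sigma i => .sigma (i.castLE (by omega))
  | .sigmaInv i => .sigmaInv (i.castLE (by omega))
  | .rho i => .rho (i.castLE (by omega))
  | .tau i => .tau (i.castLE (by omega))

/-- The same braid diagram with a trivial strand added on the right. -/
def BraidDiagram.addStrand {n : ℕ} (b : BraidDiagram n) : BraidDiagram (n + 1) :=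
  b.map Letter.addStrand

/-! ### Closures

The closure of a braid diagram is braided: the closing strands run around the right side, so the
diagram turns anti-clockwise around a point `O` to the right of the braid. Conversely a braided
diagram is cut open along a ray from `O`. The position of a strand, counted from the left, is
its position on the ray from `O` through it, counted from the outside. -/

/-- The number of strands of `L` on the ray from `O` in the direction `u`. -/
noncomputable def strandsOnRay (L : LinkDiagram) (O u : ℂ) : ℕ :=
  {x : Fin L.numComp × ℝ | x.2 ∈ Set.Ico 0 1 ∧
    ∃ r : ℝ, 0 < r ∧ L.curve x.1 x.2 - O = r * u}.ncard

/-- The number of strands of `L` on the ray from `O` through `p` that are farther than `p`. -/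
noncomputable def strandsOutside (L : LinkDiagram) (O p : ℂ) : ℕ :=
  {x : Fin L.numComp × ℝ | x.2 ∈ Set.Ico 0 1 ∧
    ∃ r : ℝ, 1 < r ∧ L.curve x.1 x.2 - O = r * (p - O)}.ncard

/-- The angle in `[0, 2π)`, measured anti-clockwise, from the ray from `O` in the direction `u` to
the ray from `O` through `p`. -/
noncomputable def angleFrom (O u p : ℂ) : ℝ :=
  toIcoMod Real.two_pi_pos 0 (Complex.arg ((p - O) / u))

/-- Near the point `p`, the diagram `L` (braided around `O`) is the given elementary diagram. -/
def IsLetterAt (L : LinkDiagram) (O : ℂ) {n : ℕ} (p : ℂ) : Letter n → Prop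
  | .sigma i => p ∈ L.doublePoints ∧ L.deco p = .pos ∧ (i : ℕ) = strandsOutside L O p
  | .sigmaInv i => p ∈ L.doublePoints ∧ L.deco p = .neg ∧ (i : ℕ) = strandsOutside L O p
  | .rho i => p ∈ L.doublePoints ∧ L.deco p = .welded ∧ (i : ℕ) = strandsOutside L O p
  | .tau i => p ∈ L.wenPoints ∧ (i : ℕ) = strandsOutside L O p

/-- `L` is the closure of the braid diagram `b`: `L` is braided around a point `O`, and cutting it
open along a ray from `O` that meets `n` strands and no double point or wen mark gives `b`; that is,
going once around `O` anti-clockwise from that ray, one meets the double points and wen marks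
of `L` as the letters of `b` in their order. (Double points and wen marks at
the same angle are at different radii and involve different strands; they may be taken in any
order.) -/
def IsClosureOf (L : LinkDiagram) {n : ℕ} (b : BraidDiagram n) : Prop :=
  ∃ (O u : ℂ) (pts : List ℂ), L.IsBraidedAround O ∧ u ≠ 0 ∧ strandsOnRay L O u = n ∧
    pts.Nodup ∧ (∀ p, p ∈ pts ↔ p ∈ L.doublePoints ∪ L.wenPoints) ∧
    (∀ p ∈ pts, 0 < angleFrom O u p) ∧
    pts.Pairwise (fun p q => angleFrom O u p ≤ angleFrom O u q) ∧
    List.Forall₂ (IsLetterAt L O) pts b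

/-! ### Extended Markov moves -/

/-- The moves (M0) and (M2) on closed braids, in terms of the braid diagrams obtained by cutting
them open. A closed braid determines the braid diagram only up to the choice of the ray along
which it is cut; this is `recut`, which does not change the closed braid. -/
inductive MarkovStep : (Σ n, BraidDiagram n) → (Σ n, BraidDiagram n) → Prop
  /-- (M0): the two diagrams represent the same extended welded braid. -/
  | m0 {n : ℕ} (b b' : BraidDiagram n) (h : b.toGroup = b'.toGroup) : MarkovStep ⟨n, b⟩ ⟨n, b'⟩
  /-- Cutting the same closed braid along another ray. -/
  | recut {n : ℕ} (b₁ b₂ : BraidDiagram n) : MarkovStep ⟨n, b₁ ++ b₂⟩ ⟨n, b₂ ++ b₁⟩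
  /-- (M2): positive stabilization. -/
  | m2_pos {n : ℕ} (b : BraidDiagram (n + 1)) :
      MarkovStep ⟨n + 1, b⟩ ⟨n + 2, b.addStrand ++ [Letter.sigma (Fin.last n)]⟩
  /-- (M2): negative stabilization. -/
  | m2_neg {n : ℕ} (b : BraidDiagram (n + 1)) :
      MarkovStep ⟨n + 1, b⟩ ⟨n + 2, b.addStrand ++ [Letter.sigmaInv (Fin.last n)]⟩
  /-- (M2): welded stabilization. -/
  | m2_welded {n : ℕ} (b : BraidDiagram (n + 1)) :
      MarkovStep ⟨n + 1, b⟩ ⟨n + 2, b.addStrand ++ [Letter.rho (Fin.last n)]⟩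

/-- Two braided diagrams are related by a finite sequence of moves (M0), (M2) and their inverses:
they are closures of braid diagrams which are so related. -/
def MarkovRelated (L L' : LinkDiagram) : Prop :=
  ∃ (n n' : ℕ) (b : BraidDiagram n) (b' : BraidDiagram n'),
    IsClosureOf L b ∧ IsClosureOf L' b' ∧ Relation.EqvGen MarkovStep ⟨n, b⟩ ⟨n', b'⟩

end ExtWelded

namespace ExtWelded

/-! ### The Coxeter presentation of the symmetric group -/

section Coxeter

open Equiv

/-! Welded crossings only permute strands. Up to conjugation and stabilization with welded
crossings, a closed extended welded braid is therefore determined by its Gauss data: the signed real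
crossings with their two branches, the arcs that join these branches, the parity of the wens on each
arc, and the loops without real crossings. Isotopies and replacements preserve these data, so two
results of the braiding process have equivalent braids.

Algebra: the generators `rh` define a map `iota` from permutations to braids. A real crossing
followed by a welded one keeps the positions of its strands; its conjugates `chi n ε a b` depend
only on the two strands `a`, `b` (`conj_chiZero`). Moving all welded crossings to the bottom writes
a braid as a product of letters `chi` and `tau`, followed by some `iota π`. Conjugation by `iota`
relabels the letters (`iota_mul_chi`, `iota_mul_tu`), and letters without a common strand commute
(`PureLetter.Disj.commute`).

This normal form is recorded by a `State`, whose nodes are the strands. In `State.Rep` the letters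
stand at the top; the strand that ends at the bottom position `f v` starts at the top position of
`prev v`, and `sign v` counts the wens at its lower end. Relabelling nodes is a conjugation
(`Rep.markovEq`). Inserting a node on a strand is a welded stabilization (`equivalent_of_insert`),
and nodes without letters can be erased while the signs of the two arcs are added
(`equivalent_of_erase`). No other stabilization is needed.

Geometry: in polar coordinates around `O` the strands of a braided diagram are graphs of the
logarithmic distance over the angle. Following them through one turn yields the braid word and its
normal form (`Motion.exists_perm`). Then every double point and wen mark receives nodes of its own
(`Ordered.insert_events`). Now all letters are disjoint and commute, so their order is forgotten;
the wens become signs (`State.equivalent_of_taus`), and all nodes except the branches at real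
crossings and one base point on each loop are erased (`circleState_equivalent_of_subset`). What
remains is `gaussState`. On a loop the sign vanishes, because the number of wens on a circle is
even.

Finally a `GaussMap` between two diagrams identifies their Gauss states. Isotopies induce one
because their Jacobian stays positive, replacements because the branches at real crossings are
transverse and hence matched uniquely. -/

/-- The permutations of `ℕ` that fix every `i ≥ n`. -/
def lowPerm (n : ℕ) : Subgroup (Perm ℕ) where
  carrier := {π | ∀ i, n ≤ i → π i = i}
  one_mem' := fun _ _ => rfl
  mul_mem' := fun {a b} ha hb i hi => by
    rw [Perm.mul_apply, hb i hi, ha i hi]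
  inv_mem' := fun {a} ha i hi => by
    rw [Perm.inv_eq_iff_eq, ha i hi]

theorem lowPerm_mono {m n : ℕ} (h : m ≤ n) : lowPerm m ≤ lowPerm n :=
  fun _ hπ i hi => hπ i (h.trans hi)

theorem lowPerm_lt {n : ℕ} {π : Perm ℕ} (hπ : π ∈ lowPerm n) {i : ℕ} (hi : i < n) : π i < n := by
  by_contra h
  push Not at h
  have := hπ _ h
  have := π.injective this
  omega

theorem swap_mem_lowPerm {n i j : ℕ} (hi : i < n) (hj : j < n) : swap i j ∈ lowPerm n :=
  fun k hk => swap_apply_of_ne_of_ne (by omega) (by omega)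

variable {G : Type*} [Group G]

/-- The relations of the symmetric group on `n` letters, for the adjacent transpositions. -/
structure CoxeterRel (n : ℕ) (r : ℕ → G) : Prop where
  sq : ∀ i, i + 1 < n → r i * r i = 1
  far : ∀ i j, i + 1 < j → j + 1 < n → r i * r j = r j * r i
  braid : ∀ i, i + 2 < n → r i * r (i + 1) * r i = r (i + 1) * r i * r (i + 1)

/-- The descending product `r (k + d - 1) * ⋯ * r (k + 1) * r k`. -/
def descProd (r : ℕ → G) (k : ℕ) : ℕ → G
  | 0 => 1
  | d + 1 => r (k + d) * descProd r k d

theorem descProd_succ' (r : ℕ → G) (k d : ℕ) :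
    descProd r k (d + 1) = descProd r (k + 1) d * r k := by
  induction d with
  | zero => simp [descProd]
  | succ d ih =>
    rw [descProd, ih, descProd, ← mul_assoc]
    congr 3
    omega

theorem CoxeterRel.mono {n m : ℕ} {r : ℕ → G} (h : CoxeterRel n r) (hm : m ≤ n) :
    CoxeterRel m r :=
  ⟨fun i hi => h.sq i (by omega), fun i j hi hj => h.far i j hi (by omega),
    fun i hi => h.braid i (by omega)⟩

theorem CoxeterRel.commute_descProd_of_lt {n : ℕ} {r : ℕ → G} (h : CoxeterRel n r) {i k d : ℕ}
    (hi : i + 1 < k) (hd : k + d < n) : Commute (r i) (descProd r k d) := by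
  induction d with
  | zero => exact Commute.one_right _
  | succ d ih =>
    exact Commute.mul_right (h.far i _ (by omega) (by omega)) (ih (by omega))

theorem CoxeterRel.commute_descProd_of_gt {n : ℕ} {r : ℕ → G} (h : CoxeterRel n r) {i k d : ℕ}
    (hi : k + d < i) (hd : i + 1 < n) : Commute (r i) (descProd r k d) := by
  induction d with
  | zero => exact Commute.one_right _
  | succ d ih =>
    exact Commute.mul_right (h.far _ i (by omega) (by omega)).symm (ih (by omega))

/-- Conjugation by a descending product shifts indices: `r (i + 1)` passes the factors of index
below `i`, one braid relation at `r (i + 1) * r i` turns it into `r i`, and this passes the factors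
of index above `i + 1`. -/
theorem CoxeterRel.descProd_mul {n : ℕ} {r : ℕ → G} (h : CoxeterRel n r) {i k d : ℕ}
    (hi : k ≤ i) (hd : i + 1 < k + d) (hn : k + d < n) :
    descProd r k d * r (i + 1) = r i * descProd r k d := by
  induction d with
  | zero => omega
  | succ d ih =>
    rcases Nat.lt_or_ge (i + 1) (k + d) with h' | h'
    · rw [descProd, mul_assoc, ih h' (by omega), ← mul_assoc, ← mul_assoc,
        h.far i (k + d) h' (by omega)]
    · obtain rfl | ⟨d, rfl⟩ : d = 0 ∨ ∃ e, d = e + 1 := by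
        cases d <;> simp
      · omega
      · obtain rfl : i = k + d := by omega
        have hc := h.commute_descProd_of_gt (i := k + d + 1) (k := k) (d := d) (by omega)
          (by omega)
        have hb := h.braid (k + d) (by omega)
        rw [descProd, descProd, ← add_assoc]
        calc r (k + d + 1) * (r (k + d) * descProd r k d) * r (k + d + 1)
            = r (k + d + 1) * r (k + d) * (descProd r k d * r (k + d + 1)) := by group
          _ = r (k + d + 1) * r (k + d) * r (k + d + 1) * descProd r k d := by
            rw [← hc.eq]; group
          _ = _ := by rw [← hb]; group

/-- The submonoid generated by the elements `r i` with `i + 1 < n`. -/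
def adjClosure (r : ℕ → G) (n : ℕ) : Submonoid G :=
  Submonoid.closure {x | ∃ i, i + 1 < n ∧ x = r i}

theorem mem_adjClosure (r : ℕ → G) {n i : ℕ} (hi : i + 1 < n) : r i ∈ adjClosure r n :=
  Submonoid.subset_closure ⟨i, hi, rfl⟩

theorem adjClosure_mono (r : ℕ → G) {m n : ℕ} (h : m ≤ n) : adjClosure r m ≤ adjClosure r n := by
  refine Submonoid.closure_mono ?_
  rintro _ ⟨i, hi, rfl⟩
  exact ⟨i, by omega, rfl⟩

/-- Coset normal form: the descending products from `r (n - 1)` down to `r k` represent all right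
cosets of the subgroup on one letter less. Right multiplication by `r i` is absorbed on the left,
lengthens the product (`i + 1 = k`), or shortens it (`i = k`). -/
theorem CoxeterRel.exists_eq_mul_descProd {n : ℕ} {r : ℕ → G} (h : CoxeterRel (n + 1) r) {x : G}
    (hx : x ∈ adjClosure r (n + 1)) :
    ∃ y ∈ adjClosure r n, ∃ k d, k + d = n ∧ x = y * descProd r k d := by
  induction hx using Submonoid.closure_induction_right with
  | one => exact ⟨1, one_mem _, n, 0, by simp, by simp [descProd]⟩
  | mul_right x _ _ hy ih =>
    obtain ⟨y, hy', k, d, hkd, rfl⟩ := ih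
    obtain ⟨i, hi, rfl⟩ := hy
    rcases lt_trichotomy (i + 1) k with hik | hik | hik
    · refine ⟨y * r i, mul_mem hy' (mem_adjClosure r (by omega)), k, d, hkd, ?_⟩
      rw [mul_assoc, mul_assoc, (h.commute_descProd_of_lt hik (by omega)).eq]
    · subst hik
      exact ⟨y, hy', i, d + 1, by omega, by rw [descProd_succ', mul_assoc]⟩
    · rcases Nat.lt_or_ge k i with hki | hki
      · obtain ⟨i, rfl⟩ : ∃ e, i = e + 1 := ⟨i - 1, by omega⟩
        refine ⟨y * r i, mul_mem hy' (mem_adjClosure r (by omega)), k, d, hkd, ?_⟩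
        rw [mul_assoc, mul_assoc, h.descProd_mul (by omega) (by omega) (by omega)]
      · obtain rfl : i = k := by omega
        obtain ⟨d, rfl⟩ : ∃ e, d = e + 1 := ⟨d - 1, by omega⟩
        refine ⟨y, hy', i + 1, d, by omega, ?_⟩
        rw [descProd_succ', mul_assoc, mul_assoc, h.sq i (by omega), mul_one]

/-- A generator together with the transposition that it stands for. -/
def withSwap (r : ℕ → G) (i : ℕ) : G × Perm ℕ := (r i, swap i (i + 1))

theorem CoxeterRel.withSwap {n : ℕ} {r : ℕ → G} (h : CoxeterRel n r) :
    CoxeterRel n (withSwap r) where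
  sq i hi := Prod.ext (h.sq i hi) (swap_mul_self _ _)
  far i j hi hj := by
    refine Prod.ext (h.far i j hi hj) (Equiv.ext fun k => ?_)
    simp only [ExtWelded.withSwap, Prod.snd_mul, Perm.mul_apply, swap_apply_def]
    split_ifs <;> omega
  braid i hi := by
    refine Prod.ext (h.braid i hi) (Equiv.ext fun k => ?_)
    simp only [ExtWelded.withSwap, Prod.snd_mul, Perm.mul_apply, swap_apply_def]
    split_ifs <;> omega

theorem snd_mem_lowPerm (r : ℕ → G) {n : ℕ} {x : G × Perm ℕ}
    (hx : x ∈ adjClosure (withSwap r) n) : x.2 ∈ lowPerm n := by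
  induction hx using Submonoid.closure_induction with
  | mem x hx =>
    obtain ⟨i, hi, rfl⟩ := hx
    exact swap_mem_lowPerm (by omega) hi
  | one => exact one_mem _
  | mul x y _ _ hx hy => exact mul_mem hx hy

theorem descProd_withSwap_apply (r : ℕ → G) (k d : ℕ) : (descProd (withSwap r) k d).2 k = k + d := by
  induction d with
  | zero => rfl
  | succ d ih =>
    rw [descProd, Prod.snd_mul, Perm.mul_apply, ih]
    exact swap_apply_left _ _

/-- Completeness of the Coxeter relations, stated for the submonoid of `G × Perm ℕ` generated by the
pairs of generator and transposition. In the normal form the permutation sends `k` to `n`, so a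
trivial permutation forces an empty descending product, and induction applies. -/
theorem CoxeterRel.eq_one_of_snd_eq_one {n : ℕ} {r : ℕ → G} (h : CoxeterRel n r) {x : G × Perm ℕ}
    (hx : x ∈ adjClosure (ExtWelded.withSwap r) n) (h1 : x.2 = 1) : x = 1 := by
  induction n generalizing x with
  | zero =>
    have : adjClosure (ExtWelded.withSwap r) 0 = ⊥ := by simp [adjClosure]
    rw [this] at hx
    exact hx
  | succ n ih =>
    obtain ⟨y, hy, k, d, hkd, rfl⟩ := h.withSwap.exists_eq_mul_descProd hx
    have hk : k = n := by
      have h2 := congrArg (fun π : Perm ℕ => π k) h1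
      simp only [Prod.snd_mul, Perm.mul_apply, descProd_withSwap_apply, Perm.one_apply, hkd] at h2
      rw [snd_mem_lowPerm r hy n le_rfl] at h2
      exact h2.symm
    obtain rfl : d = 0 := by omega
    simp only [descProd, mul_one] at h1 ⊢
    exact ih (h.mono (Nat.le_succ n)) hy h1

theorem exists_mem_adjClosure (r : ℕ → G) {n : ℕ} {π : Perm ℕ} (hπ : π ∈ lowPerm n) :
    ∃ g, (g, π) ∈ adjClosure (withSwap r) n := by
  induction n generalizing π with
  | zero =>
    obtain rfl : π = 1 := Equiv.ext fun i => hπ i (Nat.zero_le _)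
    exact ⟨1, one_mem _⟩
  | succ n ih =>
    obtain ⟨k, hk⟩ := π.surjective n
    have hkn : k ≤ n := by
      by_contra h
      have := hπ k (by omega)
      omega
    obtain ⟨d, rfl⟩ := Nat.exists_eq_add_of_le hkn
    have hmem : ∀ e, e ≤ d → descProd (withSwap r) k e ∈ adjClosure (withSwap r) (k + d + 1) := by
      intro e he
      induction e with
      | zero => exact one_mem _
      | succ e ihe => exact mul_mem (mem_adjClosure _ (by omega)) (ihe (by omega))
    have hc := hmem d le_rfl
    -- The descending product carries `k` to `k + d`, just as `π` does, so dividing by it leaves a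
    -- permutation that fixes the last letter.
    have hl : π * (descProd (withSwap r) k d).2⁻¹ ∈ lowPerm (k + d) := by
      have h1 : π * (descProd (withSwap r) k d).2⁻¹ ∈ lowPerm (k + d + 1) :=
        mul_mem hπ (inv_mem (snd_mem_lowPerm r hc))
      intro i hi
      rcases eq_or_lt_of_le hi with rfl | hi
      · have h2 : (descProd (withSwap r) k d).2⁻¹ (k + d) = k :=
          Perm.inv_eq_iff_eq.2 (descProd_withSwap_apply r k d).symm
        rw [Perm.mul_apply, h2, hk]
      · exact h1 i hi
    obtain ⟨g, hg⟩ := ih hl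
    refine ⟨g * (descProd (withSwap r) k d).1, ?_⟩
    convert mul_mem (adjClosure_mono _ (Nat.le_succ _) hg) hc using 1
    exact Prod.ext rfl (by simp)

theorem CoxeterRel.inv_mem_adjClosure {n : ℕ} {r : ℕ → G} (h : CoxeterRel n r) {x : G}
    (hx : x ∈ adjClosure r n) : x⁻¹ ∈ adjClosure r n := by
  induction hx using Submonoid.closure_induction with
  | mem x hx =>
    obtain ⟨i, hi, rfl⟩ := hx
    rw [inv_eq_of_mul_eq_one_left (h.sq i hi)]
    exact mem_adjClosure r hi
  | one => simp
  | mul x y _ _ hx hy =>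
    rw [mul_inv_rev]
    exact mul_mem hy hx

open Classical in
/-- The value at a permutation of the homomorphism that maps the adjacent transposition of `i` and
`i + 1` to `r i`. -/
noncomputable def permLift (r : ℕ → G) (n : ℕ) (π : Perm ℕ) : G :=
  if h : ∃ g, (g, π) ∈ adjClosure (withSwap r) n then h.choose else 1

theorem permLift_mem (r : ℕ → G) {n : ℕ} {π : Perm ℕ} (hπ : π ∈ lowPerm n) :
    (permLift r n π, π) ∈ adjClosure (withSwap r) n := by
  have h := exists_mem_adjClosure r hπ
  rw [permLift, dif_pos h]
  exact h.choose_spec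

/-- The submonoid of pairs is the graph of a function: two values over one permutation have a
quotient with trivial second component. Hence the chosen value does not depend on the choice. -/
theorem CoxeterRel.permLift_eq {n : ℕ} {r : ℕ → G} (h : CoxeterRel n r) {g : G} {π : Perm ℕ}
    (hg : (g, π) ∈ adjClosure (ExtWelded.withSwap r) n) : permLift r n π = g := by
  have h1 := permLift_mem r (snd_mem_lowPerm r hg)
  have h2 := h.eq_one_of_snd_eq_one (mul_mem h1 (h.withSwap.inv_mem_adjClosure hg)) (mul_inv_cancel _)
  exact eq_of_mul_inv_eq_one (congrArg Prod.fst h2)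

theorem CoxeterRel.permLift_mul {n : ℕ} {r : ℕ → G} (h : CoxeterRel n r) {π π' : Perm ℕ}
    (hπ : π ∈ lowPerm n) (hπ' : π' ∈ lowPerm n) :
    permLift r n (π * π') = permLift r n π * permLift r n π' :=
  h.permLift_eq (mul_mem (permLift_mem r hπ) (permLift_mem r hπ'))

theorem CoxeterRel.permLift_one {n : ℕ} {r : ℕ → G} (h : CoxeterRel n r) :
    permLift r n 1 = 1 := h.permLift_eq (one_mem _)

theorem CoxeterRel.permLift_inv {n : ℕ} {r : ℕ → G} (h : CoxeterRel n r) {π : Perm ℕ}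
    (hπ : π ∈ lowPerm n) : permLift r n π⁻¹ = (permLift r n π)⁻¹ :=
  eq_inv_of_mul_eq_one_left (by
    rw [← h.permLift_mul (inv_mem hπ) hπ, inv_mul_cancel, h.permLift_one])

theorem CoxeterRel.permLift_swap {n : ℕ} {r : ℕ → G} (h : CoxeterRel n r) {i : ℕ}
    (hi : i + 1 < n) : permLift r n (swap i (i + 1)) = r i :=
  h.permLift_eq (mem_adjClosure (ExtWelded.withSwap r) hi)

end Coxeter

/-! ### The extended welded braid group -/

section Group

open Equiv

variable {n : ℕ}

theorem mk_eq_of_rel {a b : FreeGroup (Gen n)} (h : BraidRelation n a b) :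
    PresentedGroup.mk {x : FreeGroup (Gen n) | ∃ a b, BraidRelation n a b ∧ x = a * b⁻¹} a =
      PresentedGroup.mk _ b := by
  have := PresentedGroup.one_of_mem
    (rels := {x : FreeGroup (Gen n) | ∃ a b, BraidRelation n a b ∧ x = a * b⁻¹})
    (x := a * b⁻¹) ⟨a, b, h, rfl⟩
  rwa [map_mul, map_inv, mul_inv_eq_one] at this

/-- The generator `σ i`, for a natural number `i` (trivial when out of range). -/
noncomputable def sg (n i : ℕ) : WBE n :=
  if h : i < n - 1 then PresentedGroup.of (Gen.sigma ⟨i, h⟩) else 1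

/-- The generator `ρ i`, for a natural number `i` (trivial when out of range). -/
noncomputable def rh (n i : ℕ) : WBE n :=
  if h : i < n - 1 then PresentedGroup.of (Gen.rho ⟨i, h⟩) else 1

/-- The generator `τ i`, for a natural number `i` (trivial when out of range). -/
noncomputable def tu (n i : ℕ) : WBE n :=
  if h : i < n then PresentedGroup.of (Gen.tau ⟨i, h⟩) else 1

theorem sg_of (i : Fin (n - 1)) : PresentedGroup.of (Gen.sigma i) = sg n i := by simp [sg]
theorem rh_of (i : Fin (n - 1)) : PresentedGroup.of (Gen.rho i) = rh n i := by simp [rh]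
theorem tu_of (i : Fin n) : PresentedGroup.of (Gen.tau i) = tu n i := by simp [tu]

theorem rh_mul_self (i : ℕ) : rh n i * rh n i = 1 := by
  unfold rh
  split_ifs with h
  · exact mk_eq_of_rel (.rho_sq ⟨i, h⟩)
  · exact one_mul 1

theorem tu_mul_self (i : ℕ) : tu n i * tu n i = 1 := by
  unfold tu
  split_ifs with h
  · exact mk_eq_of_rel (.tau_sq ⟨i, h⟩)
  · exact one_mul 1

theorem rh_comm {i j : ℕ} (hij : i + 1 < j) : rh n i * rh n j = rh n j * rh n i := by
  unfold rh
  split_ifs with h h'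
  · exact mk_eq_of_rel (.rho_comm ⟨i, h⟩ ⟨j, h'⟩ (Or.inl hij))
  all_goals simp

theorem sg_comm {i j : ℕ} (hij : i + 1 < j) : Commute (sg n i) (sg n j) := by
  unfold sg Commute SemiconjBy
  split_ifs with h h'
  · exact mk_eq_of_rel (.sigma_comm ⟨i, h⟩ ⟨j, h'⟩ (Or.inl hij))
  all_goals simp

theorem rh_sg_comm {i j : ℕ} (hij : Far i j) : Commute (rh n i) (sg n j) := by
  unfold sg rh Commute SemiconjBy
  split_ifs with h h'
  · exact mk_eq_of_rel (.rho_sigma_comm ⟨i, h⟩ ⟨j, h'⟩ hij)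
  all_goals simp

theorem tu_comm (i j : ℕ) : Commute (tu n i) (tu n j) := by
  rcases eq_or_ne i j with rfl | hij
  · exact Commute.refl _
  unfold tu Commute SemiconjBy
  split_ifs with h h'
  · exact mk_eq_of_rel (.tau_comm ⟨i, h⟩ ⟨j, h'⟩ (by simpa using hij))
  all_goals simp

theorem sg_tu_comm {i j : ℕ} (hij : j ≠ i) (hij' : j ≠ i + 1) : Commute (sg n i) (tu n j) := by
  unfold sg tu Commute SemiconjBy
  split_ifs with h h'
  · exact mk_eq_of_rel (.sigma_tau_comm ⟨i, h⟩ ⟨j, h'⟩ hij hij')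
  all_goals simp

theorem rh_tu_comm {i j : ℕ} (hij : j ≠ i) (hij' : j ≠ i + 1) : Commute (rh n i) (tu n j) := by
  unfold rh tu Commute SemiconjBy
  split_ifs with h h'
  · exact mk_eq_of_rel (.rho_tau_comm ⟨i, h⟩ ⟨j, h'⟩ hij hij')
  all_goals simp

theorem tu_mul_rh {i : ℕ} (hi : i + 1 < n) : tu n i * rh n i = rh n i * tu n (i + 1) := by
  have h1 : i < n - 1 := by omega
  have h2 : i < n := by omega
  simp only [rh, tu, h1, h2, hi, dif_pos]
  exact mk_eq_of_rel (.tau_rho ⟨i, h1⟩ ⟨i, h2⟩ ⟨i + 1, hi⟩ rfl rfl)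

theorem rh_braid {i : ℕ} (hi : i + 2 < n) :
    rh n i * rh n (i + 1) * rh n i = rh n (i + 1) * rh n i * rh n (i + 1) := by
  have h1 : i < n - 1 := by omega
  have h2 : i + 1 < n - 1 := by omega
  simp only [rh, h1, h2, dif_pos]
  exact mk_eq_of_rel (.rho_braid ⟨i, h1⟩ ⟨i + 1, h2⟩ rfl)

theorem rh_rh_sg {i : ℕ} (hi : i + 2 < n) :
    rh n (i + 1) * rh n i * sg n (i + 1) = sg n i * rh n (i + 1) * rh n i := by
  have h1 : i < n - 1 := by omega
  have h2 : i + 1 < n - 1 := by omega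
  simp only [rh, sg, h1, h2, dif_pos]
  exact mk_eq_of_rel (.mixed ⟨i, h1⟩ ⟨i + 1, h2⟩ rfl)

theorem coxeterRel_rh (n : ℕ) : CoxeterRel n (rh n) where
  sq i _ := rh_mul_self i
  far _ _ hij _ := rh_comm hij
  braid _ hi := rh_braid hi

/-! ### Permutations as welded braids -/

/-- The welded braid without real crossings that belongs to a permutation. -/
noncomputable def iota (n : ℕ) (π : Perm ℕ) : WBE n := permLift (rh n) n π

theorem iota_mul {π π' : Perm ℕ} (hπ : π ∈ lowPerm n) (hπ' : π' ∈ lowPerm n) :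
    iota n (π * π') = iota n π * iota n π' := (coxeterRel_rh n).permLift_mul hπ hπ'

@[simp] theorem iota_one : iota n 1 = 1 := (coxeterRel_rh n).permLift_one

theorem iota_inv {π : Perm ℕ} (hπ : π ∈ lowPerm n) : iota n π⁻¹ = (iota n π)⁻¹ :=
  (coxeterRel_rh n).permLift_inv hπ

theorem iota_swap {i : ℕ} (hi : i + 1 < n) : iota n (swap i (i + 1)) = rh n i :=
  (coxeterRel_rh n).permLift_swap hi

/-- Wens travel along strands through welded crossings. The claim is multiplicative in pairs of a
braid and its permutation, so it is checked on the generating pairs. -/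
theorem iota_mul_tu {π : Perm ℕ} (hπ : π ∈ lowPerm n) {a : ℕ} (ha : a < n) :
    iota n π * tu n a = tu n (π a) * iota n π := by
  suffices H : ∀ x : WBE n × Perm ℕ, x ∈ adjClosure (withSwap (rh n)) n → ∀ a < n,
      x.1 * tu n a = tu n (x.2 a) * x.1 from H _ (permLift_mem (rh n) hπ) a ha
  intro x hx
  induction hx using Submonoid.closure_induction with
  | mem x hx =>
    obtain ⟨i, hi, rfl⟩ := hx
    intro a ha
    have key := tu_mul_rh hi
    rcases eq_or_ne a i with rfl | h1
    · simp only [withSwap, swap_apply_left]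
      have h2 := rh_mul_self (n := n) a
      calc rh n a * tu n a = rh n a * (tu n a * rh n a) * rh n a := by
            rw [mul_assoc, mul_assoc, h2, mul_one]
        _ = _ := by rw [key, ← mul_assoc, h2, one_mul]
    rcases eq_or_ne a (i + 1) with rfl | h2
    · simp only [withSwap, swap_apply_right]
      exact key.symm
    · simp only [withSwap, swap_apply_of_ne_of_ne h1 h2]
      exact rh_tu_comm h1 h2
  | one => simp
  | mul x y hx' hy' hx hy =>
    intro a ha
    have := lowPerm_lt (snd_mem_lowPerm _ hy') ha
    simp only [Prod.fst_mul, Prod.snd_mul, Perm.mul_apply]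
    rw [mul_assoc, hy a ha, ← mul_assoc, hx _ this, mul_assoc]

/-! ### Real crossings of strands that keep their positions -/

/-- The crossing of the strands `0` and `1`, followed by a welded crossing of them. -/
noncomputable def chiZero (n : ℕ) (ε : ℤ) : WBE n := sg n 0 ^ ε * rh n 0

/-- The transposition is a product of adjacent ones of index at least `2`, and their welded
crossings are far from the crossing of the strands `0` and `1`. -/
theorem commute_chiZero_iota_swap {ε : ℤ} {k m : ℕ} (hk : 2 ≤ k) (hkm : k < m) (hm : m < n) :
    Commute (chiZero n ε) (iota n (swap k m)) := by
  induction m, hkm using Nat.le_induction with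
  | base =>
    rw [iota_swap hm]
    exact Commute.mul_left (Commute.zpow_left (rh_sg_comm (Or.inr (by omega))).symm _)
      (rh_comm (by omega))
  | succ m hkm ih =>
    have h1 : swap k (m + 1) = swap m (m + 1) * swap k m * swap m (m + 1) := by
      refine Equiv.ext fun i => ?_
      simp only [Perm.mul_apply, swap_apply_def]
      split_ifs <;> omega
    have h2 : Commute (chiZero n ε) (iota n (swap m (m + 1))) := by
      rw [iota_swap hm]
      exact Commute.mul_left (Commute.zpow_left (rh_sg_comm (Or.inr (by omega))).symm _)
        (rh_comm (by omega))
    have m1 : swap m (m + 1) ∈ lowPerm n := swap_mem_lowPerm (by omega) (by omega)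
    have m2 : swap k m ∈ lowPerm n := swap_mem_lowPerm (by omega) (by omega)
    rw [h1, iota_mul (mul_mem m1 m2) m1, iota_mul m1 m2]
    exact (h2.mul_right (ih (by omega))).mul_right h2

/-- A permutation that fixes `0` and `1` is a product of transpositions of larger numbers; the
induction splits off the one that moves the last non-fixed point. This is what makes `chi` depend
only on two strands. -/
theorem commute_chiZero_iota {ε : ℤ} {π : Perm ℕ} (hπ : π ∈ lowPerm n) (h0 : π 0 = 0)
    (h1 : π 1 = 1) : Commute (chiZero n ε) (iota n π) := by
  suffices H : ∀ m ≤ n, ∀ π : Perm ℕ, π ∈ lowPerm m → π 0 = 0 → π 1 = 1 →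
      Commute (chiZero n ε) (iota n π) from H n le_rfl π hπ h0 h1
  intro m
  induction m with
  | zero =>
    intro _ π hπ _ _
    obtain rfl : π = 1 := Equiv.ext fun i => hπ i (Nat.zero_le _)
    simp
  | succ m ih =>
    intro hm π hπ h0 h1
    by_cases hfix : π m = m
    · refine ih (by omega) π (fun i hi => ?_) h0 h1
      rcases eq_or_lt_of_le hi with rfl | hi
      · exact hfix
      · exact hπ i hi
    obtain ⟨k, hk⟩ := π.surjective m
    have hkm : k < m := by
      by_contra h
      rcases eq_or_lt_of_le (not_lt.1 h) with rfl | h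
      · exact hfix hk
      · have := hπ k h
        omega
    have hk2 : 2 ≤ k := by
      by_contra h
      have : k = 0 ∨ k = 1 := by omega
      rcases this with rfl | rfl
      · obtain rfl : m = 0 := by omega
        omega
      · obtain rfl : m = 1 := by omega
        omega
    have hs : swap k m ∈ lowPerm (m + 1) := swap_mem_lowPerm (by omega) (by omega)
    have hmem : π * swap k m ∈ lowPerm m := by
      intro i hi
      rcases eq_or_lt_of_le hi with rfl | hi
      · rw [Perm.mul_apply, swap_apply_right, hk]
      · exact (mul_mem hπ hs) i hi
    have h2 := ih (by omega) (π * swap k m) hmem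
      (by rw [Perm.mul_apply, swap_apply_of_ne_of_ne (by omega) (by omega), h0])
      (by rw [Perm.mul_apply, swap_apply_of_ne_of_ne (by omega) (by omega), h1])
    have h3 : π = π * swap k m * swap k m := by rw [mul_assoc, swap_mul_self, mul_one]
    rw [h3, iota_mul (lowPerm_mono (by omega) hmem) (lowPerm_mono hm hs)]
    exact h2.mul_right (commute_chiZero_iota_swap hk2 hkm (by omega))

/-- A permutation that maps `0` to `a` and `1` to `b`. -/
def moveTo (a b : ℕ) : Perm ℕ := swap 0 a * swap 1 (swap 0 a b)

theorem moveTo_zero {a b : ℕ} (h : a ≠ b) : moveTo a b 0 = a := by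
  have : swap 0 a b ≠ 0 := fun h' => h (by rw [swap_apply_eq_iff, swap_apply_left] at h'; exact h'.symm)
  rw [moveTo, Perm.mul_apply, swap_apply_of_ne_of_ne (by simp) this.symm, swap_apply_left]

theorem moveTo_one (a b : ℕ) : moveTo a b 1 = b := by
  rw [moveTo, Perm.mul_apply, swap_apply_left, swap_apply_self]

theorem moveTo_mem {a b : ℕ} (h : a ≠ b) (ha : a < n) (hb : b < n) : moveTo a b ∈ lowPerm n :=
  mul_mem (swap_mem_lowPerm (by omega) ha) (swap_mem_lowPerm (by omega)
    (lowPerm_lt (swap_mem_lowPerm (by omega) ha) hb))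

/-- A real crossing of the strands at the positions `a` and `b`, made in such a way that the
strands keep their positions. -/
noncomputable def chi (n : ℕ) (ε : ℤ) (a b : ℕ) : WBE n :=
  iota n (moveTo a b) * chiZero n ε * (iota n (moveTo a b))⁻¹

/-- Two permutations with equal values at `0` and `1` differ by one that fixes both, and that one
commutes with `chiZero`. So the particular choice `moveTo` in `chi` is immaterial. -/
theorem conj_chiZero {ε : ℤ} {π : Perm ℕ} (hπ : π ∈ lowPerm n) (hn : 2 ≤ n) :
    iota n π * chiZero n ε * (iota n π)⁻¹ = chi n ε (π 0) (π 1) := by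
  have hne : π 0 ≠ π 1 := fun h => by simpa using π.injective h
  have hm := moveTo_mem hne (lowPerm_lt hπ (by omega)) (lowPerm_lt hπ (by omega))
  set μ := moveTo (π 0) (π 1) with hμ
  have hc : Commute (chiZero n ε) (iota n (μ⁻¹ * π)) := by
    refine commute_chiZero_iota (mul_mem (inv_mem hm) hπ) ?_ ?_
    · rw [Perm.mul_apply, Perm.inv_eq_iff_eq, hμ, moveTo_zero hne]
    · rw [Perm.mul_apply, Perm.inv_eq_iff_eq, hμ, moveTo_one]
  have hπ' : iota n π = iota n μ * iota n (μ⁻¹ * π) := by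
    rw [← iota_mul hm (mul_mem (inv_mem hm) hπ), mul_inv_cancel_left]
  rw [chi, ← hμ, hπ', mul_inv_rev, mul_assoc (iota n μ), ← hc.eq]
  group

theorem iota_mul_chi {ε : ℤ} {π : Perm ℕ} (hπ : π ∈ lowPerm n) {a b : ℕ} (hab : a ≠ b)
    (ha : a < n) (hb : b < n) :
    iota n π * chi n ε a b = chi n ε (π a) (π b) * iota n π := by
  have hm := moveTo_mem hab ha hb
  have h := conj_chiZero (ε := ε) (mul_mem hπ hm) (by omega)
  rw [Perm.mul_apply, Perm.mul_apply, moveTo_zero hab, moveTo_one, iota_mul hπ hm] at h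
  rw [← h, chi]
  group

/-- Induction on `i`: conjugation by `rh n (i + 1) * rh n i` lowers both indices by one, for `sg` by
the mixed relation `rh_rh_sg` and for `rh` by the braid relation. -/
theorem chi_succ {ε : ℤ} {i : ℕ} (hi : i + 1 < n) : chi n ε i (i + 1) = sg n i ^ ε * rh n i := by
  induction i with
  | zero =>
    have := conj_chiZero (ε := ε) (one_mem (lowPerm n)) hi
    simpa [chiZero] using this.symm
  | succ i ih =>
    have m1 : swap i (i + 1) ∈ lowPerm n := swap_mem_lowPerm (by omega) (by omega)
    have m2 : swap (i + 1) (i + 1 + 1) ∈ lowPerm n := swap_mem_lowPerm (by omega) (by omega)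
    have h1 := iota_mul_chi (ε := ε) (mul_mem m2 m1) (a := i + 1) (b := i + 1 + 1)
      (by omega) (by omega) (by omega)
    simp only [Perm.mul_apply, swap_apply_right] at h1
    rw [swap_apply_of_ne_of_ne (x := i) (by omega) (by omega),
      swap_apply_of_ne_of_ne (x := i + 1 + 1) (a := i) (by omega) (by omega), swap_apply_right,
      ih (by omega), iota_mul m2 m1, iota_swap (by omega), iota_swap (by omega)] at h1
    have h2 : SemiconjBy (rh n (i + 1) * rh n i) (sg n (i + 1)) (sg n i) := by
      unfold SemiconjBy
      rw [rh_rh_sg hi, mul_assoc]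
    have h3 : SemiconjBy (rh n (i + 1) * rh n i) (rh n (i + 1)) (rh n i) := by
      unfold SemiconjBy
      rw [← rh_braid hi]
      group
    have h4 := (h2.zpow_right ε).mul_right h3
    exact mul_left_cancel (h1.trans h4.symm)

/-- The values are corrected one after the other by a transposition on the left. Earlier values
survive because they differ from both transposed numbers. -/
theorem exists_perm_four {a b c d : ℕ} (hab : a ≠ b) (hac : a ≠ c) (had : a ≠ d) (hbc : b ≠ c)
    (hbd : b ≠ d) (hcd : c ≠ d) (ha : a < n) (hb : b < n) (hc : c < n) (hd : d < n) :
    ∃ π ∈ lowPerm n, π 0 = a ∧ π 1 = b ∧ π 2 = c ∧ π 3 = d := by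
  have hn : 4 ≤ n := by omega
  have key : ∀ (π : Perm ℕ) (k x : ℕ), swap (π k) x * π = swap (π k) x * π := fun _ _ _ => rfl
  let p1 := swap 0 a
  let p2 := swap (p1 1) b * p1
  let p3 := swap (p2 2) c * p2
  let p4 := swap (p3 3) d * p3
  have m1 : p1 ∈ lowPerm n := swap_mem_lowPerm (by omega) ha
  have m2 : p2 ∈ lowPerm n := mul_mem (swap_mem_lowPerm (lowPerm_lt m1 (by omega)) hb) m1
  have m3 : p3 ∈ lowPerm n := mul_mem (swap_mem_lowPerm (lowPerm_lt m2 (by omega)) hc) m2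
  have m4 : p4 ∈ lowPerm n := mul_mem (swap_mem_lowPerm (lowPerm_lt m3 (by omega)) hd) m3
  have e10 : p1 0 = a := swap_apply_left _ _
  have e21 : p2 1 = b := swap_apply_left _ _
  have e32 : p3 2 = c := swap_apply_left _ _
  have e43 : p4 3 = d := swap_apply_left _ _
  have e20 : p2 0 = a := by
    have : p1 0 ≠ p1 1 := fun h => by simpa using p1.injective h
    change swap (p1 1) b (p1 0) = a
    rw [swap_apply_of_ne_of_ne this (by rwa [e10]), e10]
  have e30 : p3 0 = a := by
    have : p2 0 ≠ p2 2 := fun h => by simpa using p2.injective h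
    change swap (p2 2) c (p2 0) = a
    rw [swap_apply_of_ne_of_ne this (by rwa [e20]), e20]
  have e31 : p3 1 = b := by
    have : p2 1 ≠ p2 2 := fun h => by simpa using p2.injective h
    change swap (p2 2) c (p2 1) = b
    rw [swap_apply_of_ne_of_ne this (by rwa [e21]), e21]
  refine ⟨p4, m4, ?_, ?_, ?_, e43⟩
  · have : p3 0 ≠ p3 3 := fun h => by simpa using p3.injective h
    change swap (p3 3) d (p3 0) = a
    rw [swap_apply_of_ne_of_ne this (by rwa [e30]), e30]
  · have : p3 1 ≠ p3 3 := fun h => by simpa using p3.injective h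
    change swap (p3 3) d (p3 1) = b
    rw [swap_apply_of_ne_of_ne this (by rwa [e31]), e31]
  · have : p3 2 ≠ p3 3 := fun h => by simpa using p3.injective h
    change swap (p3 3) d (p3 2) = c
    rw [swap_apply_of_ne_of_ne this (by rwa [e32]), e32]

theorem commute_of_conj {G : Type*} [Group G] {g x x' y y' : G} (hx : g * x = x' * g)
    (hy : g * y = y' * g) (h : Commute x y) : Commute x' y' := by
  have hx' : x' = g * x * g⁻¹ := by rw [hx]; group
  have hy' : y' = g * y * g⁻¹ := by rw [hy]; group
  rw [hx', hy']
  exact (h.map (MulAut.conj g).toMonoidHom)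

/-- Simultaneous conjugation by a permutation moves the strands to `0, 1, 2, 3`, where the two
letters are words in generators with far indices. -/
theorem chi_comm {ε δ : ℤ} {a b c d : ℕ} (hab : a ≠ b) (hac : a ≠ c) (had : a ≠ d) (hbc : b ≠ c)
    (hbd : b ≠ d) (hcd : c ≠ d) (ha : a < n) (hb : b < n) (hc : c < n) (hd : d < n) :
    Commute (chi n ε a b) (chi n δ c d) := by
  obtain ⟨π, hπ, rfl, rfl, rfl, rfl⟩ := exists_perm_four hab hac had hbc hbd hcd ha hb hc hd
  have hn : 4 ≤ n := by omega
  refine commute_of_conj (iota_mul_chi hπ (a := 0) (b := 1) (by omega) (by omega) (by omega))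
    (iota_mul_chi hπ (a := 2) (b := 3) (by omega) (by omega) (by omega)) ?_
  rw [chi_succ (i := 0) (by omega), chi_succ (i := 2) (by omega)]
  refine Commute.mul_left (Commute.mul_right ?_ ?_) (Commute.mul_right ?_ ?_)
  · exact ((sg_comm (by omega)).zpow_left _).zpow_right _
  · exact (rh_sg_comm (Or.inr (by omega))).symm.zpow_left _
  · exact (rh_sg_comm (Or.inl (by omega))).zpow_right _
  · exact rh_comm (by omega)

theorem chi_tu_comm {ε : ℤ} {a b c : ℕ} (hab : a ≠ b) (hac : a ≠ c) (hbc : b ≠ c) (ha : a < n)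
    (hb : b < n) (hc : c < n) : Commute (chi n ε a b) (tu n c) := by
  have hm := moveTo_mem hab ha hb
  have h0 : (moveTo a b)⁻¹ c ≠ 0 := fun h => hac (by
    rw [Perm.inv_eq_iff_eq, moveTo_zero hab] at h; exact h.symm)
  have h1 : (moveTo a b)⁻¹ c ≠ 1 := fun h => hbc (by
    rw [Perm.inv_eq_iff_eq, moveTo_one] at h; exact h.symm)
  have h2 := iota_mul_tu hm (lowPerm_lt (inv_mem hm) hc)
  rw [show moveTo a b ((moveTo a b)⁻¹ c) = c from Equiv.apply_symm_apply _ _] at h2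
  refine commute_of_conj (g := iota n (moveTo a b)) (x := chiZero n ε) (by rw [chi]; group) h2 ?_
  exact Commute.mul_left ((sg_tu_comm h0 h1).zpow_left _) (rh_tu_comm h0 h1)

/-! ### Adding a strand -/

/-- The inclusion of the generators on `n` strands. -/
def Gen.addStrand : Gen n → Gen (n + 1)
  | .sigma i => .sigma (i.castLE (by omega))
  | .rho i => .rho (i.castLE (by omega))
  | .tau i => .tau (i.castLE (by omega))

theorem map_fσ (i : Fin (n - 1)) :
    FreeGroup.map Gen.addStrand (fσ i) = (fσ (i.castLE (by omega)) : FreeGroup (Gen (n + 1))) := rfl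

theorem map_fρ (i : Fin (n - 1)) :
    FreeGroup.map Gen.addStrand (fρ i) = (fρ (i.castLE (by omega)) : FreeGroup (Gen (n + 1))) := rfl

theorem map_fτ (i : Fin n) :
    FreeGroup.map Gen.addStrand (fτ i) = (fτ (i.castLE (by omega)) : FreeGroup (Gen (n + 1))) := rfl

theorem BraidRelation.addStrand {a b : FreeGroup (Gen n)} (h : BraidRelation n a b) :
    BraidRelation (n + 1) (FreeGroup.map Gen.addStrand a) (FreeGroup.map Gen.addStrand b) := by
  cases h <;> simp only [map_mul, map_inv, map_one, map_fσ, map_fρ, map_fτ]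
  case sigma_comm i j h => exact .sigma_comm _ _ h
  case sigma_braid i j h => exact .sigma_braid _ _ h
  case rho_comm i j h => exact .rho_comm _ _ h
  case rho_braid i j h => exact .rho_braid _ _ h
  case rho_sq i => exact .rho_sq _
  case rho_sigma_comm i j h => exact .rho_sigma_comm _ _ h
  case mixed i j h => exact .mixed _ _ h
  case welded i j h => exact .welded _ _ h
  case tau_comm i j h => exact .tau_comm _ _ (fun h' => h (by simpa [Fin.ext_iff] using h'))
  case tau_sq i => exact .tau_sq _
  case sigma_tau_comm i j h h' => exact .sigma_tau_comm _ _ h h'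
  case rho_tau_comm i j h h' => exact .rho_tau_comm _ _ h h'
  case tau_rho i a b ha hb => exact .tau_rho _ _ _ ha hb
  case tau_sigma i a b ha hb => exact .tau_sigma _ _ _ ha hb
  case tau_sigma_succ i a b ha hb => exact .tau_sigma_succ _ _ _ ha hb

theorem lift_addStrand (x : FreeGroup (Gen n)) :
    FreeGroup.lift (fun g : Gen n => (PresentedGroup.of g.addStrand : WBE (n + 1))) x =
      PresentedGroup.mk _ (FreeGroup.map Gen.addStrand x) := by
  induction x using FreeGroup.induction_on with
  | C1 => simp
  | of g => simp [PresentedGroup.of]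
  | inv_of g h => rw [map_inv, map_inv, map_inv, h]
  | mul x y hx hy => rw [map_mul, map_mul, map_mul, hx, hy]

/-- The homomorphism that adds a trivial strand on the right. -/
noncomputable def addStrandHom (n : ℕ) : WBE n →* WBE (n + 1) :=
  PresentedGroup.toGroup
    (f := fun g : Gen n => (PresentedGroup.of g.addStrand : WBE (n + 1))) (by
  rintro _ ⟨a, b, h, rfl⟩
  rw [map_mul, map_inv, mul_inv_eq_one, lift_addStrand, lift_addStrand]
  exact mk_eq_of_rel h.addStrand)

theorem addStrandHom_of (g : Gen n) :
    addStrandHom n (PresentedGroup.of g) = PresentedGroup.of g.addStrand :=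
  PresentedGroup.toGroup.of _

theorem addStrandHom_sg {i : ℕ} (hi : i + 1 < n) : addStrandHom n (sg n i) = sg (n + 1) i := by
  have h1 : i < n - 1 := by omega
  have h2 : i < n + 1 - 1 := by omega
  rw [sg, sg, dif_pos h1, dif_pos h2, addStrandHom_of]
  rfl

theorem addStrandHom_rh {i : ℕ} (hi : i + 1 < n) : addStrandHom n (rh n i) = rh (n + 1) i := by
  have h1 : i < n - 1 := by omega
  have h2 : i < n + 1 - 1 := by omega
  rw [rh, rh, dif_pos h1, dif_pos h2, addStrandHom_of]
  rfl

theorem addStrandHom_tu {i : ℕ} (hi : i < n) : addStrandHom n (tu n i) = tu (n + 1) i := by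
  have h2 : i < n + 1 := by omega
  rw [tu, tu, dif_pos hi, dif_pos h2, addStrandHom_of]
  rfl

theorem addStrandHom_iota {π : Perm ℕ} (hπ : π ∈ lowPerm n) :
    addStrandHom n (iota n π) = iota (n + 1) π := by
  suffices H : ∀ x : WBE n × Perm ℕ, x ∈ adjClosure (withSwap (rh n)) n →
      (addStrandHom n x.1, x.2) ∈ adjClosure (withSwap (rh (n + 1))) (n + 1) from
    ((coxeterRel_rh (n + 1)).permLift_eq (H _ (permLift_mem (rh n) hπ))).symm
  intro x hx
  induction hx using Submonoid.closure_induction with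
  | mem x hx =>
    obtain ⟨i, hi, rfl⟩ := hx
    have := mem_adjClosure (withSwap (rh (n + 1))) (n := n + 1) (i := i) (by omega)
    simpa only [withSwap, addStrandHom_rh hi] using this
  | one =>
    rw [Prod.fst_one, Prod.snd_one, map_one]
    exact one_mem _
  | mul x y _ _ hx hy =>
    simpa only [map_mul, Prod.mk_mul_mk, Prod.fst_mul, Prod.snd_mul] using mul_mem hx hy

theorem addStrandHom_chi {ε : ℤ} {a b : ℕ} (hab : a ≠ b) (ha : a < n) (hb : b < n) :
    addStrandHom n (chi n ε a b) = chi (n + 1) ε a b := by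
  simp only [chi, chiZero, map_mul, map_inv, map_zpow,
    addStrandHom_iota (moveTo_mem hab ha hb), addStrandHom_sg (n := n) (i := 0) (by omega),
    addStrandHom_rh (n := n) (i := 0) (by omega)]

theorem toGroup_letter (l : Letter n) : addStrandHom n l.toGroup = l.addStrand.toGroup := by
  cases l <;> simp only [Letter.toGroup, map_inv, addStrandHom_of] <;> rfl

theorem toGroup_addStrand (b : BraidDiagram n) :
    BraidDiagram.toGroup b.addStrand = addStrandHom n b.toGroup := by
  simp only [BraidDiagram.toGroup, BraidDiagram.addStrand, map_list_prod, List.map_map]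
  congr 1
  exact List.map_congr_left fun l _ => (toGroup_letter l).symm

theorem toGroup_append (b b' : BraidDiagram n) :
    BraidDiagram.toGroup (b ++ b') = b.toGroup * b'.toGroup := by
  simp [BraidDiagram.toGroup]

/-- The alphabet of braid diagrams has no inverses of `rho` and `tau`; they are not missing, because
these generators are involutions. -/
theorem exists_toGroup_eq (x : WBE n) : ∃ b : BraidDiagram n, b.toGroup = x := by
  suffices H : ∀ y : FreeGroup (Gen n), ∃ b : BraidDiagram n,
      b.toGroup = PresentedGroup.mk _ y by
    obtain ⟨y, rfl⟩ := PresentedGroup.mk_surjective _ x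
    exact H y
  intro y
  induction y using FreeGroup.induction_on with
  | C1 => exact ⟨[], rfl⟩
  | of g =>
    cases g with
    | sigma i => exact ⟨[.sigma i], by simp [BraidDiagram.toGroup, Letter.toGroup]; rfl⟩
    | rho i => exact ⟨[.rho i], by simp [BraidDiagram.toGroup, Letter.toGroup]; rfl⟩
    | tau i => exact ⟨[.tau i], by simp [BraidDiagram.toGroup, Letter.toGroup]; rfl⟩
  | inv_of g _ =>
    cases g with
    | sigma i => exact ⟨[.sigmaInv i], by simp [BraidDiagram.toGroup, Letter.toGroup]; rfl⟩
    | rho i =>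
      refine ⟨[.rho i], ?_⟩
      rw [map_inv, eq_inv_iff_mul_eq_one]
      simp only [BraidDiagram.toGroup, List.map_cons, List.map_nil, List.prod_singleton,
        Letter.toGroup, rh_of]
      have := rh_mul_self (n := n) i
      rw [← rh_of] at this ⊢
      exact this
    | tau i =>
      refine ⟨[.tau i], ?_⟩
      rw [map_inv, eq_inv_iff_mul_eq_one]
      simp only [BraidDiagram.toGroup, List.map_cons, List.map_nil, List.prod_singleton,
        Letter.toGroup, tu_of]
      have := tu_mul_self (n := n) i
      rw [← tu_of] at this ⊢
      exact this
  | mul x y hx hy =>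
    obtain ⟨b, hb⟩ := hx
    obtain ⟨b', hb'⟩ := hy
    exact ⟨b ++ b', by rw [toGroup_append, hb, hb', map_mul]⟩

/-! ### Markov equivalence of elements of the braid groups -/

/-- Braid diagrams that represent `x` and `y` are related by Markov moves. -/
def MarkovEq (x y : Σ n, WBE n) : Prop :=
  ∀ (b : BraidDiagram x.1) (b' : BraidDiagram y.1), b.toGroup = x.2 → b'.toGroup = y.2 →
    Relation.EqvGen MarkovStep ⟨x.1, b⟩ ⟨y.1, b'⟩

theorem MarkovEq.refl (x : Σ n, WBE n) : MarkovEq x x :=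
  fun b b' hb hb' => .rel _ _ (.m0 b b' (hb.trans hb'.symm))

theorem MarkovEq.symm {x y : Σ n, WBE n} (h : MarkovEq x y) : MarkovEq y x :=
  fun b b' hb hb' => (h b' b hb' hb).symm

theorem MarkovEq.trans {x y z : Σ n, WBE n} (h : MarkovEq x y) (h' : MarkovEq y z) :
    MarkovEq x z := fun b b' hb hb' => by
  obtain ⟨c, hc⟩ := exists_toGroup_eq y.2
  exact (h b c hb hc).trans _ _ _ (h' c b' hc hb')

theorem markovEq_of_eq {n : ℕ} {x y : WBE n} (h : x = y) : MarkovEq ⟨n, x⟩ ⟨n, y⟩ := by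
  rw [h]
  exact .refl _

theorem markovEq_mul_comm (x y : WBE n) : MarkovEq ⟨n, x * y⟩ ⟨n, y * x⟩ := by
  intro b b' hb hb'
  obtain ⟨c, hc⟩ := exists_toGroup_eq x
  obtain ⟨d, hd⟩ := exists_toGroup_eq y
  refine .trans _ _ _ (.rel _ _ (.m0 b (c ++ d) ?_)) (.trans _ _ _ (.rel _ _ (.recut c d))
    (.rel _ _ (.m0 (d ++ c) b' ?_)))
  · rw [hb, toGroup_append, hc, hd]
  · rw [toGroup_append, hc, hd]
    exact hb'.symm

theorem markovEq_conj (g x : WBE n) : MarkovEq ⟨n, g * x * g⁻¹⟩ ⟨n, x⟩ :=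
  (markovEq_mul_comm (g * x) g⁻¹).trans (markovEq_of_eq (by group))

theorem markovEq_mul_rh (x : WBE (n + 1)) :
    MarkovEq ⟨n + 2, addStrandHom (n + 1) x * rh (n + 2) n⟩ ⟨n + 1, x⟩ := by
  intro b b' hb hb'
  refine .trans _ _ _ (.rel _ _ (.m0 b (b'.addStrand ++ [Letter.rho (Fin.last n)]) ?_))
    (.symm _ _ (.rel _ _ (.m2_welded b')))
  rw [toGroup_append, toGroup_addStrand, hb, hb']
  simp only [BraidDiagram.toGroup, List.map_cons, List.map_nil, List.prod_singleton,
    Letter.toGroup]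
  congr 1
  exact (rh_of (n := n + 2) (Fin.last n)).symm

/-- Stabilization at an arbitrary strand `a`: conjugating `x` by the swap of `a` with the last
strand brings `a` to the place where the welded move acts, and conjugations cost nothing. -/
theorem markovEq_mul_swap (x : WBE n) {a : ℕ} (ha : a < n) :
    MarkovEq ⟨n + 1, addStrandHom n x * iota (n + 1) (swap a n)⟩ ⟨n, x⟩ := by
  -- From here on `n` is the index of the last old strand, and the new strand has index `n + 1`.
  obtain ⟨n, rfl⟩ : ∃ k, n = k + 1 := ⟨n - 1, by omega⟩
  have hm : swap a n ∈ lowPerm (n + 1) := swap_mem_lowPerm ha (by omega)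
  have hm' : swap a n ∈ lowPerm (n + 2) := lowPerm_mono (by omega) hm
  have hs : swap n (n + 1) ∈ lowPerm (n + 2) := swap_mem_lowPerm (by omega) (by omega)
  have hsw : swap a (n + 1) = (swap a n)⁻¹ * swap n (n + 1) * swap a n := by
    refine Equiv.ext fun i => ?_
    simp only [swap_inv, Perm.mul_apply, swap_apply_def]
    split_ifs <;> omega
  have h1 : addStrandHom (n + 1) x * iota (n + 2) (swap a (n + 1)) =
      (iota (n + 2) (swap a n))⁻¹ *
        (addStrandHom (n + 1) (iota (n + 1) (swap a n) * x * (iota (n + 1) (swap a n))⁻¹) *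
          rh (n + 2) n) * ((iota (n + 2) (swap a n))⁻¹)⁻¹ := by
    rw [hsw, iota_mul (mul_mem (inv_mem hm') hs) hm', iota_mul (inv_mem hm') hs, iota_inv hm',
      iota_swap (by omega), map_mul, map_mul, map_inv, addStrandHom_iota hm]
    group
  exact (markovEq_of_eq h1).trans ((markovEq_conj _ _).trans ((markovEq_mul_rh _).trans
    (markovEq_conj _ _)))

end Group

/-! ### Closed welded braids given by nodes on circles -/

/-! ### Products of wens on several strands -/

section Signs

open Equiv

variable {n : ℕ}

/-- The braid with wens on the strands `i` with `s i = 1`. -/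
noncomputable def wens (n : ℕ) (s : ℕ → ZMod 2) : WBE n :=
  ((List.range n).map fun i => tu n i ^ (s i).val).prod

theorem commute_list_prod {M : Type*} [Monoid M] {x : M} {l : List M} (h : ∀ y ∈ l, Commute x y) :
    Commute x l.prod := by
  induction l with
  | nil => simp
  | cons y l ih =>
    rw [List.prod_cons]
    exact (h y (by simp)).mul_right (ih fun z hz => h z (by simp [hz]))

/-- Exponents add modulo two since `tu` is an involution; this is why signs live in `ZMod 2`. -/
theorem tu_pow_add (i : ℕ) (a b : ZMod 2) :
    tu n i ^ (a + b).val = tu n i ^ a.val * tu n i ^ b.val := by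
  have h := tu_mul_self (n := n) i
  have key : ∀ a : ZMod 2, a = 0 ∨ a = 1 := by decide
  rcases key a with rfl | rfl <;> rcases key b with rfl | rfl
  · simp
  · simp
  · simp
  · have : (1 + 1 : ZMod 2).val = 0 := rfl
    rw [this, show (1 : ZMod 2).val = 1 from rfl, pow_one, pow_zero, h]

theorem wens_commute_tu (s : ℕ → ZMod 2) (i : ℕ) : Commute (tu n i) (wens n s) := by
  refine commute_list_prod fun y hy => ?_
  obtain ⟨j, -, rfl⟩ := List.mem_map.1 hy
  exact (tu_comm i j).pow_right _

theorem list_prod_map_mul {M ι : Type*} [Monoid M] (f g : ι → M) (l : List ι)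
    (h : ∀ i j, Commute (f i) (g j)) :
    (l.map fun i => f i * g i).prod = (l.map f).prod * (l.map g).prod := by
  induction l with
  | nil => simp
  | cons i l ih =>
    have hc : Commute (g i) (l.map f).prod := commute_list_prod fun y hy => by
      obtain ⟨j, -, rfl⟩ := List.mem_map.1 hy
      exact (h j i).symm
    simp only [List.map_cons, List.prod_cons, ih]
    rw [mul_assoc, mul_assoc, ← mul_assoc (g i), hc.eq, mul_assoc]

theorem wens_add (s s' : ℕ → ZMod 2) : wens n (s + s') = wens n s * wens n s' := by
  rw [wens, wens, wens, ← list_prod_map_mul]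
  · simp only [Pi.add_apply, tu_pow_add]
  · intro i j
    exact ((tu_comm i j).pow_left _).pow_right _

theorem wens_congr {s s' : ℕ → ZMod 2} (h : ∀ i < n, s i = s' i) : wens n s = wens n s' := by
  unfold wens
  congr 1
  refine List.map_congr_left fun i hi => ?_
  rw [h i (List.mem_range.1 hi)]

theorem wens_single {i : ℕ} (hi : i < n) : wens n (Pi.single i 1) = tu n i := by
  have h : ∀ m, ((List.range m).map fun j => tu n j ^ ((Pi.single i 1 : ℕ → ZMod 2) j).val).prod =
      if i < m then tu n i else 1 := by
    intro m
    induction m with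
    | zero => simp
    | succ m ih =>
      rw [List.range_succ, List.map_append, List.prod_append, ih]
      rcases lt_trichotomy i m with h | rfl | h
      · rw [if_pos h, if_pos (by omega)]
        simp [Pi.single_eq_of_ne (show m ≠ i by omega)]
      · simp [show (1 : ZMod 2).val = 1 from rfl]
      · rw [if_neg (by omega), if_neg (by omega)]
        simp [Pi.single_eq_of_ne (show m ≠ i by omega)]
  rw [wens, h, if_pos hi]

theorem mul_list_prod_eq {M ι : Type*} [Monoid M] {g : M} {f f' : ι → M} {l : List ι}
    (h : ∀ i ∈ l, g * f i = f' i * g) : g * (l.map f).prod = (l.map f').prod * g := by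
  induction l with
  | nil => simp
  | cons i l ih =>
    rw [List.map_cons, List.map_cons, List.prod_cons, List.prod_cons, ← mul_assoc,
      h i (by simp), mul_assoc, ih fun j hj => h j (by simp [hj]), mul_assoc]

theorem perm_range_map {π : Perm ℕ} (hπ : π ∈ lowPerm n) :
    ((List.range n).map π).Perm (List.range n) := by
  rw [List.perm_ext_iff_of_nodup (List.nodup_range.map π.injective) List.nodup_range]
  intro i
  simp only [List.mem_map, List.mem_range]
  constructor
  · rintro ⟨j, hj, rfl⟩
    exact lowPerm_lt hπ hj
  · intro hi
    exact ⟨π⁻¹ i, lowPerm_lt (inv_mem hπ) hi, Equiv.apply_symm_apply _ _⟩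

/-- Each wen moves from the strand `i` to the strand `π i`. The product then runs over a permuted
list, which may be reordered because wens commute. -/
theorem iota_mul_wens {π : Perm ℕ} (hπ : π ∈ lowPerm n) (s : ℕ → ZMod 2) :
    iota n π * wens n (fun i => s (π i)) = wens n s * iota n π := by
  rw [wens, mul_list_prod_eq (f' := fun i => tu n (π i) ^ (s (π i)).val)]
  · congr 1
    have : ((List.range n).map fun i => tu n (π i) ^ (s (π i)).val) =
        ((List.range n).map π).map fun i => tu n i ^ (s i).val := by
      rw [List.map_map]
      rfl
    rw [this, wens]
    refine ((perm_range_map hπ).map _).prod_eq' ?_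
    exact List.pairwise_map.2 (List.pairwise_of_forall fun x y =>
      ((tu_comm x y).pow_left _).pow_right _)
  · intro i hi
    have := iota_mul_tu hπ (List.mem_range.1 hi)
    exact (SemiconjBy.pow_right this _ : _)

theorem addStrandHom_wens {s : ℕ → ZMod 2} (hs : s n = 0) :
    addStrandHom n (wens n s) = wens (n + 1) s := by
  rw [wens, wens, map_list_prod, List.range_succ, List.map_append, List.prod_append, List.map_map]
  simp only [List.map_cons, List.map_nil, List.prod_singleton, hs, ZMod.val_zero, pow_zero,
    mul_one]
  congr 1
  refine List.map_congr_left fun i hi => ?_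
  simp [addStrandHom_tu (List.mem_range.1 hi)]

end Signs

/-! ### States: closed braids as letters, a permutation of nodes, and signs -/

section States

open Equiv

/-- A letter of a braid in which the strands keep their positions: a real crossing or a wen. -/
inductive PureLetter (α : Type*) where
  | chi (ε : ℤ) (a b : α)
  | tau (a : α)

namespace PureLetter

variable {α β : Type*}

/-- Relabel the strands. -/
def map (f : α → β) : PureLetter α → PureLetter β
  | .chi ε a b => .chi ε (f a) (f b)
  | .tau a => .tau (f a)

/-- The strands involved in the letter are distinct strands with labels in `V`. -/
def Ok (V : Set α) : PureLetter α → Prop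
  | .chi _ a b => a ∈ V ∧ b ∈ V ∧ a ≠ b
  | .tau a => a ∈ V

/-- The strand `v` is not involved in the letter. -/
def Avoids (v : α) : PureLetter α → Prop
  | .chi _ a b => a ≠ v ∧ b ≠ v
  | .tau a => a ≠ v

/-- The letters involve distinct strands. -/
def Disj : PureLetter α → PureLetter α → Prop
  | .chi _ a b, l => l.Avoids a ∧ l.Avoids b
  | .tau a, l => l.Avoids a

/-- The element of the braid group. -/
noncomputable def eval (n : ℕ) : PureLetter ℕ → WBE n
  | .chi ε a b => ExtWelded.chi n ε a b
  | .tau a => tu n a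

theorem Ok.map {V : Set α} {V' : Set β} {f : α → β} (hf : Set.MapsTo f V V')
    (hi : Set.InjOn f V) {l : PureLetter α} (h : l.Ok V) : (l.map f).Ok V' := by
  cases l with
  | chi ε a b => exact ⟨hf h.1, hf h.2.1, fun e => h.2.2 (hi h.1 h.2.1 e)⟩
  | tau a => exact hf h

theorem Ok.mono {V V' : Set α} (hV : V ⊆ V') {l : PureLetter α} (h : l.Ok V) : l.Ok V' := by
  cases l with
  | chi ε a b => exact ⟨hV h.1, hV h.2.1, h.2.2⟩
  | tau a => exact hV h

theorem map_congr {V : Set α} {f g : α → β} (hfg : ∀ v ∈ V, f v = g v) {l : PureLetter α}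
    (h : l.Ok V) : l.map f = l.map g := by
  cases l with
  | chi ε a b => simp only [PureLetter.map, hfg a h.1, hfg b h.2.1]
  | tau a => simp only [PureLetter.map, hfg a h]

theorem map_map {γ : Type*} (g : β → γ) (f : α → β) (l : PureLetter α) :
    (l.map f).map g = l.map (g ∘ f) := by
  cases l <;> rfl

theorem iota_mul_eval {n : ℕ} {π : Perm ℕ} (hπ : π ∈ lowPerm n) {l : PureLetter ℕ}
    (h : l.Ok (Set.Iio n)) : iota n π * l.eval n = (l.map π).eval n * iota n π := by
  cases l with
  | chi ε a b => exact iota_mul_chi hπ h.2.2 h.1 h.2.1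
  | tau a => exact iota_mul_tu hπ h

theorem addStrandHom_eval {n : ℕ} {l : PureLetter ℕ} (h : l.Ok (Set.Iio n)) :
    addStrandHom n (l.eval n) = l.eval (n + 1) := by
  cases l with
  | chi ε a b => exact addStrandHom_chi h.2.2 h.1 h.2.1
  | tau a => exact addStrandHom_tu h

theorem tu_commute_eval {n i : ℕ} (hi : i < n) {l : PureLetter ℕ} (h : l.Ok (Set.Iio n))
    (ha : l.Avoids i) : Commute (tu n i) (l.eval n) := by
  cases l with
  | chi ε a b => exact (chi_tu_comm h.2.2 ha.1 ha.2 h.1 h.2.1 hi).symm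
  | tau a => exact tu_comm _ _

/-- All reordering of letters in the proof rests on this: in each case the two letters have no
strand in common. -/
theorem Disj.commute {n : ℕ} {l l' : PureLetter ℕ} (hl : l.Ok (Set.Iio n)) (hl' : l'.Ok (Set.Iio n))
    (h : l.Disj l') : Commute (l.eval n) (l'.eval n) := by
  cases l with
  | tau a => exact tu_commute_eval hl hl' h
  | chi ε a b =>
    cases l' with
    | tau c => exact chi_tu_comm hl.2.2 (Ne.symm h.1) (Ne.symm h.2) hl.1 hl.2.1 hl'
    | chi δ c d =>
      exact chi_comm hl.2.2 h.1.1.symm h.1.2.symm h.2.1.symm h.2.2.symm hl'.2.2 hl.1 hl.2.1 hl'.1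
        hl'.2.1

theorem Disj.map {V : Set α} {f : α → β} (hf : Set.InjOn f V) {l l' : PureLetter α} (hl : l.Ok V)
    (hl' : l'.Ok V) (h : l.Disj l') : (l.map f).Disj (l'.map f) := by
  have key : ∀ v ∈ V, l'.Avoids v → (l'.map f).Avoids (f v) := by
    intro v hv hav
    cases l' with
    | tau c => exact fun e => hav (hf hl' hv e)
    | chi δ c d => exact ⟨fun e => hav.1 (hf hl'.1 hv e), fun e => hav.2 (hf hl'.2.1 hv e)⟩
  cases l with
  | tau a => exact key a hl h
  | chi ε a b => exact ⟨key a hl.1 h.1, key b hl.2.1 h.2⟩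

end PureLetter

theorem exists_lowPerm {n : ℕ} {h : ℕ → ℕ} (hh : Set.BijOn h (Set.Iio n) (Set.Iio n)) :
    ∃ g ∈ lowPerm n, ∀ i < n, g i = h i := by
  classical
  let k : ℕ → ℕ := fun i => if i < n then h i else i
  have hk : Function.Bijective k := by
    constructor
    · intro i j hij
      simp only [k] at hij
      split_ifs at hij with h1 h2 h2
      · exact hh.injOn h1 h2 hij
      · have : h i < n := hh.mapsTo h1
        omega
      · have : h j < n := hh.mapsTo h2
        omega
      · exact hij
    · intro j
      by_cases hj : j < n
      · obtain ⟨i, hi, rfl⟩ := hh.surjOn hj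
        exact ⟨i, if_pos hi⟩
      · exact ⟨j, if_neg hj⟩
  refine ⟨Equiv.ofBijective k hk, fun i hi => ?_, fun i hi => ?_⟩
  · exact if_neg (by omega)
  · exact if_pos hi

/-- A closed welded braid, described by finitely many nodes on its circles: `prev` is the node
met before a given node, `sign v` is the number of wens on the way from there to `v`, and `letters`
are real crossings and wens at the nodes. -/
structure State (α : Type*) where
  nodes : Finset α
  letters : List (PureLetter α)
  prev : α → α
  sign : α → ZMod 2
  bij : Set.BijOn prev nodes nodes
  ok : ∀ l ∈ letters, l.Ok (nodes : Set α)

namespace State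

variable {α β γ : Type*}

/-- The braid `x` represents the state. -/
def Rep (S : State α) (x : Σ n, WBE n) : Prop :=
  ∃ (f : α → ℕ) (π : Perm ℕ) (s : ℕ → ZMod 2), Set.BijOn f S.nodes (Set.Iio x.1) ∧
    π ∈ lowPerm x.1 ∧ (∀ v ∈ S.nodes, π (f v) = f (S.prev v)) ∧
    (∀ v ∈ S.nodes, s (f v) = S.sign v) ∧
    x.2 = (S.letters.map fun l => (l.map f).eval x.1).prod * iota x.1 π * wens x.1 s

theorem exists_enum (V : Finset α) : ∃ f : α → ℕ, Set.BijOn f V (Set.Iio V.card) := by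
  classical
  let e := V.equivFin
  refine ⟨fun v => if h : v ∈ V then e ⟨v, h⟩ else 0, ?_, ?_, ?_⟩
  · intro v hv
    have hv' : v ∈ V := hv
    simp [hv']
  · intro v hv w hw hvw
    have hv' : v ∈ V := hv
    have hw' : w ∈ V := hw
    simp only [hv', hw', dif_pos] at hvw
    exact congrArg Subtype.val (e.injective (Fin.ext hvw))
  · intro i hi
    refine ⟨e.symm ⟨i, hi⟩, (e.symm ⟨i, hi⟩).2, ?_⟩
    simp

theorem exists_inverse {V : Finset α} {n : ℕ} {f : α → ℕ} (hf : Set.BijOn f V (Set.Iio n)) :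
    ∃ g : (i : ℕ) → i < n → α, (∀ i hi, g i hi ∈ V ∧ f (g i hi) = i) ∧
      ∀ v (hv : v ∈ V), g (f v) (hf.mapsTo hv) = v := by
  choose g hg using fun i (hi : i < n) => hf.surjOn hi
  exact ⟨g, hg, fun v hv => hf.injOn (hg _ _).1 hv (hg _ _).2⟩

theorem exists_rep_of_enum (S : State α) {n : ℕ} {f : α → ℕ}
    (hf : Set.BijOn f S.nodes (Set.Iio n)) :
    ∃ (π : Perm ℕ) (s : ℕ → ZMod 2), π ∈ lowPerm n ∧ (∀ v ∈ S.nodes, π (f v) = f (S.prev v)) ∧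
      (∀ v ∈ S.nodes, s (f v) = S.sign v) := by
  classical
  obtain ⟨g, hg, hgf⟩ := exists_inverse hf
  have hb : Set.BijOn (fun i => if hi : i < n then f (S.prev (g i hi)) else 0) (Set.Iio n)
      (Set.Iio n) := by
    refine ⟨fun i hi => ?_, fun i hi j hj hij => ?_, fun i hi => ?_⟩
    · have hi' : i < n := hi
      simp only [hi', dif_pos]
      exact hf.mapsTo (S.bij.mapsTo (hg i hi).1)
    · have hi' : i < n := hi
      have hj' : j < n := hj
      simp only [hi', hj', dif_pos] at hij
      have h1 := hf.injOn (S.bij.mapsTo (hg i hi).1) (S.bij.mapsTo (hg j hj).1) hij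
      have h2 := S.bij.injOn (hg i hi).1 (hg j hj).1 h1
      rw [← (hg i hi).2, ← (hg j hj).2, h2]
    · obtain ⟨v, hv, rfl⟩ := hf.surjOn hi
      obtain ⟨w, hw, rfl⟩ := S.bij.surjOn hv
      refine ⟨f w, hf.mapsTo hw, ?_⟩
      have : f w < n := hf.mapsTo hw
      simp only [this, dif_pos]
      rw [hgf w hw]
  obtain ⟨π, hπ, hπ'⟩ := exists_lowPerm hb
  refine ⟨π, fun i => if hi : i < n then S.sign (g i hi) else 0, hπ, fun v hv => ?_,
    fun v hv => ?_⟩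
  · have : f v < n := hf.mapsTo hv
    rw [hπ' _ this, dif_pos this, hgf v hv]
  · have : f v < n := hf.mapsTo hv
    simp only [this, dif_pos]
    rw [hgf v hv]

theorem exists_rep (S : State α) : ∃ x, S.Rep x := by
  obtain ⟨f, hf⟩ := exists_enum S.nodes
  obtain ⟨π, s, hπ, h1, h2⟩ := S.exists_rep_of_enum hf
  exact ⟨⟨S.nodes.card, (S.letters.map fun l => (l.map f).eval S.nodes.card).prod *
    iota S.nodes.card π * wens S.nodes.card s⟩, f, π, s, hf, hπ, h1, h2, rfl⟩

theorem card_eq {V : Finset α} {n : ℕ} {f : α → ℕ} (hf : Set.BijOn f V (Set.Iio n)) :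
    V.card = n := by
  have h := hf.image_eq
  have := Set.InjOn.ncard_image hf.injOn
  rw [h, Set.ncard_coe_finset] at this
  rw [← this]
  simp [Set.ncard_eq_toFinset_card']

theorem letter_ok (S : State α) {n : ℕ} {f : α → ℕ} (hf : Set.BijOn f S.nodes (Set.Iio n))
    {l : PureLetter α} (hl : l ∈ S.letters) : (l.map f).Ok (Set.Iio n) :=
  (S.ok l hl).map hf.mapsTo hf.injOn

/-- Representatives of the same state are conjugate. -/
theorem Rep.markovEq {S : State α} {x y : Σ n, WBE n} (hx : S.Rep x) (hy : S.Rep y) :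
    MarkovEq x y := by
  obtain ⟨n, x⟩ := x
  obtain ⟨m, y⟩ := y
  obtain ⟨f, π, s, hf, hπ, h1, h2, hx⟩ := hx
  obtain ⟨f', π', s', hf', hπ', h1', h2', hy⟩ := hy
  dsimp only at hf hπ hx hf' hπ' hy
  obtain rfl : n = m := (card_eq hf).symm.trans (card_eq hf')
  obtain ⟨k, hk, hkf⟩ := exists_inverse hf
  -- The change of enumeration `f' ∘ f⁻¹` permutes the positions. It extends to a permutation `g`,
  -- and conjugation by `iota n g` carries one representative to the other.
  have hb : Set.BijOn (fun i => if hi : i < n then f' (k i hi) else 0) (Set.Iio n)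
      (Set.Iio n) := by
    refine ⟨fun i hi => ?_, fun i hi j hj hij => ?_, fun i hi => ?_⟩
    · have hi' : i < n := hi
      simp only [hi', dif_pos]
      exact hf'.mapsTo (hk i hi).1
    · have hi' : i < n := hi
      have hj' : j < n := hj
      simp only [hi', hj', dif_pos] at hij
      have h1 := hf'.injOn (hk i hi).1 (hk j hj).1 hij
      rw [← (hk i hi).2, ← (hk j hj).2, h1]
    · obtain ⟨v, hv, rfl⟩ := hf'.surjOn hi
      refine ⟨f v, hf.mapsTo hv, ?_⟩
      have : f v < n := hf.mapsTo hv
      simp only [this, dif_pos]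
      rw [hkf v hv]
  obtain ⟨g, hg, hg'⟩ := exists_lowPerm hb
  have hgf : ∀ v ∈ S.nodes, g (f v) = f' v := by
    intro v hv
    have : f v < n := hf.mapsTo hv
    rw [hg' _ this, dif_pos this, hkf v hv]
  have hL : iota n g * (S.letters.map fun l => (l.map f).eval n).prod =
      (S.letters.map fun l => (l.map f').eval n).prod * iota n g := by
    refine mul_list_prod_eq fun l hl => ?_
    rw [PureLetter.iota_mul_eval hg (S.letter_ok hf hl), PureLetter.map_map,
      PureLetter.map_congr (f := g ∘ f) (g := f') (fun v hv => hgf v hv) (S.ok l hl)]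
  have hP : g * π = π' * g := by
    refine Equiv.ext fun i => ?_
    by_cases hi : i < n
    · obtain ⟨v, hv, rfl⟩ := hf.surjOn hi
      rw [Perm.mul_apply, Perm.mul_apply, h1 v hv, hgf v hv, h1' v hv,
        hgf _ (S.bij.mapsTo hv)]
    · rw [Perm.mul_apply, Perm.mul_apply, hπ i (by omega), hg i (by omega), hπ' i (by omega)]
  have hW : wens n s = wens n (fun i => s' (g i)) := by
    refine wens_congr fun i hi => ?_
    obtain ⟨v, hv, rfl⟩ := hf.surjOn hi
    rw [h2 v hv, hgf v hv, h2' v hv]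
  -- `iota n g` is pushed through the letters, the permutation and the wens in turn, relabelling
  -- each of them.
  have key : iota n g * x * (iota n g)⁻¹ = y := by
    rw [hx, hy, mul_inv_eq_iff_eq_mul, hW, mul_assoc _ (wens n s'), ← iota_mul_wens hg,
      ← mul_assoc, ← mul_assoc, hL, mul_assoc _ (iota n g), ← iota_mul hg hπ, hP,
      iota_mul hπ' hg]
    group
  rw [← key]
  exact (markovEq_conj _ _).symm

/-- Representatives of the states are related by Markov moves. -/
def Equivalent (S : State α) (T : State β) : Prop := ∀ x y, S.Rep x → T.Rep y → MarkovEq x y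

theorem Equivalent.symm {S : State α} {T : State β} (h : S.Equivalent T) : T.Equivalent S :=
  fun x y hx hy => (h y x hy hx).symm

/-- A universally quantified relation between representatives composes only because the middle state
has one. -/
theorem Equivalent.trans {S : State α} {T : State β} {U : State γ} (h : S.Equivalent T)
    (h' : T.Equivalent U) : S.Equivalent U := fun x y hx hy => by
  obtain ⟨z, hz⟩ := T.exists_rep
  exact (h x z hx hz).trans (h' z y hz hy)

/-- All representatives of one state are Markov equivalent, so a single pair of representatives is
enough. -/
theorem equivalent_of_rep {S : State α} {T : State β} {x y : Σ n, WBE n} (hx : S.Rep x)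
    (hy : T.Rep y) (h : MarkovEq x y) : S.Equivalent T := fun _ _ hx' hy' =>
  (hx'.markovEq hx).trans (h.trans (hy.markovEq hy'))

/-- Relabelling the nodes, and reordering letters that involve distinct nodes. -/
theorem equivalent_of_map {S : State α} {T : State β} (ψ : α → β)
    (hψ : Set.BijOn ψ S.nodes T.nodes) (hprev : ∀ v ∈ S.nodes, ψ (S.prev v) = T.prev (ψ v))
    (hsign : ∀ v ∈ S.nodes, S.sign v = T.sign (ψ v))
    (hperm : (S.letters.map (PureLetter.map ψ)).Perm T.letters)
    (hdisj : T.letters.Pairwise PureLetter.Disj ∨ S.letters.map (PureLetter.map ψ) = T.letters) :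
    S.Equivalent T := by
  obtain ⟨⟨n, y⟩, hy⟩ := T.exists_rep
  obtain ⟨f, π, s, hf, hπ, h1, h2, hy'⟩ := id hy
  dsimp only at hf hπ hy'
  -- The enumeration of `T` pulled back along `ψ` lets the same braid represent both states, up to
  -- the order of commuting letters.
  refine equivalent_of_rep (x := ⟨n, y⟩) ⟨f ∘ ψ, π, s, hf.comp hψ, hπ, fun v hv => ?_,
    fun v hv => ?_, ?_⟩ hy (.refl _)
  · rw [Function.comp_apply, h1 _ (hψ.mapsTo hv), Function.comp_apply, hprev v hv]
  · rw [Function.comp_apply, h2 _ (hψ.mapsTo hv), hsign v hv]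
  · dsimp only
    rw [hy']
    congr 2
    have e : (S.letters.map fun l => (l.map (f ∘ ψ)).eval n) =
        (S.letters.map (PureLetter.map ψ)).map fun l => (l.map f).eval n := by
      rw [List.map_map]
      exact List.map_congr_left fun l _ => by rw [Function.comp_apply, PureLetter.map_map]
    rw [e]
    rcases hdisj with hdisj | heq
    · refine ((hperm.map _).symm).prod_eq' ?_
      rw [List.pairwise_map]
      refine hdisj.imp_of_mem fun {l l'} hl hl' h => ?_
      exact (h.map hf.injOn (T.ok l hl) (T.ok l' hl')).commute (T.letter_ok hf hl)
        (T.letter_ok hf hl')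
    · rw [heq]

/-- A wen at the beginning of the braid is recorded as a sign. -/
theorem equivalent_of_tau {S T : State α} [DecidableEq α] {a : α} (hn : S.nodes = T.nodes)
    (hL : S.letters = .tau a :: T.letters) (hP : ∀ v ∈ T.nodes, S.prev v = T.prev v)
    (hs : ∀ v ∈ T.nodes, T.sign v = S.sign v + if v = a then 1 else 0) : S.Equivalent T := by
  obtain ⟨⟨n, x⟩, hx⟩ := S.exists_rep
  obtain ⟨f, π, s, hf, hπ, h1, h2, hx'⟩ := id hx
  dsimp only at hf hπ hx'
  have ha : a ∈ S.nodes := S.ok (.tau a) (by simp [hL])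
  have hfa : f a < n := hf.mapsTo ha
  refine equivalent_of_rep hx (y := ⟨n, (T.letters.map fun l => (l.map f).eval n).prod *
    iota n π * wens n (s + Pi.single (f a) 1)⟩) ⟨f, π, s + Pi.single (f a) 1, ?_, hπ,
    fun v hv => ?_, fun v hv => ?_, rfl⟩ ?_
  · rwa [← hn]
  · rw [h1 v (hn ▸ hv), hP v hv]
  · rw [hs v hv, Pi.add_apply, h2 v (hn ▸ hv)]
    congr 1
    split_ifs with h
    · rw [h, Pi.single_eq_same]
    · exact Pi.single_eq_of_ne (fun e => h (hf.injOn (hn ▸ hv) ha e)) _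
  · rw [hx', hL, List.map_cons, List.prod_cons, wens_add, wens_single hfa]
    simp only [PureLetter.map, PureLetter.eval]
    -- The two braids differ by carrying the wen from the top to the bottom, which is a recut.
    rw [mul_assoc (tu n (f a)), mul_assoc (tu n (f a)), ← mul_assoc _ (wens n s)]
    exact markovEq_mul_comm _ _

/-- A wen is moved backwards through a node that is not involved in any letter. -/
theorem equivalent_of_moveSign {S T : State α} [DecidableEq α] {p z : α} (hn : S.nodes = T.nodes)
    (hL : S.letters = T.letters) (hP : ∀ v ∈ T.nodes, S.prev v = T.prev v) (hp : p ∈ S.nodes)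
    (hz : z ∈ S.nodes) (hpz : S.prev z = p) (hav : ∀ l ∈ S.letters, l.Avoids p)
    (hs : ∀ v ∈ T.nodes,
      T.sign v = S.sign v + (if v = p then 1 else 0) + if v = z then 1 else 0) :
    S.Equivalent T := by
  obtain ⟨⟨n, x⟩, hx⟩ := S.exists_rep
  obtain ⟨f, π, s, hf, hπ, h1, h2, hx'⟩ := id hx
  dsimp only at hf hπ hx'
  have hfp : f p < n := hf.mapsTo hp
  have hfz : f z < n := hf.mapsTo hz
  have single : ∀ v ∈ S.nodes, ∀ w ∈ S.nodes,
      (Pi.single (f w) 1 : ℕ → ZMod 2) (f v) = if v = w then 1 else 0 := by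
    intro v hv w hw
    split_ifs with h
    · rw [h, Pi.single_eq_same]
    · exact Pi.single_eq_of_ne (fun e => h (hf.injOn hv hw e)) _
  refine equivalent_of_rep hx (y := ⟨n, (T.letters.map fun l => (l.map f).eval n).prod *
    iota n π * wens n (s + Pi.single (f p) 1 + Pi.single (f z) 1)⟩)
    ⟨f, π, s + Pi.single (f p) 1 + Pi.single (f z) 1, ?_, hπ,
    fun v hv => ?_, fun v hv => ?_, rfl⟩ ?_
  · rwa [← hn]
  · rw [h1 v (hn ▸ hv), hP v hv]
  · rw [hs v hv, Pi.add_apply, Pi.add_apply, h2 v (hn ▸ hv), single v (hn ▸ hv) p hp,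
      single v (hn ▸ hv) z hz]
  · rw [wens_add, wens_add, wens_single hfp, wens_single hfz, ← hL]
    set A := (S.letters.map fun l => (l.map f).eval n).prod with hA
    have hcA : Commute (tu n (f p)) A := by
      refine commute_list_prod fun y hy => ?_
      obtain ⟨l, hl, rfl⟩ := List.mem_map.1 hy
      refine PureLetter.tu_commute_eval hfp (S.letter_ok hf hl) ?_
      have h3 := hav l hl
      have h4 := S.ok l hl
      cases l with
      | tau c => exact fun e => h3 (hf.injOn h4 hp e)
      | chi δ c d => exact ⟨fun e => h3.1 (hf.injOn h4.1 hp e),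
          fun e => h3.2 (hf.injOn h4.2.1 hp e)⟩
    have hπz := iota_mul_tu hπ hfz
    rw [h1 z hz, hpz] at hπz
    -- The wen at the lower end of the strand of `z` climbs to its upper end, at `p = prev z`, and
    -- passes the letters, which avoid `p`. Recutting brings it to the bottom at `p`, where it
    -- cancels the other new wen.
    have e1 : A * iota n π * (wens n s * tu n (f p) * tu n (f z)) =
        tu n (f p) * (A * iota n π * wens n s * tu n (f p)) := by
      rw [mul_assoc (wens n s), (tu_comm (f p) (f z)).eq, ← mul_assoc (wens n s),
        ← (wens_commute_tu s (f z)).eq]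
      calc A * iota n π * (tu n (f z) * wens n s * tu n (f p))
          = A * (iota n π * tu n (f z)) * wens n s * tu n (f p) := by group
        _ = A * tu n (f p) * iota n π * wens n s * tu n (f p) := by rw [hπz]; group
        _ = _ := by rw [← hcA.eq]; group
    have e2 : A * iota n π * wens n s * tu n (f p) * tu n (f p) = x := by
      rw [mul_assoc, tu_mul_self, mul_one, hx']
    have h3 := markovEq_mul_comm (tu n (f p)) (A * iota n π * wens n s * tu n (f p))
    rw [← e1, e2] at h3
    exact h3.symm

/-- Insertion of a node `p` right after the node `a`: the strand at `a` is called `p` from some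
moment on. -/
theorem equivalent_of_insert {S T : State α} [DecidableEq α] {a p : α} (hp : p ∉ S.nodes)
    (ha : a ∈ S.nodes) (hn : T.nodes = insert p S.nodes) {L₁ L₂ : List (PureLetter α)}
    (hL : S.letters = L₁ ++ L₂) (hL' : T.letters = L₁ ++ L₂.map (PureLetter.map (swap a p)))
    (hPp : T.prev p = a) (hP : ∀ v ∈ S.nodes, T.prev v = swap a p (S.prev v))
    (hsp : T.sign p = 0) (hs : ∀ v ∈ S.nodes, T.sign v = S.sign v) : S.Equivalent T := by
  obtain ⟨⟨n, x⟩, hx⟩ := S.exists_rep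
  obtain ⟨f, π, s, hf, hπ, h1, h2, hx'⟩ := id hx
  dsimp only at hf hπ hx'
  have hfa : f a < n := hf.mapsTo ha
  -- The new node takes the new position on the right, which carries no wen.
  let f' : α → ℕ := Function.update f p n
  have hf'p : f' p = n := Function.update_self _ _ _
  have hf' : ∀ v ∈ S.nodes, f' v = f v := fun v hv =>
    Function.update_of_ne (fun e => by rw [e] at hv; exact hp hv) _ _
  have hne : ∀ v ∈ S.nodes, v ≠ p := fun v hv e => by rw [e] at hv; exact hp hv
  let s' : ℕ → ZMod 2 := Function.update s n 0
  have hs' : ∀ i < n, s' i = s i := fun i hi => Function.update_of_ne (by omega) _ _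
  have hsw : swap (f a) n ∈ lowPerm (n + 1) := swap_mem_lowPerm (by omega) (by omega)
  have hπ' : π ∈ lowPerm (n + 1) := lowPerm_mono (by omega) hπ
  have hswap : ∀ v ∈ S.nodes, f' (swap a p v) = swap (f a) n (f v) := by
    intro v hv
    by_cases h : v = a
    · rw [h, swap_apply_left, swap_apply_left, hf'p]
    · have : f v < n := hf.mapsTo hv
      rw [swap_apply_of_ne_of_ne h (hne v hv), swap_apply_of_ne_of_ne
        (fun e => h (hf.injOn hv ha e)) (by omega), hf' v hv]
  -- The extra transposition makes the strand of `a` end at `p`, and the strand that starts at `p`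
  -- continue as the strand of `a` did.
  refine equivalent_of_rep hx (y := ⟨n + 1, (T.letters.map fun l => (l.map f').eval (n + 1)).prod *
    iota (n + 1) (swap (f a) n * π) * wens (n + 1) s'⟩)
    ⟨f', swap (f a) n * π, s', ?_, mul_mem hsw hπ', ?_, ?_, rfl⟩ ?_
  · rw [hn]
    refine ⟨fun v hv => ?_, fun v hv w hw hvw => ?_, fun i hi => ?_⟩
    · rcases Finset.mem_insert.1 hv with rfl | hv
      · rw [hf'p]
        exact Nat.lt_succ_self n
      · rw [hf' v hv]
        exact (hf.mapsTo hv).trans (Nat.lt_succ_self n)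
    · rcases Finset.mem_insert.1 hv with ev | hv <;> rcases Finset.mem_insert.1 hw with ew | hw
      · rw [ev, ew]
      · have : f w < n := hf.mapsTo hw
        rw [ev, hf'p, hf' w hw] at hvw
        omega
      · have : f v < n := hf.mapsTo hv
        rw [ew, hf'p, hf' v hv] at hvw
        omega
      · rw [hf' v hv, hf' w hw] at hvw
        exact hf.injOn hv hw hvw
    · rcases eq_or_lt_of_le (Nat.lt_succ_iff.1 hi) with rfl | hi
      · exact ⟨p, by simp, hf'p⟩
      · obtain ⟨v, hv, rfl⟩ := hf.surjOn hi
        exact ⟨v, by simp [Finset.mem_coe.1 hv], hf' v hv⟩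
  · rw [hn]
    intro v hv
    rcases Finset.mem_insert.1 hv with rfl | hv
    · rw [hf'p, hPp, Perm.mul_apply, hπ n le_rfl, swap_apply_right, hf' a ha]
    · rw [hf' v hv, Perm.mul_apply, h1 v hv, hP v hv, hswap _ (S.bij.mapsTo hv)]
  · rw [hn]
    intro v hv
    rcases Finset.mem_insert.1 hv with rfl | hv
    · rw [hf'p, hsp]
      exact Function.update_self _ _ _
    · rw [hf' v hv, hs' _ (hf.mapsTo hv), h2 v hv, hs v hv]
  · have ok1 : ∀ l ∈ L₁, l.Ok (S.nodes : Set α) := fun l hl => S.ok l (by simp [hL, hl])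
    have ok2 : ∀ l ∈ L₂, l.Ok (S.nodes : Set α) := fun l hl => S.ok l (by simp [hL, hl])
    set A₁ := (L₁.map fun l => (l.map f).eval n).prod with hA₁
    set A₂ := (L₂.map fun l => (l.map f).eval n).prod with hA₂
    have c1 : (L₁.map fun l => (l.map f').eval (n + 1)).prod = addStrandHom n A₁ := by
      rw [hA₁, map_list_prod, List.map_map]
      congr 1
      refine List.map_congr_left fun l hl => ?_
      rw [Function.comp_apply, PureLetter.addStrandHom_eval ((ok1 l hl).map hf.mapsTo hf.injOn),
        PureLetter.map_congr (fun v hv => hf' v hv) (ok1 l hl)]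
    -- Pulling the transposition upwards through the later letters undoes their relabelling from `a`
    -- to `p`.
    have c2 : ((L₂.map (PureLetter.map (swap a p))).map fun l => (l.map f').eval (n + 1)).prod *
        iota (n + 1) (swap (f a) n) = iota (n + 1) (swap (f a) n) * addStrandHom n A₂ := by
      rw [hA₂, map_list_prod, List.map_map, List.map_map]
      refine (mul_list_prod_eq fun l hl => ?_).symm
      have hok := (ok2 l hl).map hf.mapsTo hf.injOn
      rw [Function.comp_apply, Function.comp_apply, PureLetter.addStrandHom_eval hok,
        PureLetter.iota_mul_eval hsw (hok.mono (Set.Iio_subset_Iio (Nat.le_succ n))),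
        PureLetter.map_map, PureLetter.map_map]
      congr 2
      exact PureLetter.map_congr (fun v hv => (hswap v hv).symm) (ok2 l hl)
    have c3 : addStrandHom n (wens n s) = wens (n + 1) s' := by
      rw [← addStrandHom_wens (n := n) (s := s') (Function.update_self _ _ _)]
      rw [wens_congr hs']
    have hx2 : x = A₁ * (A₂ * iota n π * wens n s) := by
      rw [hx', hL, List.map_append, List.prod_append, ← hA₁, ← hA₂]
      group
    -- The new braid is the old one with the transposition put between `L₁` and the rest. A cyclic
    -- rotation moves it to the end, where it is a stabilization.
    have hy : (T.letters.map fun l => (l.map f').eval (n + 1)).prod *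
        iota (n + 1) (swap (f a) n * π) * wens (n + 1) s' = addStrandHom n A₁ *
          (iota (n + 1) (swap (f a) n) * addStrandHom n (A₂ * iota n π * wens n s)) := by
      rw [hL', List.map_append, List.prod_append, c1, iota_mul hsw hπ', ← mul_assoc _ (iota _ _),
        mul_assoc _ _ (iota (n + 1) (swap (f a) n)), c2, ← c3, ← addStrandHom_iota hπ, map_mul,
        map_mul]
      group
    rw [hy, hx2]
    set B := A₂ * iota n π * wens n s
    have h3 := markovEq_mul_comm (iota (n + 1) (swap (f a) n))
      (addStrandHom n B * addStrandHom n A₁)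
    have h4 := markovEq_mul_comm (addStrandHom n A₁)
      (iota (n + 1) (swap (f a) n) * addStrandHom n B)
    rw [← map_mul] at h3
    rw [mul_assoc, ← map_mul] at h4
    exact (markovEq_mul_comm A₁ B).trans
      (h4.trans (h3.trans (markovEq_mul_swap _ hfa))).symm

/-- Erasing a node that is not involved in any letter and is not alone on its circle. -/
theorem equivalent_of_erase {S T : State α} [DecidableEq α] {p : α} (hp : p ∉ T.nodes)
    (hn : S.nodes = insert p T.nodes) (hL : T.letters = S.letters) (hpp : S.prev p ≠ p)
    (hP : ∀ v ∈ T.nodes, T.prev v = if S.prev v = p then S.prev p else S.prev v)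
    (hs : ∀ v ∈ T.nodes, T.sign v = if S.prev v = p then S.sign v + S.sign p else S.sign v) :
    S.Equivalent T := by
  have hpS : p ∈ S.nodes := by simp [hn]
  have hsub : ∀ v ∈ T.nodes, v ∈ S.nodes := fun v hv => by simp [hn, hv]
  have hne : ∀ v ∈ T.nodes, v ≠ p := fun v hv e => by rw [e] at hv; exact hp hv
  -- The node `z` is the one that follows `p`.
  obtain ⟨z, hz, hzp⟩ := S.bij.surjOn hpS
  have hzp' : z ≠ p := fun e => hpp (e ▸ hzp)
  have hav : ∀ l ∈ S.letters, l.Avoids p := fun l hl => by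
    have h := T.ok l (hL ▸ hl)
    cases l with
    | tau c => exact hne _ h
    | chi ε c d => exact ⟨hne _ h.1, hne _ h.2.1⟩
  -- The sign of `p` is transferred to `z`. Then `p` has sign zero, as a freshly inserted node must
  -- have.
  let S₁ : State α := ⟨S.nodes, S.letters, S.prev,
    fun v => S.sign v + (if v = p then S.sign p else 0) + if v = z then S.sign p else 0,
    S.bij, S.ok⟩
  have key : ∀ c : ZMod 2, c = 0 ∨ c = 1 := by decide
  have h1 : S.Equivalent S₁ := by
    rcases key (S.sign p) with h | h
    · refine equivalent_of_map id (Set.bijOn_id _) (fun _ _ => rfl) (fun v _ => ?_)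
        (.of_eq ?_) (.inr ?_)
      · simp [S₁, h]
      · exact (List.map_congr_left fun l _ => by cases l <;> rfl).trans (List.map_id _)
      · exact (List.map_congr_left fun l _ => by cases l <;> rfl).trans (List.map_id _)
    · exact equivalent_of_moveSign (p := p) (z := z) rfl rfl (fun _ _ => rfl) hpS hz hzp hav
        (fun v _ => by simp [S₁, h])
  refine h1.trans (Equivalent.symm ?_)
  -- Erasing `p` is an insertion read backwards. All letters come before it, so none is relabelled.
  refine equivalent_of_insert (a := S.prev p) (p := p) (L₁ := S.letters) (L₂ := []) hp ?_ hn
    (by simp [hL]) (by simp [S₁]) rfl (fun v hv => ?_) ?_ (fun v hv => ?_)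
  · have h2 := S.bij.mapsTo hpS
    rw [hn] at h2
    exact (Finset.mem_insert.1 h2).resolve_left hpp
  · change S.prev v = _
    rw [hP v hv]
    split_ifs with h
    · rw [swap_apply_left, h]
    · rw [swap_apply_of_ne_of_ne (fun e => ?_) h]
      exact hne v hv (S.bij.injOn (hsub v hv) hpS e)
  · have h2 : S.sign p + S.sign p = 0 := CharTwo.add_self_eq_zero _
    simp [S₁, hzp'.symm, h2]
  · rw [hs v hv]
    simp only [S₁, hne v hv, if_false, add_zero]
    by_cases h : v = z
    · simp [h, hzp]
    · have h3 : S.prev v ≠ p := fun e => h (S.bij.injOn (hsub v hv) hz (e.trans hzp.symm))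
      simp [h, h3]

end State

end States

/-! ### Nodes on circles of length one -/

section Circles

/-- The length of the way from `y` to `x` on the circle of length one, a number in `(0, 1]`. -/
noncomputable def gap (x y : ℝ) : ℝ := toIocMod one_pos 0 (x - y)

theorem gap_pos (x y : ℝ) : 0 < gap x y := (toIocMod_mem_Ioc one_pos 0 _).1

theorem gap_le_one (x y : ℝ) : gap x y ≤ 1 := by
  have h := (toIocMod_mem_Ioc (one_pos : (0 : ℝ) < 1) 0 (x - y)).2
  rwa [zero_add] at h

theorem exists_gap (x y : ℝ) : ∃ k : ℤ, x - y = gap x y + k := by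
  refine ⟨toIocDiv one_pos 0 (x - y), ?_⟩
  have := toIocMod_add_toIocDiv_zsmul (one_pos : (0 : ℝ) < 1) 0 (x - y)
  rw [zsmul_eq_mul, mul_one] at this
  exact this.symm

theorem int_eq_zero_of_abs_lt {k : ℤ} (h1 : (k : ℝ) < 1) (h2 : -1 < (k : ℝ)) : k = 0 := by
  have h1' : k < 1 := by exact_mod_cast h1
  have h2' : -1 < k := by exact_mod_cast h2
  omega

theorem gap_eq {x y r : ℝ} (h0 : 0 < r) (h1 : r ≤ 1) {k : ℤ} (h : x - y = r + k) : gap x y = r := by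
  obtain ⟨m, hm⟩ := exists_gap x y
  have hp := gap_pos x y
  have hl := gap_le_one x y
  have : m - k = 0 := int_eq_zero_of_abs_lt (by push_cast; linarith) (by push_cast; linarith)
  have : (m : ℝ) = k := by exact_mod_cast sub_eq_zero.1 this
  linarith

theorem gap_sub {x y z : ℝ} (h : gap x y < gap x z) : gap y z = gap x z - gap x y := by
  obtain ⟨k, hk⟩ := exists_gap x y
  obtain ⟨m, hm⟩ := exists_gap x z
  refine gap_eq (k := m - k) (by linarith) (by linarith [gap_pos x y, gap_le_one x z]) ?_
  push_cast
  linarith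

theorem gap_sub' {x y z : ℝ} (h : gap x z < gap y z) : gap y x = gap y z - gap x z := by
  obtain ⟨k, hk⟩ := exists_gap x z
  obtain ⟨m, hm⟩ := exists_gap y z
  refine gap_eq (k := m - k) (by linarith) (by linarith [gap_pos x z, gap_le_one y z]) ?_
  push_cast
  linarith

/-- The convention `(0, 1]` pays off here: a node alone on its circle precedes itself after a full
turn, and all wens of the circle are counted. -/
theorem gap_self (x : ℝ) : gap x x = 1 := gap_eq (k := -1) one_pos le_rfl (by simp)

theorem eq_of_gap_eq {x y z : ℝ} (hy : y ∈ Set.Ico (0 : ℝ) 1) (hz : z ∈ Set.Ico (0 : ℝ) 1)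
    (h : gap x y = gap x z) : y = z := by
  obtain ⟨k, hk⟩ := exists_gap x y
  obtain ⟨m, hm⟩ := exists_gap x z
  have : m - k = 0 := int_eq_zero_of_abs_lt (by push_cast; linarith [hy.1, hy.2, hz.1, hz.2])
    (by push_cast; linarith [hy.1, hy.2, hz.1, hz.2])
  have : (m : ℝ) = k := by exact_mod_cast sub_eq_zero.1 this
  linarith

theorem eq_of_gap_eq' {x y z : ℝ} (hy : y ∈ Set.Ico (0 : ℝ) 1) (hz : z ∈ Set.Ico (0 : ℝ) 1)
    (h : gap y x = gap z x) : y = z := by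
  obtain ⟨k, hk⟩ := exists_gap y x
  obtain ⟨m, hm⟩ := exists_gap z x
  have : m - k = 0 := int_eq_zero_of_abs_lt (by push_cast; linarith [hy.1, hy.2, hz.1, hz.2])
    (by push_cast; linarith [hy.1, hy.2, hz.1, hz.2])
  have : (m : ℝ) = k := by exact_mod_cast sub_eq_zero.1 this
  linarith

variable {J : Type*}

/-- The nodes have parameters in the fundamental domain `[0, 1)`. -/
def Normalized (V : Finset (J × ℝ)) : Prop := ∀ v ∈ V, v.2 ∈ Set.Ico (0 : ℝ) 1

theorem Normalized.mono {V V' : Finset (J × ℝ)} (h : Normalized V') (hV : V ⊆ V') :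
    Normalized V := fun v hv => h v (hV hv)

/-- The node `w` is the first one met when going backwards from `v`. -/
def IsPrev (V : Finset (J × ℝ)) (v w : J × ℝ) : Prop :=
  w ∈ V ∧ w.1 = v.1 ∧ ∀ w' ∈ V, w'.1 = v.1 → gap v.2 w.2 ≤ gap v.2 w'.2

theorem exists_isPrev {V : Finset (J × ℝ)} {v w : J × ℝ} (hw : w ∈ V) (h : w.1 = v.1) :
    ∃ w, IsPrev V v w := by
  classical
  obtain ⟨u, hu, hmin⟩ := Finset.exists_min_image (V.filter fun w => w.1 = v.1)
    (fun w => gap v.2 w.2) ⟨w, by simp [hw, h]⟩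
  rw [Finset.mem_filter] at hu
  exact ⟨u, hu.1, hu.2, fun w' hw' h' => hmin w' (by simp [hw', h'])⟩

theorem IsPrev.unique {V : Finset (J × ℝ)} (hV : Normalized V) {v w w' : J × ℝ}
    (h : IsPrev V v w) (h' : IsPrev V v w') : w = w' := by
  refine Prod.ext (h.2.1.trans h'.2.1.symm) ?_
  exact eq_of_gap_eq (hV w h.1) (hV w' h'.1)
    (le_antisymm (h.2.2 w' h'.1 h'.2.1) (h'.2.2 w h.1 h.2.1))

/-- If two nodes had the same predecessor, the one closer to it would lie between it and the other.
-/
theorem IsPrev.injective {V : Finset (J × ℝ)} (hV : Normalized V) {v v' w : J × ℝ} (hv : v ∈ V)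
    (hv' : v' ∈ V) (h : IsPrev V v w) (h' : IsPrev V v' w) : v = v' := by
  have hc : v.1 = v'.1 := h.2.1.symm.trans h'.2.1
  refine Prod.ext hc ?_
  rcases lt_trichotomy (gap v.2 w.2) (gap v'.2 w.2) with hlt | heq | hlt
  · have h1 := gap_sub' hlt
    have h2 := h'.2.2 v hv hc
    linarith [gap_pos v.2 w.2]
  · exact eq_of_gap_eq' (hV v hv) (hV v' hv') heq
  · have h1 := gap_sub' hlt
    have h2 := h.2.2 v' hv' hc.symm
    linarith [gap_pos v'.2 w.2]

open Classical in
/-- The previous node. -/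
noncomputable def prevNode (V : Finset (J × ℝ)) (v : J × ℝ) : J × ℝ :=
  if h : ∃ w, IsPrev V v w then h.choose else v

theorem isPrev_prevNode {V : Finset (J × ℝ)} {v : J × ℝ} (hv : v ∈ V) :
    IsPrev V v (prevNode V v) := by
  have h := exists_isPrev hv rfl
  rw [prevNode, dif_pos h]
  exact h.choose_spec

theorem IsPrev.eq_prevNode {V : Finset (J × ℝ)} (hV : Normalized V) {v w : J × ℝ} (hv : v ∈ V)
    (h : IsPrev V v w) : prevNode V v = w := (isPrev_prevNode hv).unique hV h

theorem bijOn_prevNode {V : Finset (J × ℝ)} (hV : Normalized V) :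
    Set.BijOn (prevNode V) V V := by
  have hm : Set.MapsTo (prevNode V) V V := fun v hv => (isPrev_prevNode hv).1
  have hi : Set.InjOn (prevNode V) V := fun v hv w hw h => by
    have h1 := isPrev_prevNode (V := V) hv
    rw [h] at h1
    exact h1.injective hV hv hw (isPrev_prevNode hw)
  exact ⟨hm, hi, Finset.surjOn_of_injOn_of_card_le _ hm hi le_rfl⟩

/-- The gap to the nearest node is already the maximal value `1`, so every node of the circle has
gap `1` and coincides with `v`. -/
theorem prevNode_eq_self {V : Finset (J × ℝ)} (hV : Normalized V) {v w : J × ℝ} (hv : v ∈ V)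
    (hw : w ∈ V) (h : w.1 = v.1) (hp : prevNode V v = v) : w = v := by
  have h1 := (isPrev_prevNode hv).2.2 w hw h
  rw [hp, gap_self] at h1
  refine Prod.ext h (eq_of_gap_eq (x := v.2) (hV w hw) (hV v hv) ?_)
  rw [gap_self]
  exact le_antisymm (gap_le_one _ _) h1

/-! ### Counting periodic marks along a circle -/

/-- A family of sets of parameters of period `1`. -/
structure Periodic (W : J → Set ℝ) : Prop where
  add_one : ∀ j t, t + 1 ∈ W j ↔ t ∈ W j
  finite : ∀ j, (W j ∩ Set.Ico 0 1).Finite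

theorem Periodic.add_int {W : J → Set ℝ} (hW : Periodic W) (j : J) (t : ℝ) (k : ℤ) :
    t + k ∈ W j ↔ t ∈ W j := by
  induction k using Int.induction_on with
  | zero => simp
  | succ k ih =>
    rw [← ih, ← hW.add_one j (t + ((k : ℕ) : ℤ))]
    push_cast
    rw [add_assoc]
  | pred k ih =>
    rw [← ih, ← hW.add_one j (t + (_ : ℤ))]
    push_cast
    ring_nf

theorem Periodic.finite_Ioc {W : J → Set ℝ} (hW : Periodic W) (j : J) (a b : ℝ) :
    (W j ∩ Set.Ioc a b).Finite := by
  have h : W j ∩ Set.Ioc a b ⊆ ⋃ k ∈ Set.Icc ⌊a⌋ ⌊b⌋, (fun t : ℝ => t + k) '' (W j ∩ Set.Ico 0 1) := by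
    rintro t ⟨ht, hat, htb⟩
    simp only [Set.mem_iUnion]
    refine ⟨⌊t⌋, ⟨Int.floor_le_floor hat.le, Int.floor_le_floor htb⟩, Int.fract t, ⟨?_, ?_⟩, ?_⟩
    · rw [← hW.add_int j _ ⌊t⌋, Int.fract_add_floor]
      exact ht
    · exact ⟨Int.fract_nonneg t, Int.fract_lt_one t⟩
    · exact Int.fract_add_floor t
  exact (Set.Finite.biUnion (Set.finite_Icc _ _) fun k _ => (hW.finite j).image _).subset h

/-- The number of elements of `W` in an interval. -/
noncomputable def countIoc (W : J → Set ℝ) (j : J) (a b : ℝ) : ℕ := (W j ∩ Set.Ioc a b).ncard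

theorem Periodic.countIoc_add {W : J → Set ℝ} (hW : Periodic W) (j : J) {a b c : ℝ} (hab : a ≤ b)
    (hbc : b ≤ c) : countIoc W j a c = countIoc W j a b + countIoc W j b c := by
  rw [countIoc, countIoc, countIoc, ← Set.ncard_union_eq _ (hW.finite_Ioc j a b)
    (hW.finite_Ioc j b c), ← Set.inter_union_distrib_left, Set.Ioc_union_Ioc_eq_Ioc hab hbc]
  refine Set.disjoint_left.2 ?_
  rintro t ⟨-, h1⟩ ⟨-, h2⟩
  exact absurd h1.2 (not_le.2 h2.1)

theorem Periodic.countIoc_add_int {W : J → Set ℝ} (hW : Periodic W) (j : J) (a b : ℝ) (k : ℤ) :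
    countIoc W j (a + k) (b + k) = countIoc W j a b := by
  have : W j ∩ Set.Ioc (a + k) (b + k) = (fun t : ℝ => t + k) '' (W j ∩ Set.Ioc a b) := by
    ext t
    constructor
    · rintro ⟨h1, h2, h3⟩
      refine ⟨t - k, ⟨?_, ?_, ?_⟩, by simp⟩
      · rw [← hW.add_int j _ k]
        simpa using h1
      · linarith
      · linarith
    · rintro ⟨u, ⟨h1, h2, h3⟩, rfl⟩
      exact ⟨(hW.add_int j _ k).2 h1, by simpa using h2, by simpa using h3⟩
  rw [countIoc, this, Set.ncard_image_of_injective _ (add_left_injective _), countIoc]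

theorem Periodic.countIoc_period {W : J → Set ℝ} (hW : Periodic W) (j : J) (a : ℝ) :
    countIoc W j a (a + 1) = (W j ∩ Set.Ico 0 1).ncard := by
  have h1 : countIoc W j a (a + 1) = countIoc W j 0 1 := by
    -- The interval is cut at the integer `⌊a⌋ + 1`, and the second piece is moved back by one
    -- period; together the pieces fill a unit interval between integers.
    have e1 := hW.countIoc_add j (a := a) (b := ⌊a⌋ + 1) (c := a + 1)
      (Int.lt_floor_add_one a).le (by linarith [Int.floor_le a])
    have e2 := hW.countIoc_add j (a := ⌊a⌋) (b := a) (c := ⌊a⌋ + 1) (Int.floor_le a)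
      (Int.lt_floor_add_one a).le
    have e3 := hW.countIoc_add_int j ⌊a⌋ a 1
    have e4 := hW.countIoc_add_int j 0 1 ⌊a⌋
    simp only [Int.cast_one, zero_add] at e3 e4
    rw [add_comm (1 : ℝ)] at e4
    omega
  rw [h1, countIoc]
  -- The half-open intervals differ in their end points only, and `1` is identified with `0` by
  -- periodicity.
  refine Set.ncard_congr (fun t _ => if t = 1 then 0 else t) ?_ ?_ ?_
  · rintro t ⟨ht, h0, h1⟩
    split_ifs with h
    · refine ⟨?_, le_rfl, one_pos⟩
      rw [← hW.add_one, zero_add, ← h]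
      exact ht
    · exact ⟨ht, h0.le, lt_of_le_of_ne h1 h⟩
  · rintro t u ⟨-, ht, -⟩ ⟨-, hu, -⟩ h
    split_ifs at h with h1 h2 h2
    · rw [h1, h2]
    · exact absurd hu (by rw [← h]; exact lt_irrefl _)
    · exact absurd ht (by rw [h]; exact lt_irrefl _)
    · exact h
  · rintro t ⟨ht, h0, h1⟩
    rcases eq_or_lt_of_le h0 with rfl | h0
    · refine ⟨1, ⟨?_, one_pos, le_rfl⟩, if_pos rfl⟩
      rw [← hW.add_one, zero_add] at ht
      exact ht
    · exact ⟨t, ⟨ht, h0, h1.le⟩, if_neg h1.ne⟩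

/-- The parity of the number of elements of `W` on the way from the previous node to `v`. -/
noncomputable def wenSign (W : J → Set ℝ) (V : Finset (J × ℝ)) (v : J × ℝ) : ZMod 2 :=
  countIoc W v.1 (v.2 - gap v.2 (prevNode V v).2) v.2

/-- If all wens are nodes, the sign of a node tells whether it is a wen. -/
theorem wenSign_of_subset {W : J → Set ℝ} (hW : Periodic W) {V : Finset (J × ℝ)}
    (hWV : ∀ j, ∀ t ∈ W j, t ∈ Set.Ico (0 : ℝ) 1 → (j, t) ∈ V) {v : J × ℝ} (hv : v ∈ V)
    [Decidable (v.2 ∈ W v.1)] : wenSign W V v = if v.2 ∈ W v.1 then 1 else 0 := by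
  have hprev := isPrev_prevNode hv
  set g := gap v.2 (prevNode V v).2 with hg
  have hg0 : 0 < g := gap_pos _ _
  have hsub : W v.1 ∩ Set.Ioc (v.2 - g) v.2 = W v.1 ∩ {v.2} := by
    ext t
    constructor
    · rintro ⟨ht, h1, h2⟩
      refine ⟨ht, ?_⟩
      by_contra hne
      have hlt : t < v.2 := lt_of_le_of_ne h2 hne
      -- A wen strictly between the previous node and `v` would itself be a node, closer to `v` than
      -- the previous one.
      have hf : Int.fract t ∈ W v.1 := by
        rw [← hW.add_int v.1 _ ⌊t⌋, Int.fract_add_floor]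
        exact ht
      have hmem := hWV _ _ hf ⟨Int.fract_nonneg t, Int.fract_lt_one t⟩
      have h3 := hprev.2.2 _ hmem rfl
      have h4 : gap v.2 (Int.fract t) = v.2 - t := by
        refine gap_eq (k := ⌊t⌋) (by linarith) ?_ ?_
        · have := gap_le_one v.2 (prevNode V v).2
          linarith
        · rw [← Int.self_sub_floor]
          ring
      simp only [h4] at h3
      linarith
    · rintro ⟨ht, rfl⟩
      exact ⟨ht, by linarith, le_rfl⟩
  rw [wenSign, countIoc, hsub]
  split_ifs with h
  · rw [Set.inter_eq_right.2 (Set.singleton_subset_iff.2 h), Set.ncard_singleton, Nat.cast_one]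
  · rw [Set.inter_singleton_eq_empty.2 h, Set.ncard_empty, Nat.cast_zero]

variable [DecidableEq (J × ℝ)]

/-- The new node `p` cuts the arc that ends at `v` into two. The hypothesis `hpp` says that `p` is
not alone on its circle, so an old node precedes it. -/
theorem gap_prevNode_insert {V : Finset (J × ℝ)} {p v : J × ℝ} (hV : Normalized (insert p V))
    (hp : p ∉ V) (hpp : prevNode (insert p V) p ≠ p) (hv : v ∈ V)
    (h : prevNode (insert p V) v = p) :
    prevNode V v = prevNode (insert p V) p ∧
      gap v.2 (prevNode V v).2 = gap v.2 p.2 + gap p.2 (prevNode (insert p V) p).2 := by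
  have h1 := isPrev_prevNode (V := insert p V) (v := v) (by simp [hv])
  have h2 := isPrev_prevNode (V := insert p V) (v := p) (by simp)
  rw [h] at h1
  set q := prevNode (insert p V) p with hq
  have hqV : q ∈ V := (Finset.mem_insert.1 h2.1).resolve_left hpp
  have hlt : ∀ w ∈ V, w.1 = v.1 → gap v.2 p.2 < gap v.2 w.2 := by
    intro w hw hwv
    refine lt_of_le_of_ne (h1.2.2 w (by simp [hw]) hwv) fun e => hp ?_
    have : p = w := Prod.ext (h1.2.1.trans hwv.symm)
      (eq_of_gap_eq (hV p (by simp)) (hV w (by simp [hw])) e)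
    rwa [this]
  have hqv : q.1 = v.1 := h2.2.1.trans h1.2.1
  have hgq := gap_sub (hlt q hqV hqv)
  have hprev : IsPrev V v q := by
    refine ⟨hqV, hqv, fun w hw hwv => ?_⟩
    have h3 := h2.2.2 w (by simp [hw]) (hwv.trans h1.2.1.symm)
    have h4 := gap_sub (hlt w hw hwv)
    linarith
  have he := hprev.eq_prevNode (hV.mono (Finset.subset_insert _ _)) hv
  rw [he]
  exact ⟨rfl, by linarith⟩

theorem prevNode_insert_of_ne {V : Finset (J × ℝ)} {p v : J × ℝ} (hV : Normalized (insert p V))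
    (hv : v ∈ V) (h : prevNode (insert p V) v ≠ p) : prevNode V v = prevNode (insert p V) v := by
  have h1 := isPrev_prevNode (V := insert p V) (v := v) (by simp [hv])
  exact IsPrev.eq_prevNode (hV.mono (Finset.subset_insert _ _)) hv
    ⟨(Finset.mem_insert.1 h1.1).resolve_left h, h1.2.1, fun w hw => h1.2.2 w (by simp [hw])⟩

theorem wenSign_insert {W : J → Set ℝ} (hW : Periodic W) {V : Finset (J × ℝ)} {p v : J × ℝ}
    (hV : Normalized (insert p V)) (hp : p ∉ V) (hpp : prevNode (insert p V) p ≠ p) (hv : v ∈ V)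
    (h : prevNode (insert p V) v = p) :
    wenSign W V v = wenSign W (insert p V) v + wenSign W (insert p V) p := by
  obtain ⟨h1, h2⟩ := gap_prevNode_insert hV hp hpp hv h
  have h3 := (isPrev_prevNode (V := insert p V) (v := v) (by simp [hv])).2.1
  rw [h] at h3
  obtain ⟨k, hk⟩ := exists_gap v.2 p.2
  have hg1 := gap_pos v.2 p.2
  have hg2 := gap_pos p.2 (prevNode (insert p V) p).2
  rw [wenSign, wenSign, wenSign, h, h2, ← Nat.cast_add,
    hW.countIoc_add v.1 (a := v.2 - (gap v.2 p.2 + gap p.2 (prevNode (insert p V) p).2))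
      (b := v.2 - gap v.2 p.2) (by linarith) (by linarith), add_comm]
  congr 2
  -- The parameter of `p` and the point at distance `gap v.2 p.2` before `v` agree only up to the
  -- integer `k`.
  rw [h3, ← hW.countIoc_add_int v.1 _ p.2 k]
  congr 1 <;> linarith

/-- The state given by finitely many nodes on the circles of an arrangement with wens `W`. -/
noncomputable def circleState (W : J → Set ℝ) (V : Finset (J × ℝ)) (hV : Normalized V)
    (L : List (PureLetter (J × ℝ))) (hL : ∀ l ∈ L, l.Ok (V : Set (J × ℝ))) : State (J × ℝ) where
  nodes := V
  letters := L
  prev := prevNode V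
  sign := wenSign W V
  bij := bijOn_prevNode hV
  ok := hL

/-- Nodes that are not involved in any letter can be erased, if a node remains on each circle. -/
theorem circleState_equivalent_of_subset {W : J → Set ℝ} (hW : Periodic W) {V A : Finset (J × ℝ)}
    (hV : Normalized V) (hVA : Normalized (A ∪ V)) {L : List (PureLetter (J × ℝ))}
    (hL : ∀ l ∈ L, l.Ok (V : Set (J × ℝ))) (hL' : ∀ l ∈ L, l.Ok (↑(A ∪ V) : Set (J × ℝ)))
    (hA : ∀ a ∈ A, ∃ v ∈ V, v.1 = a.1) :
    (circleState W (A ∪ V) hVA L hL').Equivalent (circleState W V hV L hL) := by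
  induction A using Finset.induction_on with
  | empty =>
    have : (∅ ∪ V : Finset (J × ℝ)) = V := Finset.empty_union V
    intro x y hx hy
    simp only [this] at hx
    exact hx.markovEq hy
  | insert p A hpA ih =>
    have hins : insert p A ∪ V = insert p (A ∪ V) := Finset.insert_union p A V
    have hVA' : Normalized (A ∪ V) := hVA.mono (by rw [hins]; exact Finset.subset_insert _ _)
    have hL'' : ∀ l ∈ L, l.Ok (↑(A ∪ V) : Set (J × ℝ)) := fun l hl =>
      (hL l hl).mono (by simp)
    refine State.Equivalent.trans ?_ (ih hVA' hL'' fun a ha => hA a (by simp [ha]))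
    by_cases hp : p ∈ A ∪ V
    · have : insert p A ∪ V = A ∪ V := by rw [hins, Finset.insert_eq_of_mem hp]
      intro x y hx hy
      simp only [this] at hx
      exact hx.markovEq hy
    have hN : Normalized (insert p (A ∪ V)) := hins ▸ hVA
    -- Some node of `V` lies on the circle of `p`; if `p` preceded itself, it would be that node.
    have hpp : prevNode (insert p (A ∪ V)) p ≠ p := by
      intro h
      obtain ⟨v, hv, hvp⟩ := hA p (by simp)
      have := prevNode_eq_self hN (by simp) (w := v) (by simp [hv]) hvp h
      exact hp (by simp [← this, hv])
    refine State.equivalent_of_erase (p := p) hp hins rfl ?_ (fun v hv => ?_) (fun v hv => ?_)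
    · simpa only [circleState, hins] using hpp
    · simp only [circleState, hins]
      split_ifs with h
      · exact (gap_prevNode_insert hN hp hpp hv h).1
      · exact prevNode_insert_of_ne hN hv h
    · simp only [circleState, hins]
      split_ifs with h
      · exact wenSign_insert hW hN hp hpp hv h
      · rw [wenSign, wenSign, prevNode_insert_of_ne hN hv h]

end Circles

/-! ### The Gauss data of a diagram -/

section Gauss

theorem cross_self (a : ℂ) : cross a a = 0 := by
  unfold cross
  ring

theorem cross_swap (a b : ℂ) : cross a b = -cross b a := by
  unfold cross
  ring

theorem cross_smul_smul (r s : ℝ) (a b : ℂ) : cross (r • a) (s • b) = r * s * cross a b := by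
  simp only [cross, Complex.real_smul, Complex.mul_re, Complex.mul_im, Complex.ofReal_re,
    Complex.ofReal_im]
  ring

/-- The representative of a point of a circle with parameter in `[0, 1)`. -/
noncomputable def toDomain {m : ℕ} (x : Fin m × ℝ) : Fin m × ℝ := (x.1, Int.fract x.2)

theorem toDomain_mem {m : ℕ} (x : Fin m × ℝ) : (toDomain x).2 ∈ Set.Ico (0 : ℝ) 1 :=
  ⟨Int.fract_nonneg _, Int.fract_lt_one _⟩

theorem toDomain_eq_self {m : ℕ} {x : Fin m × ℝ} (h : x.2 ∈ Set.Ico (0 : ℝ) 1) :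
    toDomain x = x := Prod.ext rfl (Int.fract_eq_self.2 h)

theorem samePoint_iff {m : ℕ} {x y : Fin m × ℝ} : SamePoint x y ↔ toDomain x = toDomain y := by
  unfold SamePoint toDomain
  rw [Prod.ext_iff]
  refine and_congr_right fun _ => ?_
  rw [eq_comm, Int.fract_eq_fract]
  exact exists_congr fun k => by constructor <;> intro h <;> linarith

theorem samePoint_toDomain {m : ℕ} (x : Fin m × ℝ) : SamePoint (toDomain x) x := by
  rw [samePoint_iff, toDomain_eq_self (toDomain_mem x)]

namespace LinkDiagram

variable (K : LinkDiagram)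

theorem curve_add_int (j : Fin K.numComp) (t : ℝ) (k : ℤ) : K.curve j (t + k) = K.curve j t := by
  have h : Function.Periodic (K.curve j) 1 := K.periodic j
  simpa using h.int_mul k t

theorem deriv_add_int (j : Fin K.numComp) (t : ℝ) (k : ℤ) :
    deriv (K.curve j) (t + k) = deriv (K.curve j) t := by
  rw [← deriv_comp_add_const]
  congr 1
  exact funext fun t => K.curve_add_int j t k

theorem curve_eq_of_samePoint {x y : Fin K.numComp × ℝ} (h : SamePoint x y) :
    K.curve x.1 x.2 = K.curve y.1 y.2 := by
  obtain ⟨h1, k, hk⟩ := h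
  rw [hk, ← h1, K.curve_add_int]

theorem deriv_eq_of_samePoint {x y : Fin K.numComp × ℝ} (h : SamePoint x y) :
    deriv (K.curve x.1) x.2 = deriv (K.curve y.1) y.2 := by
  obtain ⟨h1, k, hk⟩ := h
  rw [hk, ← h1, K.deriv_add_int]

theorem curve_toDomain (x : Fin K.numComp × ℝ) :
    K.curve (toDomain x).1 (toDomain x).2 = K.curve x.1 x.2 :=
  K.curve_eq_of_samePoint (samePoint_toDomain x)

theorem deriv_toDomain (x : Fin K.numComp × ℝ) :
    deriv (K.curve (toDomain x).1) (toDomain x).2 = deriv (K.curve x.1) x.2 :=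
  K.deriv_eq_of_samePoint (samePoint_toDomain x)

theorem periodic_wen : Periodic K.wen := ⟨K.wen_periodic, K.wen_finite⟩

theorem eq_of_domain {x y : Fin K.numComp × ℝ} (hx : x.2 ∈ Set.Ico (0 : ℝ) 1)
    (hy : y.2 ∈ Set.Ico (0 : ℝ) 1) (h : SamePoint x y) : x = y := by
  rwa [samePoint_iff, toDomain_eq_self hx, toDomain_eq_self hy] at h

/-- The branches at the real crossings. -/
def ports : Set (Fin K.numComp × ℝ) :=
  {x | x.2 ∈ Set.Ico (0 : ℝ) 1 ∧ K.curve x.1 x.2 ∈ K.realCrossings}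

theorem toDomain_mem_ports {x : Fin K.numComp × ℝ} (h : K.curve x.1 x.2 ∈ K.realCrossings) :
    toDomain x ∈ K.ports := ⟨toDomain_mem x, by rwa [curve_toDomain]⟩

theorem eq_or_eq_of_curve_eq {x y z : Fin K.numComp × ℝ} (hx : x.2 ∈ Set.Ico (0 : ℝ) 1)
    (hy : y.2 ∈ Set.Ico (0 : ℝ) 1) (hz : z.2 ∈ Set.Ico (0 : ℝ) 1) (hxy : x ≠ y)
    (h1 : K.curve x.1 x.2 = K.curve y.1 y.2) (h2 : K.curve x.1 x.2 = K.curve z.1 z.2) :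
    z = x ∨ z = y := by
  by_contra! h
  exact K.no_triple x y z (fun e => hxy (K.eq_of_domain hx hy e))
    (fun e => h.2 (K.eq_of_domain hy hz e).symm) (fun e => h.1 (K.eq_of_domain hx hz e).symm)
    ⟨h1, h1.symm.trans h2⟩

theorem cross_ne_zero {x y : Fin K.numComp × ℝ} (hx : x.2 ∈ Set.Ico (0 : ℝ) 1)
    (hy : y.2 ∈ Set.Ico (0 : ℝ) 1) (hxy : x ≠ y) (h : K.curve x.1 x.2 = K.curve y.1 y.2) :
    cross (deriv (K.curve x.1) x.2) (deriv (K.curve y.1) y.2) ≠ 0 :=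
  K.transverse x y (fun e => hxy (K.eq_of_domain hx hy e)) h

theorem exists_other_branch {p : ℂ} (hp : p ∈ K.doublePoints) (x : Fin K.numComp × ℝ) :
    ∃ y : Fin K.numComp × ℝ, y.2 ∈ Set.Ico (0 : ℝ) 1 ∧ y ≠ x ∧ K.curve y.1 y.2 = p := by
  obtain ⟨y, z, hyz, hy, hz⟩ := hp
  by_cases h : toDomain y = x
  · refine ⟨toDomain z, toDomain_mem z, fun e => hyz ?_, by rw [curve_toDomain, hz]⟩
    rw [samePoint_iff, h, e]
  · exact ⟨toDomain y, toDomain_mem y, h, by rw [curve_toDomain, hy]⟩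

theorem finite_fiber (p : ℂ) :
    {x : Fin K.numComp × ℝ | x.2 ∈ Set.Ico (0 : ℝ) 1 ∧ K.curve x.1 x.2 = p}.Finite := by
  by_cases h : ∃ x y : Fin K.numComp × ℝ, x.2 ∈ Set.Ico (0 : ℝ) 1 ∧ y.2 ∈ Set.Ico (0 : ℝ) 1 ∧
      x ≠ y ∧ K.curve x.1 x.2 = p ∧ K.curve y.1 y.2 = p
  · obtain ⟨x, y, hx, hy, hxy, hxp, hyp⟩ := h
    refine (Set.toFinite {x, y}).subset ?_
    rintro z ⟨hz, hzp⟩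
    exact K.eq_or_eq_of_curve_eq hx hy hz hxy (hxp.trans hyp.symm) (hxp.trans hzp.symm)
  · push Not at h
    refine Set.Subsingleton.finite ?_
    rintro x ⟨hx, hxp⟩ y ⟨hy, hyp⟩
    by_contra hxy
    exact h x y hx hy hxy hxp hyp

theorem finite_ports : K.ports.Finite := by
  refine ((K.finite_double.biUnion fun p _ => K.finite_fiber p)).subset ?_
  rintro x ⟨hx, hx'⟩
  simp only [Set.mem_iUnion]
  exact ⟨_, hx'.1, hx, rfl⟩

/-- The exponent of `σ` at a double point with the given decoration. -/
def _root_.ExtWelded.Decoration.sgn : Decoration → ℤ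
  | .pos => 1
  | .neg => -1
  | .welded => 0

/-- The letters of the real crossings: the first strand is the one that crosses the other strand
from left to right. -/
def crossingLetters : Set (PureLetter (Fin K.numComp × ℝ)) :=
  {l | ∃ x ∈ K.ports, ∃ y ∈ K.ports, K.curve x.1 x.2 = K.curve y.1 y.2 ∧
    0 < cross (deriv (K.curve y.1) y.2) (deriv (K.curve x.1) x.2) ∧
    l = .chi (K.deco (K.curve x.1 x.2)).sgn x y}

theorem finite_crossingLetters : K.crossingLetters.Finite := by
  refine ((K.finite_ports.prod K.finite_ports).image fun xy : (Fin K.numComp × ℝ) × _ =>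
    PureLetter.chi (K.deco (K.curve xy.1.1 xy.1.2)).sgn xy.1 xy.2).subset ?_
  rintro l ⟨x, hx, y, hy, -, -, rfl⟩
  exact ⟨(x, y), ⟨hx, hy⟩, rfl⟩

theorem crossingLetters_ok {l : PureLetter (Fin K.numComp × ℝ)} (hl : l ∈ K.crossingLetters) :
    l.Ok K.ports := by
  obtain ⟨x, hx, y, hy, -, h, rfl⟩ := hl
  refine ⟨hx, hy, fun e => ?_⟩
  rw [e, cross_self] at h
  exact lt_irrefl _ h

/-- A real crossing has exactly two branches, and the sign of `cross` fixes their order, so it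
yields one letter only. Different letters belong to different crossings and share no branch. -/
theorem crossingLetters_disj {l l' : PureLetter (Fin K.numComp × ℝ)} (hl : l ∈ K.crossingLetters)
    (hl' : l' ∈ K.crossingLetters) (hne : l ≠ l') : l.Disj l' := by
  have hok := K.crossingLetters_ok hl
  have hok' := K.crossingLetters_ok hl'
  obtain ⟨x, hx, y, hy, hxy, h, rfl⟩ := hl
  obtain ⟨z, hz, w, hw, hzw, h', rfl⟩ := hl'
  have hxy' : x ≠ y := hok.2.2
  have hzw' : z ≠ w := hok'.2.2
  have flip : ¬ (z = y ∧ w = x) := by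
    rintro ⟨rfl, rfl⟩
    rw [cross_swap] at h
    linarith
  have same : ¬ (z = x ∧ w = y) := by
    rintro ⟨rfl, rfl⟩
    exact hne rfl
  have key : K.curve x.1 x.2 ≠ K.curve z.1 z.2 := by
    intro e
    have h1 := K.eq_or_eq_of_curve_eq hx.1 hy.1 hz.1 hxy' hxy e
    have h2 := K.eq_or_eq_of_curve_eq hx.1 hy.1 hw.1 hxy' hxy (e.trans hzw)
    rcases h1 with rfl | rfl <;> rcases h2 with rfl | rfl
    · exact hzw' rfl
    · exact same ⟨rfl, rfl⟩
    · exact flip ⟨rfl, rfl⟩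
    · exact hzw' rfl
  refine ⟨⟨?_, ?_⟩, ?_, ?_⟩ <;> rintro rfl
  · exact key rfl
  · exact key hzw.symm
  · exact key hxy
  · exact key (hxy.trans hzw.symm)

open Classical in
/-- The branches at the real crossings, and one base point on each component without real
crossings. -/
noncomputable def gaussNodes (base : Fin K.numComp → ℝ) : Finset (Fin K.numComp × ℝ) :=
  K.finite_ports.toFinset ∪ (Finset.univ.filter (· ∈ K.loops)).image fun j => (j, base j)

theorem mem_gaussNodes {base : Fin K.numComp → ℝ} {v : Fin K.numComp × ℝ} :
    v ∈ K.gaussNodes base ↔ v ∈ K.ports ∨ v.1 ∈ K.loops ∧ v.2 = base v.1 := by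
  classical
  simp only [gaussNodes, Finset.mem_union, Set.Finite.mem_toFinset, Finset.mem_image,
    Finset.mem_filter, Finset.mem_univ, true_and]
  refine or_congr_right ⟨?_, ?_⟩
  · rintro ⟨j, hj, rfl⟩
    exact ⟨hj, rfl⟩
  · rintro ⟨h, h'⟩
    exact ⟨v.1, h, Prod.ext rfl h'.symm⟩

theorem notMem_loops_of_mem_ports {v : Fin K.numComp × ℝ} (h : v ∈ K.ports) : v.1 ∉ K.loops :=
  fun h' => h' v.2 h.2

theorem normalized_gaussNodes {base : Fin K.numComp → ℝ}
    (hbase : ∀ j, base j ∈ Set.Ico (0 : ℝ) 1) : Normalized (K.gaussNodes base) := by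
  intro v hv
  rcases K.mem_gaussNodes.1 hv with h | ⟨-, h⟩
  · exact h.1
  · rw [h]
    exact hbase _

/-- The state given by the real crossings of the diagram and the arcs between them. -/
noncomputable def gaussState (base : Fin K.numComp → ℝ)
    (hbase : ∀ j, base j ∈ Set.Ico (0 : ℝ) 1) : State (Fin K.numComp × ℝ) :=
  circleState K.wen (K.gaussNodes base) (K.normalized_gaussNodes hbase)
    K.finite_crossingLetters.toFinset.toList fun l hl =>
      (K.crossingLetters_ok (by simpa using hl)).mono fun _ hv =>
        K.mem_gaussNodes.2 (Or.inl hv)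

theorem realCrossings_add_int {j : Fin K.numComp} {t : ℝ} (k : ℤ) :
    K.curve j (t + k) ∈ K.realCrossings ↔ K.curve j t ∈ K.realCrossings := by
  rw [K.curve_add_int]

/-- The previous node of a port is joined to it by an arc. -/
theorem isArc_prevNode {base : Fin K.numComp → ℝ} {v : Fin K.numComp × ℝ} (hv : v ∈ K.ports) :
    prevNode (K.gaussNodes base) v ∈ K.ports ∧
      (prevNode (K.gaussNodes base) v).1 = v.1 ∧
      K.IsArc v.1 (v.2 - gap v.2 (prevNode (K.gaussNodes base) v).2) v.2 := by
  have h := isPrev_prevNode (K.mem_gaussNodes (base := base).2 (Or.inl hv))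
  set w := prevNode (K.gaussNodes base) v
  have hw : w ∈ K.ports := by
    rcases K.mem_gaussNodes.1 h.1 with h1 | ⟨h1, -⟩
    · exact h1
    · rw [h.2.1] at h1
      exact absurd h1 (K.notMem_loops_of_mem_ports hv)
  refine ⟨hw, h.2.1, ?_, ?_, hv.2, ?_⟩
  · linarith [gap_pos v.2 w.2]
  · obtain ⟨k, hk⟩ := exists_gap v.2 w.2
    have : v.2 - gap v.2 w.2 = w.2 + k := by linarith
    rw [this, K.realCrossings_add_int, ← h.2.1]
    exact hw.2
  · intro t h1 h2 ht
    have hm : toDomain (v.1, t) ∈ K.ports := K.toDomain_mem_ports ht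
    have h3 := h.2.2 _ (K.mem_gaussNodes.2 (Or.inl hm)) rfl
    have h4 : gap v.2 (toDomain (v.1, t)).2 = v.2 - t := by
      refine gap_eq (k := ⌊t⌋) (by linarith) (by linarith [gap_le_one v.2 w.2]) ?_
      change v.2 - Int.fract t = _
      rw [← Int.self_sub_floor]
      ring
    rw [h4] at h3
    linarith

theorem wen_notMem_of_realCrossing {j : Fin K.numComp} {t : ℝ}
    (h : K.curve j t ∈ K.realCrossings) : t ∉ K.wen j := fun h' => K.wen_not_double j t h' h.1

/-- The right end of the interval is a crossing, where no wen mark can be, so including it does not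
change the count. -/
theorem countIoc_wen {j : Fin K.numComp} {s t : ℝ} (h : K.curve j t ∈ K.realCrossings) :
    countIoc K.wen j s t = K.wensBetween j s t := by
  rw [countIoc, wensBetween]
  congr 1
  ext u
  refine and_congr_right fun hu => ⟨fun h' => ⟨h'.1, lt_of_le_of_ne h'.2 ?_⟩,
    fun h' => ⟨h'.1, h'.2.le⟩⟩
  rintro rfl
  exact K.wen_notMem_of_realCrossing h hu

/-- An arc leads from the previous node to a port. -/
theorem IsArc.prevNode_eq {K : LinkDiagram} {base : Fin K.numComp → ℝ}
    (hbase : ∀ j, base j ∈ Set.Ico (0 : ℝ) 1) {j : Fin K.numComp} {s s' : ℝ}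
    (h : K.IsArc j s s') :
    prevNode (K.gaussNodes base) (toDomain (j, s')) = toDomain (j, s) ∧
      wenSign K.wen (K.gaussNodes base) (toDomain (j, s')) = K.wensBetween j s s' := by
  obtain ⟨hss, hs, hs', hno⟩ := h
  have hv : toDomain (j, s') ∈ K.ports := K.toDomain_mem_ports hs'
  have hw : toDomain (j, s) ∈ K.ports := K.toDomain_mem_ports hs
  -- The crossing at `s` is met again at `s + 1`, so an arc cannot be longer than the circle.
  have hle : s' ≤ s + 1 := by
    by_contra hlt
    refine hno (s + 1) (by linarith) (by linarith) ?_
    rw [K.periodic]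
    exact hs
  have hgap : gap (toDomain (j, s')).2 (toDomain (j, s)).2 = s' - s := by
    refine gap_eq (k := ⌊s⌋ - ⌊s'⌋) (by linarith) (by linarith) ?_
    change Int.fract s' - Int.fract s = _
    rw [← Int.self_sub_floor, ← Int.self_sub_floor]
    push_cast
    ring
  have hprev : IsPrev (K.gaussNodes base) (toDomain (j, s')) (toDomain (j, s)) := by
    refine ⟨K.mem_gaussNodes.2 (Or.inl hw), rfl, fun w hw' hwj => ?_⟩
    rw [hgap]
    -- A closer node would be either a real crossing inside the arc or a base point on a component
    -- with real crossings; both are impossible.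
    by_contra! hlt
    rcases K.mem_gaussNodes.1 hw' with h1 | ⟨h1, -⟩
    · obtain ⟨k, hk⟩ := exists_gap (toDomain (j, s')).2 w.2
      change Int.fract s' - w.2 = _ at hk
      rw [← Int.self_sub_floor] at hk
      have hg := gap_pos (toDomain (j, s')).2 w.2
      refine hno (s' - gap (toDomain (j, s')).2 w.2) (by linarith) (by linarith) ?_
      have e : s' - gap (toDomain (j, s')).2 w.2 = w.2 + ((k + ⌊s'⌋ : ℤ) : ℝ) := by
        push_cast
        linarith
      have hwj' : w.1 = j := hwj
      rw [e, K.realCrossings_add_int, ← hwj']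
      exact h1.2
    · rw [hwj] at h1
      exact K.notMem_loops_of_mem_ports hv h1
  have he := hprev.eq_prevNode (K.normalized_gaussNodes hbase) (K.mem_gaussNodes.2 (Or.inl hv))
  refine ⟨he, ?_⟩
  rw [wenSign, he, hgap, ← K.countIoc_wen hs']
  congr 1
  have h1 := K.periodic_wen.countIoc_add_int j (Int.fract s' - (s' - s)) (Int.fract s') ⌊s'⌋
  rw [Int.fract_add_floor] at h1
  change countIoc K.wen j (Int.fract s' - (s' - s)) (Int.fract s') = _
  rw [← h1]
  congr 1
  have := Int.fract_add_floor s'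
  linarith

/-- The base point is the only node on a loop, so its sign is the parity of all wens there, which is
even. This is why loops may correspond in any way. -/
theorem prevNode_loop {base : Fin K.numComp → ℝ} (hbase : ∀ j, base j ∈ Set.Ico (0 : ℝ) 1)
    {v : Fin K.numComp × ℝ} (hv : v ∈ K.gaussNodes base) (hl : v.1 ∈ K.loops) :
    prevNode (K.gaussNodes base) v = v ∧ wenSign K.wen (K.gaussNodes base) v = 0 := by
  have hN := K.normalized_gaussNodes hbase
  have h : ∀ w ∈ K.gaussNodes base, w.1 = v.1 → w = v := by
    intro w hw hwv
    have key : ∀ u ∈ K.gaussNodes base, u.1 ∈ K.loops → u.2 = base u.1 := by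
      intro u hu hul
      rcases K.mem_gaussNodes.1 hu with h1 | ⟨-, h1⟩
      · exact absurd hul (K.notMem_loops_of_mem_ports h1)
      · exact h1
    refine Prod.ext hwv ?_
    rw [key w hw (hwv ▸ hl), key v hv hl, hwv]
  have hp := isPrev_prevNode hv
  have he : prevNode (K.gaussNodes base) v = v := h _ hp.1 hp.2.1
  refine ⟨he, ?_⟩
  rw [wenSign, he, gap_self]
  have h1 := K.periodic_wen.countIoc_period v.1 (v.2 - 1)
  rw [sub_add_cancel] at h1
  rw [h1]
  exact (ZMod.natCast_eq_zero_iff_even).2 (K.wen_even v.1)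

end LinkDiagram

/-! ### Comparison of Gauss data -/

/-- A correspondence between the real crossings of two diagrams that respects signs, arcs and the
parity of the numbers of wens on them. -/
structure GaussMap (K L : LinkDiagram) (ψ : Fin K.numComp × ℝ → Fin L.numComp × ℝ) : Prop where
  bij : Set.BijOn ψ K.ports L.ports
  curve_eq : ∀ x ∈ K.ports, ∀ y ∈ K.ports, K.curve x.1 x.2 = K.curve y.1 y.2 →
    L.curve (ψ x).1 (ψ x).2 = L.curve (ψ y).1 (ψ y).2
  cross_pos : ∀ x ∈ K.ports, ∀ y ∈ K.ports, K.curve x.1 x.2 = K.curve y.1 y.2 →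
    0 < cross (deriv (K.curve x.1) x.2) (deriv (K.curve y.1) y.2) →
    0 < cross (deriv (L.curve (ψ x).1) (ψ x).2) (deriv (L.curve (ψ y).1) (ψ y).2)
  deco_eq : ∀ x ∈ K.ports, L.deco (L.curve (ψ x).1 (ψ x).2) = K.deco (K.curve x.1 x.2)
  arcs : ∀ j s s', K.IsArc j s s' → ∃ k t t', L.IsArc k t t' ∧
    toDomain (k, t) = ψ (toDomain (j, s)) ∧ toDomain (k, t') = ψ (toDomain (j, s')) ∧
    (L.wensBetween k t t' : ZMod 2) = K.wensBetween j s s'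
  loops : Nonempty (K.loops ≃ L.loops)

/-- The two states differ by relabelling and by the order of the letters, which is irrelevant since
the letters are disjoint. -/
theorem GaussMap.gaussState_equivalent {K L : LinkDiagram}
    {ψ : Fin K.numComp × ℝ → Fin L.numComp × ℝ} (h : GaussMap K L ψ) {base : Fin K.numComp → ℝ}
    (hbase : ∀ j, base j ∈ Set.Ico (0 : ℝ) 1) {base' : Fin L.numComp → ℝ}
    (hbase' : ∀ j, base' j ∈ Set.Ico (0 : ℝ) 1) :
    (K.gaussState base hbase).Equivalent (L.gaussState base' hbase') := by
  classical
  obtain ⟨e⟩ := h.loops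
  -- Branches are relabelled by `ψ`; base points of loops follow the arbitrary bijection `e`.
  let Ψ : Fin K.numComp × ℝ → Fin L.numComp × ℝ := fun v =>
    if hv : v.1 ∈ K.loops then ((e ⟨v.1, hv⟩ : Fin L.numComp), base' (e ⟨v.1, hv⟩)) else ψ v
  have hΨ : ∀ v ∈ K.ports, Ψ v = ψ v := fun v hv => dif_neg (K.notMem_loops_of_mem_ports hv)
  have hΨl : ∀ v (hv : v.1 ∈ K.loops),
      Ψ v = ((e ⟨v.1, hv⟩ : Fin L.numComp), base' (e ⟨v.1, hv⟩)) := fun v hv => dif_pos hv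
  have hcases : ∀ v ∈ K.gaussNodes base, v ∈ K.ports ∨ v.1 ∈ K.loops ∧ v.2 = base v.1 :=
    fun v hv => K.mem_gaussNodes.1 hv
  have hmapsTo : Set.MapsTo Ψ (K.gaussNodes base) (L.gaussNodes base') := by
    intro v hv
    rw [Finset.mem_coe, L.mem_gaussNodes]
    rcases hcases v hv with h1 | ⟨h1, -⟩
    · rw [hΨ v h1]
      exact Or.inl (h.bij.mapsTo h1)
    · rw [hΨl v h1]
      exact Or.inr ⟨(e ⟨v.1, h1⟩).2, rfl⟩
  have hport : ∀ v ∈ K.gaussNodes base,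
      prevNode (L.gaussNodes base') (Ψ v) = Ψ (prevNode (K.gaussNodes base) v) ∧
      wenSign K.wen (K.gaussNodes base) v = wenSign L.wen (L.gaussNodes base') (Ψ v) := by
    intro v hv
    rcases hcases v hv with h1 | ⟨h1, -⟩
    · obtain ⟨hw, hw1, harc⟩ := K.isArc_prevNode (base := base) h1
      set w := prevNode (K.gaussNodes base) v with hwdef
      obtain ⟨k, t, t', harc', e1, e2, e3⟩ := h.arcs _ _ _ harc
      have d1 : toDomain (v.1, v.2) = v := toDomain_eq_self h1.1
      have d2 : toDomain (v.1, v.2 - gap v.2 w.2) = w := by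
        obtain ⟨m, hm⟩ := exists_gap v.2 w.2
        have h2 : SamePoint (v.1, v.2 - gap v.2 w.2) w := ⟨hw1.symm, -m, by push_cast; linarith⟩
        exact (samePoint_iff.1 h2).trans (toDomain_eq_self hw.1)
      rw [d1] at e2
      rw [d2] at e1
      have p1 := harc.prevNode_eq hbase
      have p2 := harc'.prevNode_eq hbase'
      rw [d1] at p1
      rw [e1, e2] at p2
      rw [hΨ v h1, hΨ w hw, p1.2, p2.2, e3]
      exact ⟨p2.1, rfl⟩
    · have p1 := K.prevNode_loop hbase hv h1
      have p2 := L.prevNode_loop hbase' (v := Ψ v) (hmapsTo hv)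
        (by rw [hΨl v h1]; exact (e ⟨v.1, h1⟩).2)
      rw [p1.1, p1.2, p2.1, p2.2]
      exact ⟨rfl, rfl⟩
  have hletters : ∀ l, l ∈ L.crossingLetters ↔ ∃ l' ∈ K.crossingLetters, l'.map Ψ = l := by
    have hmap : ∀ l' ∈ K.crossingLetters, l'.map Ψ ∈ L.crossingLetters := by
      rintro l' ⟨x, hx, y, hy, hxy, hc, rfl⟩
      refine ⟨ψ x, h.bij.mapsTo hx, ψ y, h.bij.mapsTo hy, h.curve_eq x hx y hy hxy,
        h.cross_pos y hy x hx hxy.symm hc, ?_⟩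
      rw [PureLetter.map, hΨ x hx, hΨ y hy, h.deco_eq x hx]
    intro l
    refine ⟨fun hl => ?_, ?_⟩
    · have hok := L.crossingLetters_ok hl
      obtain ⟨x', hx', y', hy', hxy', hc, rfl⟩ := id hl
      obtain ⟨x, hx, rfl⟩ := h.bij.surjOn hx'
      obtain ⟨y, hy, hyx, hyp⟩ := K.exists_other_branch hx.2.1 x
      have hyP : y ∈ K.ports := ⟨hy, by rw [hyp]; exact hx.2⟩
      have h1 := h.curve_eq x hx y hyP hyp.symm
      have h2 := L.eq_or_eq_of_curve_eq (h.bij.mapsTo hx).1 (h.bij.mapsTo hyP).1 hy'.1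
        (fun e => hyx (h.bij.injOn hyP hx e.symm)) h1 hxy'
      have h3 : y' = ψ y := h2.resolve_left (fun e => hok.2.2 e.symm)
      subst h3
      -- By transversality the frame in `K` has a sign; the wrong one would be carried to the wrong
      -- one in `L`.
      have h4 : 0 < cross (deriv (K.curve y.1) y.2) (deriv (K.curve x.1) x.2) := by
        rcases lt_or_gt_of_ne (K.cross_ne_zero hy hx.1 hyx hyp) with h5 | h5
        · rw [cross_swap] at h5
          have h6 := h.cross_pos x hx y hyP hyp.symm (by linarith)
          rw [cross_swap] at h6
          linarith
        · exact h5
      refine ⟨_, ⟨x, hx, y, hyP, hyp.symm, h4, rfl⟩, ?_⟩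
      rw [PureLetter.map, hΨ x hx, hΨ y hyP, h.deco_eq x hx]
    · rintro ⟨l', hl', rfl⟩
      exact hmap l' hl'
  have hinj : Set.InjOn Ψ (K.gaussNodes base) := by
    intro v hv w hw hvw
    rcases hcases v hv with h1 | ⟨h1, h1'⟩ <;> rcases hcases w hw with h2 | ⟨h2, h2'⟩
    · rw [hΨ v h1, hΨ w h2] at hvw
      exact h.bij.injOn h1 h2 hvw
    · rw [hΨ v h1, hΨl w h2] at hvw
      have := L.notMem_loops_of_mem_ports (h.bij.mapsTo h1)
      rw [hvw] at this
      exact absurd (e ⟨w.1, h2⟩).2 this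
    · rw [hΨl v h1, hΨ w h2] at hvw
      have := L.notMem_loops_of_mem_ports (h.bij.mapsTo h2)
      rw [← hvw] at this
      exact absurd (e ⟨v.1, h1⟩).2 this
    · rw [hΨl v h1, hΨl w h2] at hvw
      have h3 := e.injective (Subtype.ext (congrArg Prod.fst hvw))
      have h4 : v.1 = w.1 := congrArg Subtype.val h3
      exact Prod.ext h4 (by rw [h1', h2', h4])
  refine State.equivalent_of_map Ψ ⟨hmapsTo, hinj, ?_⟩ (fun v hv => (hport v hv).1.symm)
    (fun v hv => (hport v hv).2) ?_ (.inl ?_)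
  · intro v' hv'
    rcases L.mem_gaussNodes.1 hv' with h1 | ⟨h1, h1'⟩
    · obtain ⟨v, hv, rfl⟩ := h.bij.surjOn h1
      exact ⟨v, K.mem_gaussNodes.2 (Or.inl hv), hΨ v hv⟩
    · refine ⟨((e.symm ⟨v'.1, h1⟩ : Fin K.numComp), base _),
        K.mem_gaussNodes.2 (Or.inr ⟨(e.symm ⟨v'.1, h1⟩).2, rfl⟩), ?_⟩
      rw [hΨl _ (e.symm ⟨v'.1, h1⟩).2]
      simp only [Subtype.coe_eta, Equiv.apply_symm_apply]
      exact Prod.ext rfl h1'.symm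
  · rw [List.perm_ext_iff_of_nodup]
    · intro l
      simp only [LinkDiagram.gaussState, circleState, List.mem_map, Finset.mem_toList,
        Set.Finite.mem_toFinset]
      exact (hletters l).symm
    · refine List.Nodup.map_on ?_ (Finset.nodup_toList _)
      intro l hl l' hl' hll
      have o1 := K.crossingLetters_ok (l := l) (by simpa [LinkDiagram.gaussState, circleState] using hl)
      have o2 := K.crossingLetters_ok (l := l')
        (by simpa [LinkDiagram.gaussState, circleState] using hl')
      have hsub : ∀ v ∈ K.ports, v ∈ (K.gaussNodes base : Set (Fin K.numComp × ℝ)) :=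
        fun v hv => K.mem_gaussNodes.2 (Or.inl hv)
      cases l <;> cases l' <;> simp only [PureLetter.map, PureLetter.chi.injEq,
        PureLetter.tau.injEq, reduceCtorEq] at hll
      · obtain ⟨rfl, h1, h2⟩ := hll
        rw [hinj (hsub _ o1.1) (hsub _ o2.1) h1, hinj (hsub _ o1.2.1) (hsub _ o2.2.1) h2]
      · rw [hinj (hsub _ o1) (hsub _ o2) hll]
    · exact Finset.nodup_toList _
  · have : ∀ l ∈ L.finite_crossingLetters.toFinset.toList, l ∈ L.crossingLetters :=
      fun l hl => by simpa using hl
    refine (Finset.nodup_toList L.finite_crossingLetters.toFinset).imp_of_mem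
      fun {l l'} hl hl' hne => ?_
    exact L.crossingLetters_disj (this l hl) (this l' hl') hne

end Gauss

/-! ### Isotopies and replacements preserve the Gauss data -/

section Invariance

/-- Multiplicativity of the determinant; the factor is the determinant of `A`, computed on the basis
`1`, `I`. -/
theorem cross_map (A : ℂ →L[ℝ] ℂ) (a b : ℂ) :
    cross (A a) (A b) = cross (A 1) (A Complex.I) * cross a b := by
  have h : ∀ z : ℂ, A z = z.re • A 1 + z.im • A Complex.I := by
    intro z
    conv_lhs => rw [← Complex.re_add_im z]
    rw [← map_smul, ← map_smul, ← map_add]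
    congr 1
    simp
  rw [h a, h b]
  simp only [cross, Complex.add_re, Complex.add_im, Complex.real_smul, Complex.mul_re,
    Complex.mul_im, Complex.ofReal_re, Complex.ofReal_im]
  ring

namespace PlaneIsotopy

variable (Φ : PlaneIsotopy)

theorem hasFDerivAt (τ : ℝ) (p : ℂ) : HasFDerivAt (Φ.toFun τ)
    ((fderiv ℝ (fun q : ℝ × ℂ => Φ.toFun q.1 q.2) (τ, p)).comp
      (ContinuousLinearMap.inr ℝ ℝ ℂ)) p := by
  have h1 : HasFDerivAt (fun q : ℝ × ℂ => Φ.toFun q.1 q.2) _ (τ, p) :=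
    (Φ.smooth.differentiable (by simp) (τ, p)).hasFDerivAt
  exact h1.comp p (hasFDerivAt_prodMk_right τ p)

/-- The derivative of an isotopy preserves the orientation of the plane. -/
theorem cross_deriv_pos (p : ℂ) :
    0 < cross (fderiv ℝ (Φ.toFun 1) p 1) (fderiv ℝ (Φ.toFun 1) p Complex.I) := by
  let d : ℝ → ℝ := fun τ => cross (fderiv ℝ (Φ.toFun τ) p 1) (fderiv ℝ (Φ.toFun τ) p Complex.I)
  have hcont : Continuous fun τ : ℝ => fderiv ℝ (fun q : ℝ × ℂ => Φ.toFun q.1 q.2) (τ, p) :=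
    (Φ.smooth.continuous_fderiv (by simp)).comp (by fun_prop)
  have hd : Continuous d := by
    have : ∀ v : ℂ, Continuous fun τ => fderiv ℝ (Φ.toFun τ) p v := by
      intro v
      have e : (fun τ => fderiv ℝ (Φ.toFun τ) p v) = fun τ =>
          fderiv ℝ (fun q : ℝ × ℂ => Φ.toFun q.1 q.2) (τ, p) (0, v) := by
        funext τ
        rw [(Φ.hasFDerivAt τ p).fderiv]
        rfl
      rw [e]
      exact hcont.clm_apply continuous_const
    have h1 := this 1
    have h2 := this Complex.I
    exact ((Complex.continuous_re.comp h1).mul (Complex.continuous_im.comp h2)).sub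
      ((Complex.continuous_im.comp h1).mul (Complex.continuous_re.comp h2))
  have hd0 : d 0 = 1 := by
    have : Φ.toFun 0 = id := funext Φ.zero
    simp [d, this, cross]
  -- At every time the smooth inverse makes the derivative invertible.
  have hne : ∀ τ, d τ ≠ 0 := by
    intro τ h0
    have h1 : HasFDerivAt (Φ.inv τ ∘ Φ.toFun τ)
        ((fderiv ℝ (Φ.inv τ) (Φ.toFun τ p)).comp (fderiv ℝ (Φ.toFun τ) p)) p :=
      (((Φ.smooth_inv τ).differentiable (by simp) _).hasFDerivAt).comp p
        (Φ.hasFDerivAt τ p).differentiableAt.hasFDerivAt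
    have h2 : Φ.inv τ ∘ Φ.toFun τ = id := funext (Φ.left_inv τ)
    rw [h2] at h1
    have h3 := h1.unique (hasFDerivAt_id p)
    have h4 : ∀ v : ℂ, fderiv ℝ (Φ.inv τ) (Φ.toFun τ p) (fderiv ℝ (Φ.toFun τ) p v) = v :=
      fun v => congrArg (fun A : ℂ →L[ℝ] ℂ => A v) h3
    have h5 := cross_map (fderiv ℝ (Φ.inv τ) (Φ.toFun τ p)) (fderiv ℝ (Φ.toFun τ) p 1)
      (fderiv ℝ (Φ.toFun τ) p Complex.I)
    rw [h4, h4] at h5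
    change _ = _ * d τ at h5
    rw [h0, mul_zero] at h5
    simp [cross] at h5
  -- The Jacobian is continuous in time and starts at `1`; it cannot become negative without
  -- vanishing.
  by_contra! hneg
  have h1 : (0 : ℝ) ∈ d '' Set.Icc 0 1 :=
    intermediate_value_Icc' zero_le_one hd.continuousOn ⟨hneg, by rw [hd0]; exact zero_le_one⟩
  obtain ⟨τ, -, hτ⟩ := h1
  exact hne τ hτ

end PlaneIsotopy

/-- Only the components are renamed: parameters, wens and arcs are literally the same, and
positivity of the Jacobian preserves the order of the branches at a crossing. -/
theorem Isotopic.exists_gaussMap {K K' : LinkDiagram} (h : Isotopic K K') :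
    ∃ ψ, GaussMap K K' ψ := by
  obtain ⟨Φ, e, hcurve, hdeco, hwen⟩ := h
  have hinj : Function.Injective (Φ.toFun 1) := (Φ.left_inv 1).injective
  have hdouble : ∀ j t, K'.curve (e j) t ∈ K'.doublePoints ↔ K.curve j t ∈ K.doublePoints := by
    intro j t
    rw [hcurve]
    constructor
    · rintro ⟨x, y, hxy, hx, hy⟩
      obtain ⟨jx, hjx⟩ := e.surjective x.1
      obtain ⟨jy, hjy⟩ := e.surjective y.1
      refine ⟨(jx, x.2), (jy, y.2), fun hs => hxy ⟨?_, hs.2⟩, hinj ?_, hinj ?_⟩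
      · rw [← hjx, ← hjy]
        exact congrArg e hs.1
      · rw [← hcurve, ← hx, hjx]
      · rw [← hcurve, ← hy, hjy]
    · rintro ⟨x, y, hxy, hx, hy⟩
      refine ⟨(e x.1, x.2), (e y.1, y.2), fun hs => hxy ⟨e.injective hs.1, hs.2⟩, ?_, ?_⟩
      · rw [hcurve, hx]
      · rw [hcurve, hy]
  have hreal : ∀ j t, K'.curve (e j) t ∈ K'.realCrossings ↔ K.curve j t ∈ K.realCrossings := by
    intro j t
    constructor
    · rintro ⟨h1, h2⟩
      have h3 := (hdouble j t).1 h1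
      exact ⟨h3, by rwa [hcurve, hdeco _ h3] at h2⟩
    · rintro ⟨h1, h2⟩
      exact ⟨(hdouble j t).2 h1, by rwa [hcurve, hdeco _ h1]⟩
  have hderiv : ∀ j t, deriv (K'.curve (e j)) t =
      fderiv ℝ (Φ.toFun 1) (K.curve j t) (deriv (K.curve j) t) := by
    intro j t
    have h1 : K'.curve (e j) = Φ.toFun 1 ∘ K.curve j := funext fun t => hcurve j t
    have h2 : HasDerivAt (K.curve j) (deriv (K.curve j) t) t :=
      ((K.smooth j).differentiable (by simp) t).hasDerivAt
    rw [h1]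
    exact ((Φ.hasFDerivAt 1 (K.curve j t)).differentiableAt.hasFDerivAt.comp_hasDerivAt t h2).deriv
  refine ⟨fun x => (e x.1, x.2), ⟨fun x hx => ⟨hx.1, (hreal _ _).2 hx.2⟩, ?_, ?_⟩, ?_, ?_, ?_, ?_,
    ?_⟩
  · intro x _ y _ hxy
    simp only [Prod.mk.injEq] at hxy
    exact Prod.ext (e.injective hxy.1) hxy.2
  · intro y hy
    obtain ⟨j, hj⟩ := e.surjective y.1
    refine ⟨(j, y.2), ⟨hy.1, (hreal _ _).1 ?_⟩, Prod.ext hj rfl⟩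
    rw [hj]
    exact hy.2
  · intro x _ y _ hxy
    rw [hcurve, hcurve, hxy]
  · intro x _ y _ hxy hc
    rw [hderiv, hderiv, hxy, cross_map]
    exact mul_pos (Φ.cross_deriv_pos _) hc
  · intro x hx
    rw [hcurve, hdeco _ hx.2.1]
  · rintro j s s' ⟨h1, h2, h3, h4⟩
    refine ⟨e j, s, s', ⟨h1, (hreal _ _).2 h2, (hreal _ _).2 h3,
      fun t ht ht' h => h4 t ht ht' ((hreal _ _).1 h)⟩, rfl, rfl, ?_⟩
    rw [LinkDiagram.wensBetween, LinkDiagram.wensBetween, hwen]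
  · refine ⟨e.subtypeEquiv fun j => ?_⟩
    exact forall_congr' fun t => not_congr (hreal j t).symm

theorem SameBranch.curve_eq {K K' : LinkDiagram} {x : Fin K.numComp × ℝ}
    {y : Fin K'.numComp × ℝ} (h : SameBranch K K' x y) :
    K'.curve y.1 y.2 = K.curve x.1 x.2 := by
  obtain ⟨φ, h1, -, -, h2⟩ := h
  rw [← h1]
  exact h2.self_of_nhds

theorem SameBranch.deriv_eq {K K' : LinkDiagram} {x : Fin K.numComp × ℝ}
    {y : Fin K'.numComp × ℝ} (h : SameBranch K K' x y) :
    ∃ r : ℝ, 0 < r ∧ deriv (K.curve x.1) x.2 = r • deriv (K'.curve y.1) y.2 := by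
  obtain ⟨φ, h1, h2, h3, h4⟩ := h
  refine ⟨deriv φ x.2, h3, ?_⟩
  have d1 : HasDerivAt φ (deriv φ x.2) x.2 := (h2.differentiableAt (by simp)).hasDerivAt
  have d2 : HasDerivAt (K'.curve y.1) (deriv (K'.curve y.1) (φ x.2)) (φ x.2) :=
    ((K'.smooth y.1).differentiable (by simp) _).hasDerivAt
  have d3 := d2.scomp x.2 d1
  rw [h1] at d3
  have h5 : K'.curve y.1 ∘ φ =ᶠ[𝓝 x.2] K.curve x.1 := h4
  rw [← h5.deriv_eq]
  exact d3.deriv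

/-- Two different branches of `K'` that both match one branch of `K` would be tangent at their
common point, against transversality. -/
theorem SameBranch.toDomain_eq {K K' : LinkDiagram} {x x' : Fin K.numComp × ℝ}
    (hx : SamePoint x x') {y y' : Fin K'.numComp × ℝ} (h : SameBranch K K' x y)
    (h' : SameBranch K K' x' y') : toDomain y = toDomain y' := by
  by_contra hne
  obtain ⟨r, hr, e⟩ := h.deriv_eq
  obtain ⟨r', hr', e'⟩ := h'.deriv_eq
  refine K'.transverse y y' (fun hs => hne (samePoint_iff.1 hs))
    (by rw [h.curve_eq, h'.curve_eq, K.curve_eq_of_samePoint hx]) ?_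
  have h1 := cross_self (deriv (K.curve x.1) x.2)
  nth_rw 2 [K.deriv_eq_of_samePoint hx] at h1
  rw [e, e', cross_smul_smul] at h1
  exact (mul_eq_zero.1 h1).resolve_left (mul_pos hr hr').ne'

/-- Each branch at a real crossing goes to its matching branch. Distinct branches are not tangent,
so the map is injective; it is surjective because a crossing of `K'` has only two branches. -/
theorem IsReplacement.exists_gaussMap {K K' : LinkDiagram} (h : IsReplacement K K') :
    ∃ ψ, GaussMap K K' ψ := by
  classical
  have hex : ∀ x : Fin K.numComp × ℝ, ∃ y, x ∈ K.ports → SameBranch K K' x y := by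
    intro x
    by_cases hx : x ∈ K.ports
    · obtain ⟨y, hy⟩ := h.branches x.1 x.2 hx.2
      exact ⟨y, fun _ => hy⟩
    -- Away from the ports the value does not matter; it is only needed that `K'` has some point
    -- when `K` has one.
    suffices H : Nonempty (Fin K'.numComp × ℝ) from ⟨H.some, fun hx' => absurd hx' hx⟩
    by_cases hl : x.1 ∈ K.loops
    · obtain ⟨e⟩ := h.loops
      exact ⟨((e ⟨x.1, hl⟩ : Fin K'.numComp), 0)⟩
    · simp only [LinkDiagram.loops, Set.mem_ofPred_eq, not_forall, not_not] at hl
      obtain ⟨t, ht⟩ := hl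
      obtain ⟨y, -⟩ := h.branches x.1 t ht
      exact ⟨y⟩
  choose b hb using hex
  have hcurve : ∀ x ∈ K.ports, K'.curve (toDomain (b x)).1 (toDomain (b x)).2 =
      K.curve x.1 x.2 := fun x hx => by rw [K'.curve_toDomain, (hb x hx).curve_eq]
  have hmaps : Set.MapsTo (fun x => toDomain (b x)) K.ports K'.ports := fun x hx =>
    ⟨toDomain_mem _, by rw [hcurve x hx, h.crossings]; exact hx.2⟩
  have hinj : Set.InjOn (fun x => toDomain (b x)) K.ports := by
    intro x hx y hy hxy
    dsimp only at hxy
    by_contra hne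
    have hs := samePoint_iff.2 hxy
    obtain ⟨r, hr, e⟩ := (hb x hx).deriv_eq
    obtain ⟨r', hr', e'⟩ := (hb y hy).deriv_eq
    refine K.cross_ne_zero hx.1 hy.1 hne ?_ ?_
    · rw [← hcurve x hx, hxy, hcurve y hy]
    · rw [e, e', K'.deriv_eq_of_samePoint hs, cross_smul_smul, cross_self, mul_zero]
  have hbr : ∀ j s, K.curve j s ∈ K.realCrossings → ∀ y, SameBranch K K' (j, s) y →
      toDomain y = toDomain (b (toDomain (j, s))) := by
    intro j s hs y hy
    have hp := K.toDomain_mem_ports (x := (j, s)) hs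
    exact SameBranch.toDomain_eq (samePoint_iff.2 (toDomain_eq_self (toDomain_mem (j, s))).symm)
      hy (hb _ hp)
  refine ⟨fun x => toDomain (b x), ⟨hmaps, hinj, ?_⟩, ?_, ?_, ?_, ?_, h.loops⟩
  · intro y hy
    have hp : K'.curve y.1 y.2 ∈ K.realCrossings := by
      rw [← h.crossings]
      exact hy.2
    -- The branch to be avoided is arbitrary here; any first branch through the crossing will do.
    obtain ⟨x, hx, -, hxp⟩ := K.exists_other_branch hp.1 (Fin.mk 0 (by
      obtain ⟨x, -⟩ := hp.1
      exact x.1.pos), 0)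
    obtain ⟨z, hz, hzx, hzp⟩ := K.exists_other_branch hp.1 x
    have hxP : x ∈ K.ports := ⟨hx, by rwa [hxp]⟩
    have hzP : z ∈ K.ports := ⟨hz, by rwa [hzp]⟩
    rcases K'.eq_or_eq_of_curve_eq (hmaps hxP).1 (hmaps hzP).1 hy.1
      (fun e => hzx (hinj hzP hxP e.symm))
      ((hcurve x hxP).trans ((hxp.trans hzp.symm).trans (hcurve z hzP).symm))
      ((hcurve x hxP).trans hxp) with e | e
    · exact ⟨x, hxP, e.symm⟩
    · exact ⟨z, hzP, e.symm⟩
  · intro x hx y hy hxy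
    rw [hcurve x hx, hcurve y hy, hxy]
  · intro x hx y hy _ hc
    obtain ⟨r, hr, e⟩ := (hb x hx).deriv_eq
    obtain ⟨r', hr', e'⟩ := (hb y hy).deriv_eq
    rw [e, e', cross_smul_smul] at hc
    rw [K'.deriv_toDomain, K'.deriv_toDomain]
    exact (mul_pos_iff_of_pos_left (mul_pos hr hr')).1 hc
  · intro x hx
    rw [hcurve x hx, h.signs _ hx.2]
  · intro j s s' harc
    obtain ⟨⟨k, t⟩, hkt⟩ := h.branches j s harc.2.1
    obtain ⟨t', h1, h2, h3⟩ := h.arcs j s s' harc k t hkt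
    exact ⟨k, t, t', h1, hbr j s harc.2.1 _ hkt, hbr j s' harc.2.2.1 _ h2, h3⟩

theorem BraidingProcess.gaussState_equivalent {K L : LinkDiagram} (h : BraidingProcess K L)
    {base : Fin K.numComp → ℝ} (hbase : ∀ j, base j ∈ Set.Ico (0 : ℝ) 1)
    {base' : Fin L.numComp → ℝ} (hbase' : ∀ j, base' j ∈ Set.Ico (0 : ℝ) 1) :
    (K.gaussState base hbase).Equivalent (L.gaussState base' hbase') := by
  obtain ⟨K₁, O, h1, h2, -⟩ := h
  obtain ⟨ψ, hψ⟩ := h1.exists_gaussMap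
  obtain ⟨φ, hφ⟩ := h2.exists_gaussMap
  have h0 : ∀ j : Fin K₁.numComp, (fun _ => 0 : Fin K₁.numComp → ℝ) j ∈ Set.Ico (0 : ℝ) 1 :=
    fun _ => ⟨le_rfl, one_pos⟩
  exact (hψ.gaussState_equivalent hbase h0).trans (hφ.gaussState_equivalent h0 hbase')

end Invariance

/-! ### Positions of strands that move along a ray -/

section Tracking

open Equiv

/-- What happens to the strands at some moment: a crossing of two strands, the first of which moves
to the right, or a wen mark. -/
inductive EventKind (α : Type*) where
  | cross (d : Decoration) (a b : α)
  | wen (a : α)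

namespace EventKind

variable {α : Type*}

/-- A strand involved in the event. -/
def strand : EventKind α → α
  | .cross _ a _ => a
  | .wen a => a

/-- The event is a crossing of the strands `v` and `w`. -/
def IsPair (v w : α) : EventKind α → Prop
  | .cross _ a b => v = a ∧ w = b ∨ v = b ∧ w = a
  | .wen _ => False

theorem IsPair.symm {v w : α} {e : EventKind α} (h : e.IsPair v w) : e.IsPair w v := by
  cases e with
  | cross d a b => exact h.elim (fun h => Or.inr ⟨h.2, h.1⟩) fun h => Or.inl ⟨h.2, h.1⟩
  | wen a => exact h

/-- The letters of the event, for strands that keep their labels. -/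
def pureLetters : EventKind α → List (PureLetter α)
  | .cross .pos a b => [.chi 1 a b]
  | .cross .neg a b => [.chi (-1) a b]
  | .cross .welded _ _ => []
  | .wen a => [.tau a]

/-- The elementary braid of the event at the position `i`. -/
noncomputable def toGroup (n i : ℕ) : EventKind α → WBE n
  | .cross .pos _ _ => sg n i
  | .cross .neg _ _ => (sg n i)⁻¹
  | .cross .welded _ _ => rh n i
  | .wen _ => tu n i

end EventKind

variable {α : Type*}

/-- A motion of the strands `V` along a ray in the time interval `[0, T]`, in which the
events `evs` occur. The distance of the strand `v` at the time `t` is measured by `R v t`. -/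
structure Motion (V : Finset α) (R : α → ℝ → ℝ) (T : ℝ) (evs : List (ℝ × EventKind α)) : Prop where
  cont : ∀ v ∈ V, Continuous (R v)
  nonneg : 0 ≤ T
  sorted : evs.Pairwise fun e e' => e.1 ≤ e'.1
  distinct : evs.Pairwise fun e e' => ∀ v w, e.2.IsPair v w → e'.2.IsPair v w → e.1 ≠ e'.1
  range : ∀ e ∈ evs, 0 < e.1 ∧ e.1 < T
  mem : ∀ e ∈ evs, ∀ d a b, e.2 = .cross d a b → a ∈ V ∧ b ∈ V ∧ a ≠ b
  mem_wen : ∀ e ∈ evs, ∀ a, e.2 = .wen a → a ∈ V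
  eq : ∀ e ∈ evs, ∀ d a b, e.2 = .cross d a b → R a e.1 = R b e.1
  ne : ∀ e ∈ evs, ∀ c ∈ V, R c e.1 = R e.2.strand e.1 → c = e.2.strand ∨ e.2.IsPair e.2.strand c
  before : ∀ e ∈ evs, ∀ d a b, e.2 = .cross d a b → ∀ᶠ t in 𝓝[<] e.1, R b t < R a t
  after : ∀ e ∈ evs, ∀ d a b, e.2 = .cross d a b → ∀ᶠ t in 𝓝[>] e.1, R a t < R b t
  zeros : ∀ v ∈ V, ∀ w ∈ V, v ≠ w → ∀ t ∈ Set.Icc 0 T, R v t = R w t →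
    ∃ e ∈ evs, e.2.IsPair v w ∧ e.1 = t

/-- The number of strands farther than the given event. -/
noncomputable def rank (V : Finset α) (R : α → ℝ → ℝ) (e : ℝ × EventKind α) : ℕ :=
  (V.filter fun c => R e.2.strand e.1 < R c e.1).card

theorem lt_iff_lt_of_ne {f g : ℝ → ℝ} (hf : Continuous f) (hg : Continuous g) {x y : ℝ}
    (hxy : x ≤ y) (h : ∀ t ∈ Set.Icc x y, f t ≠ g t) : f x < g x ↔ f y < g y := by
  constructor
  · intro hx
    by_contra! hy
    obtain ⟨t, ht, h0⟩ := intermediate_value_Icc hxy (hf.sub hg).continuousOn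
      (show (0 : ℝ) ∈ Set.Icc (f x - g x) (f y - g y) from ⟨by linarith, by linarith⟩)
    exact h t ht (sub_eq_zero.1 h0)
  · intro hy
    by_contra! hx
    obtain ⟨t, ht, h0⟩ := intermediate_value_Icc' hxy (hf.sub hg).continuousOn
      (show (0 : ℝ) ∈ Set.Icc (f y - g y) (f x - g x) from ⟨by linarith, by linarith⟩)
    exact h t ht (sub_eq_zero.1 h0)

theorem swap_lt_swap_iff {i x y : ℕ} (h : ¬(x = i ∧ y = i + 1))
    (h' : ¬(x = i + 1 ∧ y = i)) : swap i (i + 1) x < swap i (i + 1) y ↔ x < y := by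
  simp only [swap_apply_def]
  split_ifs <;> omega

/-- This links positions, given as an abstract enumeration, with the geometric count `rank`. -/
theorem card_filter_lt {V : Finset α} {n : ℕ} {q : α → ℕ} (hq : Set.BijOn q V (Set.Iio n)) {v : α}
    (hv : v ∈ V) : (V.filter fun c => q c < q v).card = q v := by
  classical
  have h : (V.filter fun c => q c < q v).image q = Finset.range (q v) := by
    ext i
    simp only [Finset.mem_image, Finset.mem_filter, Finset.mem_range]
    constructor
    · rintro ⟨c, ⟨-, hc⟩, rfl⟩
      exact hc
    · intro hi
      have hvn : q v < n := hq.mapsTo hv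
      obtain ⟨c, hc, rfl⟩ := hq.surjOn (show i ∈ Set.Iio n from hi.trans hvn)
      exact ⟨c, ⟨hc, hi⟩, rfl⟩
  rw [← Finset.card_image_of_injOn (f := q), h, Finset.card_range]
  exact fun x hx y hy hxy => hq.injOn (Finset.mem_filter.1 hx).1 (Finset.mem_filter.1 hy).1 hxy

/-- The strands are ordered at the time `t` as the pair of strands `v`, `w` is ordered when the
events `done` have occurred and the events `todo` have not. -/
def InWindow (done todo : List (ℝ × EventKind α)) (v w : α) (t : ℝ) : Prop :=
  (∀ e ∈ done, e.2.IsPair v w → e.1 < t) ∧ ∀ e ∈ todo, e.2.IsPair v w → t < e.1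

/-- The positions `q` are correct when the events `done` have occurred and the events `todo`
have not. -/
def Tracks (V : Finset α) (R : α → ℝ → ℝ) (T : ℝ) (done todo : List (ℝ × EventKind α))
    (q : α → ℕ) : Prop :=
  ∀ v ∈ V, ∀ w ∈ V, v ≠ w → ∀ t ∈ Set.Icc 0 T, InWindow done todo v w t →
    (q v < q w ↔ R w t < R v t)

namespace Motion

variable {V : Finset α} {R : α → ℝ → ℝ} {T : ℝ}

theorem eq_of_isPair {evs : List (ℝ × EventKind α)} (h : Motion V R T evs) {e : ℝ × EventKind α}
    (he : e ∈ evs) {v w : α} (hp : e.2.IsPair v w) : R v e.1 = R w e.1 := by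
  obtain ⟨t, k⟩ := e
  cases k with
  | wen a => exact hp.elim
  | cross d a b =>
    have h1 := h.eq _ he d a b rfl
    rcases hp with ⟨rfl, rfl⟩ | ⟨rfl, rfl⟩
    · exact h1
    · exact h1.symm

theorem tracks_nil {evs : List (ℝ × EventKind α)} (h : Motion V R T evs) {f : α → ℕ}
    (hf : ∀ v ∈ V, ∀ w ∈ V, f v < f w ↔ R w 0 < R v 0) : Tracks V R T [] evs f := by
  intro v hv w hw hvw t ht hwin
  rw [hf v hv w hw]
  refine lt_iff_lt_of_ne (h.cont w hw) (h.cont v hv) ht.1 fun x hx hxe => ?_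
  obtain ⟨e, he, hp, rfl⟩ := h.zeros v hv w hw hvw x ⟨hx.1, hx.2.trans ht.2⟩ hxe.symm
  exact absurd (hwin.2 e he hp) (not_lt.2 hx.2)

variable {done todo : List (ℝ × EventKind α)} {e : ℝ × EventKind α}

theorem le_of_mem_done (h : Motion V R T (done ++ e :: todo)) {e' : ℝ × EventKind α}
    (he' : e' ∈ done) : e'.1 ≤ e.1 :=
  (List.pairwise_append.1 h.sorted).2.2 e' he' e (by simp)

theorem le_of_mem_todo (h : Motion V R T (done ++ e :: todo)) {e' : ℝ × EventKind α}
    (he' : e' ∈ todo) : e.1 ≤ e'.1 :=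
  (List.pairwise_cons.1 (List.pairwise_append.1 h.sorted).2.1).1 e' he'

/-- The time of an event is in the window of each pair of strands that do not meet then. -/
theorem inWindow_of_ne (h : Motion V R T (done ++ e :: todo)) {v w : α}
    (hne : R v e.1 ≠ R w e.1) : InWindow done (e :: todo) v w e.1 := by
  have key : ∀ e' ∈ done ++ e :: todo, e'.2.IsPair v w → e'.1 ≠ e.1 := by
    intro e' he' hp heq
    have := h.eq_of_isPair he' hp
    rw [heq] at this
    exact hne this
  refine ⟨fun e' he' hp => lt_of_le_of_ne (h.le_of_mem_done he') (key e' (by simp [he']) hp),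
    fun e' he' hp => ?_⟩
  rcases List.mem_cons.1 he' with rfl | he'
  · exact absurd rfl (key e' (by simp) hp)
  · exact lt_of_le_of_ne (h.le_of_mem_todo he') (key e' (by simp [he']) hp).symm

/-- Events may be simultaneous, so in general no moment separates `done` from `todo`. Therefore
`Tracks` gives each pair of strands its own window of times, and the moment of `e` lies in the
window of every pair that does not meet then. -/
theorem lt_iff_of_ne (h : Motion V R T (done ++ e :: todo)) {q : α → ℕ}
    (hq : Tracks V R T done (e :: todo) q) {v w : α} (hv : v ∈ V) (hw : w ∈ V)
    (hne : R v e.1 ≠ R w e.1) : q v < q w ↔ R w e.1 < R v e.1 := by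
  refine hq v hv w hw (fun hvw => hne (by rw [hvw])) e.1 ?_ (h.inWindow_of_ne hne)
  have := h.range e (by simp)
  exact ⟨this.1.le, this.2.le⟩

theorem position_wen (h : Motion V R T (done ++ e :: todo)) {n : ℕ} {q : α → ℕ}
    (hb : Set.BijOn q V (Set.Iio n)) (hq : Tracks V R T done (e :: todo) q) {a : α}
    (he : e.2 = .wen a) : q a = rank V R e := by
  have ha := h.mem_wen e (by simp) a he
  rw [← card_filter_lt hb ha, rank, he]
  congr 1
  refine Finset.filter_congr fun c hc => ?_
  change q c < q a ↔ R a e.1 < R c e.1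
  by_cases hca : c = a
  · simp [hca]
  · refine h.lt_iff_of_ne hq hc ha fun heq => ?_
    have := h.ne e (by simp) c hc (by rw [he]; exact heq)
    rw [he] at this
    exact this.elim hca id

/-- Just before the crossing the strand `a` is farther out than `b`, and small positions are the far
ones. Earlier meetings of this pair are strictly earlier by `distinct`, so such a moment lies in the
window. -/
theorem position_lt (h : Motion V R T (done ++ e :: todo)) {q : α → ℕ}
    (hq : Tracks V R T done (e :: todo) q) {d : Decoration} {a b : α}
    (he : e.2 = .cross d a b) : q a < q b := by
  obtain ⟨ha, hb, hab⟩ := h.mem e (by simp) d a b he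
  obtain ⟨h0, hT⟩ := h.range e (by simp)
  have hpe : e.2.IsPair a b := by
    rw [he]
    exact Or.inl ⟨rfl, rfl⟩
  have hdone : ∀ e' ∈ done, e'.2.IsPair a b → e'.1 < e.1 := fun e' he' hp =>
    lt_of_le_of_ne (h.le_of_mem_done he')
      ((List.pairwise_append.1 h.distinct).2.2 e' he' e (by simp) a b hp hpe)
  -- Induction over the finite list of past events.
  have h1 : ∀ᶠ t in 𝓝[<] e.1, ∀ e' ∈ done, e'.2.IsPair a b → e'.1 < t := by
    clear * - hdone
    induction done with
    | nil => simp
    | cons e' l ih =>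
      have h2 := ih fun e'' he'' => hdone e'' (by simp [he''])
      have h3 : ∀ᶠ t in 𝓝[<] e.1, e'.2.IsPair a b → e'.1 < t := by
        by_cases hp : e'.2.IsPair a b
        · have := Ioo_mem_nhdsLT (hdone e' (by simp) hp)
          filter_upwards [this] with t ht _ using ht.1
        · exact Filter.Eventually.of_forall fun t hp' => absurd hp' hp
      filter_upwards [h2, h3] with t ht ht'
      intro e'' he''
      rcases List.mem_cons.1 he'' with rfl | he''
      · exact ht'
      · exact ht e'' he''
  have h2 : ∀ᶠ t in 𝓝[<] e.1, t ∈ Set.Ioo 0 e.1 := Ioo_mem_nhdsLT h0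
  obtain ⟨t, ht1, ht2, ht3⟩ := (h1.and (h2.and (h.before e (by simp) d a b he))).exists
  refine (hq a ha b hb hab t ⟨ht2.1.le, (ht2.2.trans hT).le⟩ ⟨ht1, fun e' he' _ => ?_⟩).2 ht3
  rcases List.mem_cons.1 he' with rfl | he'
  · exact ht2.2
  · exact ht2.2.trans_le (h.le_of_mem_todo he')

/-- At the crossing every other strand is strictly farther or strictly nearer than both, so the
strands ahead of `b` are `a` and those ahead of `a`. -/
theorem position_cross (h : Motion V R T (done ++ e :: todo)) {n : ℕ} {q : α → ℕ}
    (hbij : Set.BijOn q V (Set.Iio n)) (hq : Tracks V R T done (e :: todo) q) {d : Decoration}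
    {a b : α} (he : e.2 = .cross d a b) : q a = rank V R e ∧ q b = rank V R e + 1 := by
  classical
  obtain ⟨ha, hb, hab⟩ := h.mem e (by simp) d a b he
  have hlt := h.position_lt hq he
  have heq := h.eq e (by simp) d a b he
  have hother : ∀ c ∈ V, c ≠ a → c ≠ b → R c e.1 ≠ R a e.1 := by
    intro c hc hca hcb hc'
    have := h.ne e (by simp) c hc (by rw [he]; exact hc')
    rw [he] at this
    rcases this with h1 | h1 | h1
    · exact hca h1
    · exact hcb h1.2
    · exact hab h1.1
  have h1 : V.filter (fun c => q c < q a) = V.filter fun c => R a e.1 < R c e.1 := by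
    refine Finset.filter_congr fun c hc => ?_
    by_cases hca : c = a
    · simp [hca]
    by_cases hcb : c = b
    · rw [hcb, heq]
      exact iff_of_false (by omega) (lt_irrefl _)
    · exact h.lt_iff_of_ne hq hc ha (hother c hc hca hcb)
  have h2 : V.filter (fun c => q c < q b) = insert a (V.filter fun c => R a e.1 < R c e.1) := by
    ext c
    simp only [Finset.mem_filter, Finset.mem_insert]
    by_cases hca : c = a
    · simp [hca, ha, hlt]
    by_cases hcb : c = b
    · simp [hcb, heq, hab.symm]
    · simp only [hca, false_or]
      refine and_congr_right fun hc => ?_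
      rw [heq]
      exact h.lt_iff_of_ne hq hc hb (by rw [← heq]; exact hother c hc hca hcb)
  have e1 := card_filter_lt hbij ha
  have e2 := card_filter_lt hbij hb
  rw [h1] at e1
  rw [h2, Finset.card_insert_of_notMem (by simp)] at e2
  rw [rank, he]
  exact ⟨e1.symm, e2.symm⟩

theorem tracks_wen {q : α → ℕ} (hq : Tracks V R T done (e :: todo) q) {a : α}
    (he : e.2 = .wen a) : Tracks V R T (done ++ [e]) todo q := by
  intro v hv w hw hvw t ht hwin
  refine hq v hv w hw hvw t ht ⟨fun e' he' => hwin.1 e' (by simp [he']), fun e' he' hp => ?_⟩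
  rcases List.mem_cons.1 he' with rfl | he'
  · rw [he] at hp
    exact hp.elim
  · exact hwin.2 e' he' hp

/-- An adjacent transposition changes the order of the crossing pair only, and all other pairs have
the same window before and after the event. -/
theorem tracks_cross (h : Motion V R T (done ++ e :: todo)) {n : ℕ} {q : α → ℕ}
    (hbij : Set.BijOn q V (Set.Iio n)) (hq : Tracks V R T done (e :: todo) q) {d : Decoration}
    {a b : α} (he : e.2 = .cross d a b) {i : ℕ} (hi : i = rank V R e) :
    Tracks V R T (done ++ [e]) todo fun v => swap i (i + 1) (q v) := by
  obtain ⟨ha, hb, hab⟩ := h.mem e (by simp) d a b he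
  obtain ⟨hqa, hqb⟩ := h.position_cross hbij hq he
  obtain ⟨h0, hT⟩ := h.range e (by simp)
  rw [← hi] at hqa hqb
  -- The order that holds right after the crossing persists as long as the pair does not meet again.
  have key : ∀ t ∈ Set.Icc 0 T, InWindow (done ++ [e]) todo a b t → R a t < R b t := by
    intro t ht hwin
    have hpe : e.2.IsPair a b := by
      rw [he]
      exact Or.inl ⟨rfl, rfl⟩
    have het : e.1 < t := hwin.1 e (by simp) hpe
    have h2 : ∀ᶠ x in 𝓝[>] e.1, x ∈ Set.Ioo e.1 t := Ioo_mem_nhdsGT het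
    obtain ⟨x, hx, hx'⟩ := (h2.and (h.after e (by simp) d a b he)).exists
    refine (lt_iff_lt_of_ne (h.cont a ha) (h.cont b hb) hx.2.le fun y hy hye => ?_).1 hx'
    obtain ⟨e', he', hp, rfl⟩ := h.zeros a ha b hb hab y
      ⟨h0.le.trans (hx.1.le.trans hy.1), hy.2.trans ht.2⟩ hye
    rcases List.mem_append.1 he' with h3 | h3
    · have := h.le_of_mem_done h3
      linarith [hx.1, hy.1]
    · rcases List.mem_cons.1 h3 with rfl | h3
      · linarith [hx.1, hy.1]
      · have := hwin.2 e' h3 hp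
        linarith [hy.2]
  intro v hv w hw hvw t ht hwin
  dsimp only
  by_cases h1 : v = a ∧ w = b
  · obtain ⟨rfl, rfl⟩ := h1
    rw [hqa, hqb, swap_apply_left, swap_apply_right]
    have := key t ht hwin
    exact iff_of_false (by omega) (not_lt.2 this.le)
  by_cases h2 : v = b ∧ w = a
  · obtain ⟨rfl, rfl⟩ := h2
    rw [hqa, hqb, swap_apply_left, swap_apply_right]
    have := key t ht ⟨fun e' he' hp => hwin.1 e' he' hp.symm, fun e' he' hp => hwin.2 e' he' hp.symm⟩
    exact iff_of_true (by omega) this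
  have hqinj : ∀ x ∈ V, ∀ y ∈ V, q x = q y → x = y := fun x hx y hy hxy => hbij.injOn hx hy hxy
  rw [swap_lt_swap_iff]
  · refine hq v hv w hw hvw t ht ⟨fun e' he' => hwin.1 e' (by simp [he']), fun e' he' hp => ?_⟩
    rcases List.mem_cons.1 he' with rfl | he'
    · rw [he] at hp
      exact hp.elim (fun hh => absurd hh h1) fun hh => absurd hh h2
    · exact hwin.2 e' he' hp
  · rintro ⟨e1, e2⟩
    exact h1 ⟨hqinj v hv a ha (e1.trans hqa.symm), hqinj w hw b hb (e2.trans hqb.symm)⟩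
  · rintro ⟨e1, e2⟩
    exact h2 ⟨hqinj v hv b hb (e1.trans hqb.symm), hqinj w hw a ha (e2.trans hqa.symm)⟩

/-- A power of `sg n i` is `chi n ε i (i + 1) * rh n i`. Moving `iota n π` past the `chi` renames
its strands by their initial positions, and the welded crossing joins the permutation; for a welded
letter only the latter remains. -/
theorem toGroup_cross {n i : ℕ} (hi : i + 1 < n) {π : Perm ℕ} (hπ : π ∈ lowPerm n)
    (d : Decoration) {a b : α} {f : α → ℕ} (ha : π i = f a) (hb : π (i + 1) = f b) :
    iota n π * (EventKind.cross d a b).toGroup n i =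
      ((EventKind.cross d a b).pureLetters.map fun l => (l.map f).eval n).prod *
        iota n (π * swap i (i + 1)) := by
  have hs : swap i (i + 1) ∈ lowPerm n := swap_mem_lowPerm (by omega) hi
  have key : ∀ ε : ℤ, iota n π * sg n i ^ ε =
      chi n ε (f a) (f b) * iota n (π * swap i (i + 1)) := by
    intro ε
    have h1 : sg n i ^ ε = chi n ε i (i + 1) * rh n i := by
      rw [chi_succ hi, mul_assoc, rh_mul_self, mul_one]
    rw [h1, ← mul_assoc, iota_mul_chi hπ (by omega) (by omega) hi, ha, hb, iota_mul hπ hs,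
      iota_swap hi, mul_assoc]
  cases d
  · simpa [EventKind.toGroup, EventKind.pureLetters, PureLetter.map, PureLetter.eval] using key 1
  · simpa [EventKind.toGroup, EventKind.pureLetters, PureLetter.map, PureLetter.eval] using
      key (-1)
  · simp [EventKind.toGroup, EventKind.pureLetters, iota_mul hπ hs, iota_swap hi]

/-- The braid traced out by a motion. -/
theorem exists_perm {evs : List (ℝ × EventKind α)} (h : Motion V R T evs) {n : ℕ} {f : α → ℕ}
    (hf : Set.BijOn f V (Set.Iio n)) (hlt : ∀ v ∈ V, ∀ w ∈ V, f v < f w ↔ R w 0 < R v 0) :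
    ∃ π ∈ lowPerm n, (evs.map fun e => e.2.toGroup n (rank V R e)).prod =
        ((evs.flatMap fun e => e.2.pureLetters).map fun l => (l.map f).eval n).prod * iota n π ∧
      ∀ v ∈ V, ∀ w ∈ V, v ≠ w → (π⁻¹ (f v) < π⁻¹ (f w) ↔ R w T < R v T) := by
  -- Invariant of the induction: `π⁻¹ (f v)` is the current position of the strand that started at
  -- `f v`.
  suffices H : ∀ todo done : List (ℝ × EventKind α), done ++ todo = evs →
      ∀ π ∈ lowPerm n, Tracks V R T done todo (fun v => π⁻¹ (f v)) →
      ∃ π' ∈ lowPerm n, iota n π * (todo.map fun e => e.2.toGroup n (rank V R e)).prod =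
        ((todo.flatMap fun e => e.2.pureLetters).map fun l => (l.map f).eval n).prod *
          iota n π' ∧ Tracks V R T (done ++ todo) [] (fun v => π'⁻¹ (f v)) by
    obtain ⟨π, hπ, h1, h2⟩ := H evs [] rfl 1 (one_mem _) (h.tracks_nil hlt)
    rw [iota_one, one_mul] at h1
    refine ⟨π, hπ, h1, fun v hv w hw hvw => h2 v hv w hw hvw T ⟨h.nonneg, le_rfl⟩
      ⟨fun e he _ => (h.range e he).2, by simp⟩⟩
  intro todo
  induction todo with
  | nil =>
    intro done _ π hπ ht
    exact ⟨π, hπ, by simp, by simpa using ht⟩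
  | cons e todo ih =>
    intro done hd π hπ ht
    have hM : Motion V R T (done ++ e :: todo) := hd ▸ h
    have hbij : Set.BijOn (fun v => π⁻¹ (f v)) V (Set.Iio n) := by
      refine ⟨fun v hv => lowPerm_lt (inv_mem hπ) (hf.mapsTo hv), fun v hv w hw hvw =>
        hf.injOn hv hw (π⁻¹.injective hvw), fun i hi => ?_⟩
      obtain ⟨v, hv, hvi⟩ := hf.surjOn (show π i ∈ Set.Iio n from lowPerm_lt hπ hi)
      exact ⟨v, hv, by simp [hvi]⟩
    have hd' : (done ++ [e]) ++ todo = evs := by simpa using hd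
    obtain ⟨t, k⟩ := e
    cases k with
    | wen a =>
      have ha := hM.mem_wen (t, .wen a) (by simp) a rfl
      have hpos := hM.position_wen hbij ht (a := a) rfl
      obtain ⟨π', hπ', h1, h2⟩ := ih _ hd' π hπ (tracks_wen ht (a := a) rfl)
      refine ⟨π', hπ', ?_, by simpa using h2⟩
      have hlt' : rank V R (t, .wen a) < n := hpos ▸ hbij.mapsTo ha
      have h3 := iota_mul_tu hπ hlt'
      rw [← hpos, show π (π⁻¹ (f a)) = f a from Equiv.apply_symm_apply _ _] at h3
      rw [List.map_cons, List.prod_cons, List.flatMap_cons, List.map_append, List.prod_append,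
        mul_assoc, ← h1, ← mul_assoc, ← mul_assoc]
      congr 1
      rw [← hpos]
      simpa [EventKind.toGroup, EventKind.pureLetters, PureLetter.map, PureLetter.eval] using h3
    | cross d a b =>
      obtain ⟨ha, hb, hab⟩ := hM.mem (t, .cross d a b) (by simp) d a b rfl
      obtain ⟨hqa, hqb⟩ := hM.position_cross hbij ht (d := d) (a := a) (b := b) rfl
      have ht' := hM.tracks_cross hbij ht (d := d) (a := a) (b := b) rfl rfl
      set i := rank V R (t, .cross d a b) with hi
      have hin : i + 1 < n := hqb ▸ hbij.mapsTo hb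
      have hs : swap i (i + 1) ∈ lowPerm n := swap_mem_lowPerm (by omega) hin
      have e1 : (fun v => (π * swap i (i + 1))⁻¹ (f v)) =
          fun v => swap i (i + 1) (π⁻¹ (f v)) := by
        funext v
        rw [mul_inv_rev, swap_inv, Perm.mul_apply]
      obtain ⟨π', hπ', h1, h2⟩ := ih _ hd' (π * swap i (i + 1)) (mul_mem hπ hs) (by rw [e1]; exact ht')
      refine ⟨π', hπ', ?_, by simpa using h2⟩
      rw [List.map_cons, List.prod_cons, List.flatMap_cons, List.map_append, List.prod_append,
        mul_assoc, ← h1, ← mul_assoc, ← mul_assoc]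
      congr 1
      refine toGroup_cross hin hπ d ?_ ?_
      · rw [← hqa]
        exact Equiv.apply_symm_apply _ _
      · rw [← hqb]
        exact Equiv.apply_symm_apply _ _

end Motion

/-- The order of distinct numbers is given by an enumeration. -/
theorem exists_ranking (V : Finset α) (r : α → ℝ) (hr : Set.InjOn r V) :
    ∃ f : α → ℕ, Set.BijOn f V (Set.Iio V.card) ∧ ∀ v ∈ V, ∀ w ∈ V, f v < f w ↔ r w < r v := by
  classical
  let f : α → ℕ := fun v => (V.filter fun w => r v < r w).card
  have hmono : ∀ v ∈ V, ∀ w ∈ V, r w < r v → f v < f w := by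
    intro v hv w hw h
    refine Finset.card_lt_card ⟨fun u hu => ?_, fun hsub => ?_⟩
    · rw [Finset.mem_filter] at hu ⊢
      exact ⟨hu.1, h.trans hu.2⟩
    · have := hsub (Finset.mem_filter.2 ⟨hv, h⟩)
      exact lt_irrefl _ (Finset.mem_filter.1 this).2
  have hiff : ∀ v ∈ V, ∀ w ∈ V, f v < f w ↔ r w < r v := by
    intro v hv w hw
    refine ⟨fun h => ?_, hmono v hv w hw⟩
    by_contra! h'
    rcases eq_or_lt_of_le h' with h' | h'
    · rw [hr hv hw h'] at h
      exact lt_irrefl _ h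
    · have := hmono w hw v hv h'
      omega
  have hinj : Set.InjOn f V := by
    intro v hv w hw h
    refine hr hv hw (le_antisymm ?_ ?_)
    · exact not_lt.1 fun h' => by have := hmono v hv w hw h'; omega
    · exact not_lt.1 fun h' => by have := hmono w hw v hv h'; omega
  have hmaps : Set.MapsTo f V (Finset.range V.card : Set ℕ) := by
    intro v hv
    rw [Finset.mem_coe, Finset.mem_range]
    refine Finset.card_lt_card ⟨Finset.filter_subset _ _, fun hsub => ?_⟩
    exact lt_irrefl _ (Finset.mem_filter.1 (hsub hv)).2
  refine ⟨f, ?_, hiff⟩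
  have h := Finset.surjOn_of_injOn_of_card_le f hmaps hinj (by simp)
  rw [Finset.coe_range] at hmaps h
  exact ⟨hmaps, hinj, h⟩

end Tracking

/-! ### Polar coordinates on a braided diagram -/

section Polar

theorem im_div_eq_cross (a b : ℂ) : (b / a).im = cross a b / Complex.normSq a := by
  rw [Complex.div_im, cross]
  ring

/-- A logarithm of the diagram, seen from the point `O`. -/
structure Lift (L : LinkDiagram) (O : ℂ) where
  log : Fin L.numComp → ℝ → ℂ
  exp_log : ∀ j t, Complex.exp (log j t) = L.curve j t - O
  hasDerivAt : ∀ j t, HasDerivAt (log j) (deriv (L.curve j) t / (L.curve j t - O)) t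
  winding : Fin L.numComp → ℕ
  winding_pos : ∀ j, 0 < winding j
  log_add_one : ∀ j t, log j (t + 1) = log j t + 2 * Real.pi * winding j * Complex.I
  angle : Fin L.numComp → ℝ ≃o ℝ
  angle_eq : ∀ j t, angle j t = (log j t).im

/-- The logarithm is a primitive of the logarithmic derivative, started at a logarithm of the
initial value; `(curve - O) * exp (-g)` has derivative zero and equals `1`. -/
theorem exists_log {L : LinkDiagram} {O : ℂ} (h : L.IsBraidedAround O) (j : Fin L.numComp) :
    ∃ g : ℝ → ℂ, (∀ t, Complex.exp (g t) = L.curve j t - O) ∧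
      ∀ t, HasDerivAt g (deriv (L.curve j) t / (L.curve j t - O)) t := by
  have hne : ∀ t, L.curve j t - O ≠ 0 := fun t => sub_ne_zero.2 (h.avoids j t)
  have hc : ∀ t, HasDerivAt (L.curve j) (deriv (L.curve j) t) t := fun t =>
    ((L.smooth j).differentiable (by simp) t).hasDerivAt
  have hcont : Continuous fun t => deriv (L.curve j) t / (L.curve j t - O) :=
    ((L.smooth j).continuous_deriv (by simp)).div ((L.smooth j).continuous.sub continuous_const) hne
  let g : ℝ → ℂ := fun t => Complex.log (L.curve j 0 - O) +
    ∫ s in (0 : ℝ)..t, deriv (L.curve j) s / (L.curve j s - O)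
  have hg : ∀ t, HasDerivAt g (deriv (L.curve j) t / (L.curve j t - O)) t := fun t =>
    ((hcont.integral_hasStrictDerivAt 0 t).hasDerivAt).const_add _
  refine ⟨g, fun t => ?_, hg⟩
  have hF : ∀ t, HasDerivAt (fun t => (L.curve j t - O) * Complex.exp (-g t)) 0 t := by
    intro t
    have h1 := ((hc t).sub_const O).mul ((hg t).neg.cexp)
    have h2 : deriv (L.curve j) t * Complex.exp (-g t) + (L.curve j t - O) *
        (Complex.exp (-g t) * -(deriv (L.curve j) t / (L.curve j t - O))) = 0 := by
      rw [mul_left_comm, mul_neg, mul_div_cancel₀ _ (hne t)]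
      ring
    exact h2 ▸ h1
  have hconst : (L.curve j t - O) * Complex.exp (-g t) =
      (L.curve j 0 - O) * Complex.exp (-g 0) :=
    is_const_of_deriv_eq_zero (fun t => (hF t).differentiableAt) (fun t => (hF t).deriv) t 0
  have h0 : (L.curve j 0 - O) * Complex.exp (-g 0) = 1 := by
    simp only [g, intervalIntegral.integral_same, add_zero]
    rw [Complex.exp_neg, Complex.exp_log (hne 0), mul_inv_cancel₀ (hne 0)]
  rw [h0, Complex.exp_neg] at hconst
  exact (eq_of_mul_inv_eq_one hconst).symm

/-- Positive angular speed makes the imaginary part of the logarithm strictly increasing. Over one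
period it grows by a constant positive multiple of `2π`, hence it is unbounded in both directions
and an order isomorphism of the line. -/
theorem nonempty_lift {L : LinkDiagram} {O : ℂ} (h : L.IsBraidedAround O) :
    Nonempty (Lift L O) := by
  choose g hexp hderiv using exists_log h
  have him : ∀ j t, HasDerivAt (fun t => (g j t).im)
      (deriv (L.curve j) t / (L.curve j t - O)).im t := fun j t =>
    (Complex.imCLM.hasFDerivAt.comp_hasDerivAt t (hderiv j t))
  have hmono : ∀ j, StrictMono fun t => (g j t).im := by
    intro j
    refine strictMono_of_deriv_pos fun t => ?_
    rw [(him j t).deriv, im_div_eq_cross]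
    exact div_pos (h.monotone j t)
      (Complex.normSq_pos.2 (sub_ne_zero.2 (h.avoids j t)))
  have hcont : ∀ j, Continuous fun t => (g j t).im := fun j =>
    continuous_iff_continuousAt.2 fun t => (him j t).continuousAt
  have hshift : ∀ j, ∃ w : ℕ, 0 < w ∧ ∀ t, g j (t + 1) = g j t + 2 * Real.pi * w * Complex.I := by
    intro j
    have hd : ∀ t, HasDerivAt (fun t => g j (t + 1) - g j t) 0 t := by
      intro t
      have h1 := ((hderiv j (t + 1)).comp_add_const t 1).sub (hderiv j t)
      have h2 := L.deriv_add_int j t 1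
      rw [Int.cast_one] at h2
      rwa [h2, L.periodic, sub_self] at h1
    have hconst : ∀ t, g j (t + 1) - g j t = g j (0 + 1) - g j 0 := fun t =>
      is_const_of_deriv_eq_zero (fun t => (hd t).differentiableAt) (fun t => (hd t).deriv) t 0
    have he : Complex.exp (g j (0 + 1)) = Complex.exp (g j 0) := by
      rw [hexp, hexp, L.periodic]
    obtain ⟨m, hm⟩ := Complex.exp_eq_exp_iff_exists_int.1 he
    have hmpos : 0 < m := by
      have h1 := hmono j (show (0 : ℝ) < 0 + 1 by norm_num)
      simp only [hm, Complex.add_im] at h1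
      have h2 : ((m : ℂ) * (2 * Real.pi * Complex.I)).im = m * (2 * Real.pi) := by
        simp [Complex.mul_im]
      rw [h2] at h1
      have h3 : (0 : ℝ) < m * (2 * Real.pi) := by linarith
      exact_mod_cast (mul_pos_iff_of_pos_right Real.two_pi_pos).1 h3
    refine ⟨m.toNat, by omega, fun t => ?_⟩
    have hcast : ((m.toNat : ℕ) : ℂ) = (m : ℂ) := by
      have : ((m.toNat : ℕ) : ℤ) = m := Int.toNat_of_nonneg hmpos.le
      exact_mod_cast congrArg (fun k : ℤ => (k : ℂ)) this
    have h1 := hconst t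
    rw [hm] at h1
    rw [hcast]
    linear_combination h1
  choose w hw hgw using hshift
  have hsurj : ∀ j, Function.Surjective fun t => (g j t).im := by
    intro j y
    have hnat : ∀ (n : ℕ) (t : ℝ), (g j (t + n)).im = (g j t).im + 2 * Real.pi * w j * n := by
      intro n t
      induction n with
      | zero => simp
      | succ n ih =>
        have : t + ((n + 1 : ℕ) : ℝ) = (t + n) + 1 := by push_cast; ring
        rw [this, hgw, Complex.add_im, ih]
        have h2 : ((2 : ℂ) * Real.pi * (w j : ℂ) * Complex.I).im = 2 * Real.pi * w j := by
          simp [Complex.mul_im]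
        rw [h2]
        push_cast
        ring
    have hc : (0 : ℝ) < 2 * Real.pi * w j :=
      mul_pos Real.two_pi_pos (by exact_mod_cast hw j)
    obtain ⟨n, hn⟩ := exists_nat_gt (|y - (g j 0).im| / (2 * Real.pi * w j))
    rw [div_lt_iff₀ hc] at hn
    have h1 := hnat n 0
    have h2 := hnat n (-n)
    rw [zero_add] at h1
    rw [neg_add_cancel] at h2
    have h3 := abs_lt.1 hn
    obtain ⟨t, -, ht⟩ := intermediate_value_Icc
      (show (-(n : ℝ)) ≤ n by linarith [(Nat.cast_nonneg n : (0 : ℝ) ≤ n)])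
      (hcont j).continuousOn (show y ∈ Set.Icc (g j (-n)).im (g j n).im from
        ⟨by nlinarith, by nlinarith⟩)
    exact ⟨t, ht⟩
  exact ⟨⟨g, hexp, hderiv, w, hw, hgw,
    fun j => (hmono j).orderIsoOfSurjective _ (hsurj j), fun j t => rfl⟩⟩

/-! ### Strands parametrized by the angle around `O` -/

namespace Lift

variable {L : LinkDiagram} {O : ℂ} (Λ : Lift L O)

theorem angle_add_int (j : Fin L.numComp) (t : ℝ) (k : ℤ) :
    Λ.angle j (t + k) = Λ.angle j t + 2 * Real.pi * Λ.winding j * k := by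
  have h1 : ∀ t, Λ.angle j (t + 1) = Λ.angle j t + 2 * Real.pi * Λ.winding j := by
    intro t
    rw [Λ.angle_eq, Λ.angle_eq, Λ.log_add_one, Complex.add_im]
    congr 1
    simp [Complex.mul_im]
  induction k using Int.induction_on with
  | zero => simp
  | succ k ih =>
    have : t + ((k + 1 : ℤ) : ℝ) = (t + (k : ℤ)) + 1 := by push_cast; ring
    rw [this, h1, ih]
    push_cast
    ring
  | pred k ih =>
    have h2 := h1 (t + ((-k - 1 : ℤ) : ℝ))
    have : t + ((-k - 1 : ℤ) : ℝ) + 1 = t + ((-k : ℤ) : ℝ) := by push_cast; ring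
    rw [this, ih] at h2
    push_cast at h2 ⊢
    linarith

theorem re_log (j : Fin L.numComp) (t : ℝ) : (Λ.log j t).re = Real.log ‖L.curve j t - O‖ := by
  rw [← Λ.exp_log, Complex.norm_exp, Real.log_exp]

/-- The parameter of the strand through `v` after turning by the angle `β` around `O`. -/
noncomputable def flow (v : Fin L.numComp × ℝ) (β : ℝ) : ℝ :=
  (Λ.angle v.1).symm (Λ.angle v.1 v.2 + β)

/-- The point of the strand through `v` after turning by the angle `β` around `O`. -/
noncomputable def pt (v : Fin L.numComp × ℝ) (β : ℝ) : Fin L.numComp × ℝ := (v.1, Λ.flow v β)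

theorem angle_flow (v : Fin L.numComp × ℝ) (β : ℝ) :
    Λ.angle v.1 (Λ.flow v β) = Λ.angle v.1 v.2 + β := by
  rw [flow, OrderIso.apply_symm_apply]

theorem angle_pt (v : Fin L.numComp × ℝ) (β : ℝ) :
    Λ.angle (Λ.pt v β).1 (Λ.pt v β).2 = Λ.angle v.1 v.2 + β := Λ.angle_flow v β

theorem pt_zero (v : Fin L.numComp × ℝ) : Λ.pt v 0 = v := by
  refine Prod.ext rfl ((Λ.angle v.1).injective ?_)
  exact (Λ.angle_flow v 0).trans (add_zero _)

/-- The logarithmic distance from `O` of the strand through `v`. -/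
noncomputable def radius (v : Fin L.numComp × ℝ) (β : ℝ) : ℝ := (Λ.log v.1 (Λ.flow v β)).re

theorem radius_eq (v : Fin L.numComp × ℝ) (β : ℝ) :
    Λ.radius v β = Real.log ‖L.curve (Λ.pt v β).1 (Λ.pt v β).2 - O‖ := Λ.re_log _ _

theorem continuous_radius (v : Fin L.numComp × ℝ) : Continuous (Λ.radius v) := by
  have h1 : Continuous (Λ.log v.1) :=
    continuous_iff_continuousAt.2 fun t => (Λ.hasDerivAt v.1 t).continuousAt
  have h2 : Continuous (Λ.flow v) :=
    (Λ.angle v.1).symm.continuous.comp (continuous_const.add continuous_id)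
  exact Complex.continuous_re.comp (h1.comp h2)

/-- Chain rule along the inverse of the angle: with `z` the logarithmic derivative of the curve,
distance and angle change at the rates `z.re` and `z.im`. -/
theorem hasDerivAt_radius (h : L.IsBraidedAround O) (v : Fin L.numComp × ℝ) (β : ℝ) :
    HasDerivAt (Λ.radius v)
      ((deriv (L.curve v.1) (Λ.flow v β) / (L.curve v.1 (Λ.flow v β) - O)).re /
        (deriv (L.curve v.1) (Λ.flow v β) / (L.curve v.1 (Λ.flow v β) - O)).im) β := by
  set z := deriv (L.curve v.1) (Λ.flow v β) / (L.curve v.1 (Λ.flow v β) - O) with hz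
  have hlog := Λ.hasDerivAt v.1 (Λ.flow v β)
  rw [← hz] at hlog
  have him0 : HasDerivAt (fun t => (Λ.log v.1 t).im) z.im (Λ.flow v β) :=
    Complex.imCLM.hasFDerivAt.comp_hasDerivAt _ hlog
  have hang : HasDerivAt (Λ.angle v.1) z.im (Λ.flow v β) := by
    have : (fun t => (Λ.log v.1 t).im) = Λ.angle v.1 := funext fun t => (Λ.angle_eq v.1 t).symm
    rwa [this] at him0
  have hzim : z.im ≠ 0 := by
    rw [hz, im_div_eq_cross]
    exact (div_pos (h.monotone _ _)
      (Complex.normSq_pos.2 (sub_ne_zero.2 (h.avoids _ _)))).ne'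
  have hflow : HasDerivAt (Λ.flow v) z.im⁻¹ β := by
    have h1 : HasDerivAt (Λ.angle v.1).symm z.im⁻¹ (Λ.angle v.1 v.2 + β) :=
      HasDerivAt.of_local_left_inverse (f := Λ.angle v.1)
        (Λ.angle v.1).symm.continuous.continuousAt hang hzim
        (Filter.Eventually.of_forall fun y => (Λ.angle v.1).apply_symm_apply y)
    exact h1.comp_const_add (Λ.angle v.1 v.2) β
  have h2 := hlog.scomp β hflow
  have h3 : HasDerivAt (Λ.radius v) (z.im⁻¹ • z).re β :=
    Complex.reCLM.hasFDerivAt.comp_hasDerivAt β h2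
  convert h3 using 1
  rw [Complex.smul_re, smul_eq_mul]
  ring

/-- The points of the diagram that have the same angle are distinguished by their distance. -/
theorem curve_eq_of_angle {x y : Fin L.numComp × ℝ} {m : ℤ}
    (ha : Λ.angle x.1 x.2 = Λ.angle y.1 y.2 + 2 * Real.pi * m)
    (hr : ‖L.curve x.1 x.2 - O‖ = ‖L.curve y.1 y.2 - O‖) :
    L.curve x.1 x.2 = L.curve y.1 y.2 := by
  have hpos : ∀ x : Fin L.numComp × ℝ, 0 < ‖L.curve x.1 x.2 - O‖ := fun x => by
    rw [← Λ.exp_log, Complex.norm_exp]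
    exact Real.exp_pos _
  have h1 : Λ.log x.1 x.2 = Λ.log y.1 y.2 + m * (2 * Real.pi * Complex.I) := by
    rw [Λ.angle_eq, Λ.angle_eq] at ha
    refine Complex.ext ?_ ?_
    · have h2 : ((m : ℂ) * (2 * Real.pi * Complex.I)).re = 0 := by simp [Complex.mul_re]
      rw [Complex.add_re, h2, add_zero, Λ.re_log, Λ.re_log, hr]
    · have h2 : ((m : ℂ) * (2 * Real.pi * Complex.I)).im = 2 * Real.pi * m := by
        simp [Complex.mul_im]
        ring
      rw [Complex.add_im, h2, ha]
  have h3 := Complex.exp_eq_exp_iff_exists_int.2 ⟨m, h1⟩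
  rw [Λ.exp_log, Λ.exp_log] at h3
  exact sub_left_injective h3

theorem angle_eq_of_curve_eq {x y : Fin L.numComp × ℝ}
    (h : L.curve x.1 x.2 = L.curve y.1 y.2) :
    ∃ m : ℤ, Λ.angle x.1 x.2 = Λ.angle y.1 y.2 + 2 * Real.pi * m := by
  have h1 : Complex.exp (Λ.log x.1 x.2) = Complex.exp (Λ.log y.1 y.2) := by
    rw [Λ.exp_log, Λ.exp_log, h]
  obtain ⟨m, hm⟩ := Complex.exp_eq_exp_iff_exists_int.1 h1
  refine ⟨m, ?_⟩
  rw [Λ.angle_eq, Λ.angle_eq, hm, Complex.add_im]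
  simp [Complex.mul_im]
  ring

theorem angle_of_samePoint {x y : Fin L.numComp × ℝ} (h : SamePoint x y) :
    ∃ m : ℤ, Λ.angle x.1 x.2 = Λ.angle y.1 y.2 + 2 * Real.pi * m :=
  Λ.angle_eq_of_curve_eq (L.curve_eq_of_samePoint h)

theorem flow_add_int (j : Fin L.numComp) (t β : ℝ) (k : ℤ) :
    Λ.flow (j, t + k) β = Λ.flow (j, t) β + k := by
  refine (Λ.angle j).injective ?_
  have h1 := Λ.angle_flow (j, t + k) β
  have h2 := Λ.angle_flow (j, t) β
  dsimp only at h1 h2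
  rw [Λ.angle_add_int, h1, h2, Λ.angle_add_int]
  ring

theorem samePoint_pt {v w : Fin L.numComp × ℝ} (h : SamePoint v w) (β : ℝ) :
    SamePoint (Λ.pt v β) (Λ.pt w β) := by
  obtain ⟨j, t⟩ := v
  obtain ⟨j', t'⟩ := w
  obtain ⟨h1, k, h2⟩ := h
  dsimp only at h1 h2
  subst h1
  exact ⟨rfl, k, by rw [h2]; exact Λ.flow_add_int _ _ _ _⟩

theorem pt_pt (v : Fin L.numComp × ℝ) (β γ : ℝ) : Λ.pt (Λ.pt v β) γ = Λ.pt v (β + γ) := by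
  refine Prod.ext rfl ((Λ.angle v.1).injective ?_)
  have h1 := Λ.angle_pt (Λ.pt v β) γ
  have h2 := Λ.angle_pt v (β + γ)
  rw [Λ.angle_pt v β] at h1
  exact h1.trans ((add_assoc _ _ _).trans h2.symm)

theorem samePoint_of_samePoint_pt {v w : Fin L.numComp × ℝ} {β : ℝ}
    (h : SamePoint (Λ.pt v β) (Λ.pt w β)) : SamePoint v w := by
  have := Λ.samePoint_pt h (-β)
  rwa [pt_pt, pt_pt, add_neg_cancel, pt_zero, pt_zero] at this

/-- One period of the parameter turns by at least `2π`, because the winding number is positive. -/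
theorem flow_le (v : Fin L.numComp × ℝ) {β : ℝ} (hβ : β ≤ 2 * Real.pi) :
    Λ.flow v β ≤ v.2 + 1 := by
  rw [← (Λ.angle v.1).le_iff_le, Λ.angle_flow]
  have h1 := Λ.angle_add_int v.1 v.2 1
  rw [Int.cast_one, mul_one] at h1
  rw [h1]
  have h2 : (1 : ℝ) ≤ Λ.winding v.1 := by exact_mod_cast Λ.winding_pos v.1
  nlinarith [Real.two_pi_pos]

theorem lt_flow (v : Fin L.numComp × ℝ) {β : ℝ} (hβ : 0 < β) : v.2 < Λ.flow v β := by
  rw [← (Λ.angle v.1).lt_iff_lt, Λ.angle_flow]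
  linarith

/-- The strands on the ray in the direction `exp (i α)`. -/
def onRay (α : ℝ) : Set (Fin L.numComp × ℝ) :=
  {v | v.2 ∈ Set.Ico (0 : ℝ) 1 ∧ ∃ m : ℤ, Λ.angle v.1 v.2 = α + 2 * Real.pi * m}

theorem finite_onRay (α : ℝ) : (Λ.onRay α).Finite := by
  have hj : ∀ j, {t : ℝ | t ∈ Set.Ico (0 : ℝ) 1 ∧ ∃ m : ℤ,
      Λ.angle j t = α + 2 * Real.pi * m}.Finite := by
    intro j
    let a := (Λ.angle j 0 - α) / (2 * Real.pi)
    let b := (Λ.angle j 1 - α) / (2 * Real.pi)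
    refine ((Set.finite_Icc ⌊a⌋ ⌈b⌉).image fun m : ℤ =>
      (Λ.angle j).symm (α + 2 * Real.pi * m)).subset ?_
    rintro t ⟨⟨h0, h1⟩, m, hm⟩
    refine ⟨m, ⟨?_, ?_⟩, by simp only [← hm, OrderIso.symm_apply_apply]⟩
    · have h2 := (Λ.angle j).monotone h0
      have h3 : a ≤ m := by
        rw [div_le_iff₀ Real.two_pi_pos]
        linarith
      exact_mod_cast (Int.floor_le a).trans h3
    · have h2 := (Λ.angle j).monotone h1.le
      have h3 : (m : ℝ) ≤ b := by
        rw [le_div_iff₀ Real.two_pi_pos]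
        linarith
      exact_mod_cast h3.trans (Int.le_ceil b)
  refine (Set.finite_iUnion fun j => (hj j).image fun t => (j, t)).subset ?_
  rintro ⟨j, t⟩ hv
  exact Set.mem_iUnion.2 ⟨j, t, hv, rfl⟩

theorem exists_coord (α : ℝ) (x : Fin L.numComp × ℝ) :
    ∃ (v : Fin L.numComp × ℝ) (β : ℝ), v ∈ Λ.onRay α ∧ 0 ≤ β ∧ β < 2 * Real.pi ∧
      SamePoint (Λ.pt v β) x := by
  have hp := Real.two_pi_pos
  set δ := Λ.angle x.1 x.2 - α with hδ
  set m := ⌊δ / (2 * Real.pi)⌋ with hm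
  -- The remainder modulo `2π` of the angle from the ray to `x`; turning back by it leads from `x`
  -- to the ray.
  set β := δ - 2 * Real.pi * m with hβ
  have h1 : (m : ℝ) ≤ δ / (2 * Real.pi) := Int.floor_le _
  have h2 : δ / (2 * Real.pi) < m + 1 := Int.lt_floor_add_one _
  rw [le_div_iff₀ hp] at h1
  rw [div_lt_iff₀ hp] at h2
  have hs := samePoint_toDomain (Λ.pt x (-β))
  refine ⟨toDomain (Λ.pt x (-β)), β, ⟨toDomain_mem _, ?_⟩, by linarith, by linarith, ?_⟩
  · obtain ⟨k, hk⟩ := Λ.angle_of_samePoint hs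
    refine ⟨m + k, ?_⟩
    rw [hk, Λ.angle_pt]
    push_cast
    linarith
  · have := Λ.samePoint_pt hs β
    rwa [pt_pt, neg_add_cancel, pt_zero] at this

end Lift

theorem eq_of_two_pi {β γ : ℝ} {m : ℤ} (h : β = γ + 2 * Real.pi * m) (hβ : 0 ≤ β)
    (hβ' : β < 2 * Real.pi) (hγ : 0 ≤ γ) (hγ' : γ < 2 * Real.pi) : β = γ := by
  have hp := Real.two_pi_pos
  have : m = 0 := by
    refine int_eq_zero_of_abs_lt ?_ ?_
    · by_contra! h1
      nlinarith
    · by_contra! h1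
      nlinarith
  rw [this] at h
  simpa using h

namespace Lift

variable {L : LinkDiagram} {O : ℂ} (Λ : Lift L O)

theorem coord_unique {α : ℝ} {v w : Fin L.numComp × ℝ} (hv : v ∈ Λ.onRay α) (hw : w ∈ Λ.onRay α)
    {β γ : ℝ} (hβ : 0 ≤ β) (hβ' : β < 2 * Real.pi) (hγ : 0 ≤ γ) (hγ' : γ < 2 * Real.pi)
    (h : SamePoint (Λ.pt v β) (Λ.pt w γ)) : v = w ∧ β = γ := by
  obtain ⟨m, hm⟩ := Λ.angle_of_samePoint h
  obtain ⟨k, hk⟩ := hv.2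
  obtain ⟨l, hl⟩ := hw.2
  rw [Λ.angle_pt, Λ.angle_pt, hk, hl] at hm
  have h1 : β = γ := eq_of_two_pi (m := m + l - k) (by push_cast; linarith) hβ hβ' hγ hγ'
  subst h1
  exact ⟨L.eq_of_domain hv.1 hw.1 (Λ.samePoint_of_samePoint_pt h), rfl⟩

/-- The strand through the point `x`. -/
noncomputable def strand (α : ℝ) (x : Fin L.numComp × ℝ) : Fin L.numComp × ℝ :=
  (Λ.exists_coord α x).choose

/-- The angle from the ray to the point `x`. -/
noncomputable def time (α : ℝ) (x : Fin L.numComp × ℝ) : ℝ :=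
  (Λ.exists_coord α x).choose_spec.choose

variable (α : ℝ) (x : Fin L.numComp × ℝ)

theorem strand_mem : Λ.strand α x ∈ Λ.onRay α := (Λ.exists_coord α x).choose_spec.choose_spec.1

theorem time_nonneg : 0 ≤ Λ.time α x := (Λ.exists_coord α x).choose_spec.choose_spec.2.1

theorem time_lt : Λ.time α x < 2 * Real.pi := (Λ.exists_coord α x).choose_spec.choose_spec.2.2.1

theorem samePoint_coord : SamePoint (Λ.pt (Λ.strand α x) (Λ.time α x)) x :=
  (Λ.exists_coord α x).choose_spec.choose_spec.2.2.2

variable {α x}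

theorem coord_eq {v : Fin L.numComp × ℝ} (hv : v ∈ Λ.onRay α) {β : ℝ} (hβ : 0 ≤ β)
    (hβ' : β < 2 * Real.pi) (h : SamePoint (Λ.pt v β) x) :
    Λ.strand α x = v ∧ Λ.time α x = β := by
  refine Λ.coord_unique (Λ.strand_mem α x) hv (Λ.time_nonneg α x) (Λ.time_lt α x) hβ hβ' ?_
  rw [samePoint_iff] at h ⊢
  rw [h, ← samePoint_iff]
  exact Λ.samePoint_coord α x

theorem coord_of_mem (hx : x ∈ Λ.onRay α) : Λ.strand α x = x ∧ Λ.time α x = 0 :=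
  Λ.coord_eq hx le_rfl Real.two_pi_pos (by rw [pt_zero]; exact ⟨rfl, 0, by simp⟩)

theorem exists_angle_eq (α : ℝ) (x : Fin L.numComp × ℝ) :
    ∃ m : ℤ, Λ.angle x.1 x.2 = α + Λ.time α x + 2 * Real.pi * m := by
  obtain ⟨m, hm⟩ := Λ.angle_of_samePoint (Λ.samePoint_coord α x)
  obtain ⟨k, hk⟩ := (Λ.strand_mem α x).2
  rw [Λ.angle_pt, hk] at hm
  refine ⟨k - m, ?_⟩
  push_cast
  linarith

theorem time_eq_of_angle {β : ℝ} {m : ℤ} (hβ : 0 ≤ β) (hβ' : β < 2 * Real.pi)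
    (h : Λ.angle x.1 x.2 = α + β + 2 * Real.pi * m) : Λ.time α x = β := by
  obtain ⟨k, hk⟩ := Λ.exists_angle_eq α x
  exact eq_of_two_pi (m := m - k) (by push_cast; linarith) (Λ.time_nonneg α x) (Λ.time_lt α x)
    hβ hβ'

theorem time_eq_of_curve_eq {y : Fin L.numComp × ℝ} (h : L.curve x.1 x.2 = L.curve y.1 y.2) :
    Λ.time α x = Λ.time α y := by
  obtain ⟨m, hm⟩ := Λ.angle_eq_of_curve_eq h
  obtain ⟨k, hk⟩ := Λ.exists_angle_eq α y
  refine Λ.time_eq_of_angle (m := m + k) (Λ.time_nonneg α y) (Λ.time_lt α y) ?_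
  push_cast
  linarith

theorem radius_coord (α : ℝ) (x : Fin L.numComp × ℝ) :
    Λ.radius (Λ.strand α x) (Λ.time α x) = Real.log ‖L.curve x.1 x.2 - O‖ := by
  rw [Λ.radius_eq, L.curve_eq_of_samePoint (Λ.samePoint_coord α x)]

/-- Going backwards from `x`, one first meets the ray if no other node is in between. -/
theorem isPrev_of_time {V : Finset (Fin L.numComp × ℝ)} {v : Fin L.numComp × ℝ}
    (hvV : v ∈ V) (hv : v ∈ Λ.onRay α) {β : ℝ} (hβ : 0 < β) (hβ' : β ≤ 2 * Real.pi)
    (hx : SamePoint (Λ.pt v β) x) (hV : ∀ w ∈ V, Λ.time α w = 0 ∨ β ≤ Λ.time α w) :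
    IsPrev V x v := by
  obtain ⟨h1, k, hk⟩ := hx
  change v.1 = x.1 at h1
  change x.2 = Λ.flow v β + k at hk
  have hlt := Λ.lt_flow v hβ
  have hle := Λ.flow_le v hβ'
  have hgap : gap x.2 v.2 = Λ.flow v β - v.2 :=
    gap_eq (k := k) (by linarith) (by linarith) (by rw [hk]; ring)
  refine ⟨hvV, h1, fun w hw hwx => ?_⟩
  -- A closer node would be met strictly between the ray and `x`, at an angle strictly between `0`
  -- and `β`, which `hV` excludes.
  by_contra! hcon
  obtain ⟨l, hl⟩ := exists_gap x.2 w.2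
  have hg0 := gap_pos x.2 w.2
  set g := gap x.2 w.2 with hg
  have hw2 : Λ.flow v β - g = w.2 + ((l - k : ℤ) : ℝ) := by
    push_cast
    linarith
  have hwv : w.1 = v.1 := hwx.trans h1.symm
  have ha := Λ.angle_add_int v.1 w.2 (l - k)
  rw [← hw2] at ha
  have h3 : Λ.angle v.1 v.2 < Λ.angle v.1 (Λ.flow v β - g) :=
    (Λ.angle v.1).lt_iff_lt.2 (by linarith)
  have h4 : Λ.angle v.1 (Λ.flow v β - g) < Λ.angle v.1 v.2 + β := by
    rw [← Λ.angle_flow]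
    exact (Λ.angle v.1).lt_iff_lt.2 (by linarith)
  obtain ⟨m, hm⟩ := hv.2
  obtain ⟨m', hm'⟩ := Λ.exists_angle_eq α w
  rw [hwv] at hm'
  have hp := Real.two_pi_pos
  have e : Λ.angle v.1 (Λ.flow v β - g) - Λ.angle v.1 v.2 = Λ.time α w +
      2 * Real.pi * ((m' - m + Λ.winding v.1 * (l - k) : ℤ) : ℝ) := by
    rw [ha, hm', hm]
    push_cast
    ring
  set M := m' - m + Λ.winding v.1 * (l - k)
  have ht0 := Λ.time_nonneg α w
  have ht1 := Λ.time_lt α w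
  have hM : M = 0 := by
    refine int_eq_zero_of_abs_lt ?_ ?_
    · by_contra! h5
      nlinarith
    · by_contra! h5
      nlinarith
  rw [hM] at e
  simp only [Int.cast_zero, mul_zero, add_zero] at e
  rcases hV w hw with h5 | h5 <;> linarith

end Lift

end Polar

/-! ### Inserting the events of a braided diagram as nodes -/

section Insertion

open Equiv

namespace EventKind

variable {α β : Type*}

/-- Relabel the strands. -/
def map (f : α → β) : EventKind α → EventKind β
  | .cross d a b => .cross d (f a) (f b)
  | .wen a => .wen (f a)

/-- The strands involved in the event. -/
def points : EventKind α → List α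
  | .cross _ a b => [a, b]
  | .wen a => [a]

/-- The event involves distinct strands. -/
def Valid : EventKind α → Prop
  | .cross _ a b => a ≠ b
  | .wen _ => True

theorem pureLetters_map (f : α → β) (k : EventKind α) :
    (k.map f).pureLetters = k.pureLetters.map (PureLetter.map f) := by
  rcases k with ⟨_ | _ | _, a, b⟩ | a <;> rfl

theorem ok_of_mem_pureLetters {k : EventKind α} (h : k.Valid) {l : PureLetter α}
    (hl : l ∈ k.pureLetters) {V : Set α} (hV : ∀ a ∈ k.points, a ∈ V) : l.Ok V := by
  rcases k with ⟨_ | _ | _, a, b⟩ | a <;>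
    simp only [pureLetters, List.mem_singleton, List.not_mem_nil] at hl <;>
    simp only [points, List.mem_cons, List.not_mem_nil, or_false, forall_eq_or_imp,
      forall_eq] at hV
  · rw [hl]
    exact ⟨hV.1, hV.2, h⟩
  · rw [hl]
    exact ⟨hV.1, hV.2, h⟩
  · rw [hl]
    exact hV

end EventKind

theorem map_eq_self_of_ok {α : Type*} {V : Set α} {f : α → α} (hf : ∀ v ∈ V, f v = v)
    {L : List (PureLetter α)} (hL : ∀ l ∈ L, l.Ok V) : L.map (PureLetter.map f) = L := by
  refine (List.map_congr_left fun l hl => ?_).trans (List.map_id L)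
  rw [PureLetter.map_congr (g := id) hf (hL l hl)]
  cases l <;> rfl

/-- The state with given nodes and letters and without signs. -/
noncomputable def plainState {J : Type*} (V : Finset (J × ℝ)) (hV : Normalized V)
    (L : List (PureLetter (J × ℝ))) (hL : ∀ l ∈ L, l.Ok (V : Set (J × ℝ))) : State (J × ℝ) where
  nodes := V
  letters := L
  prev := prevNode V
  sign := 0
  bij := bijOn_prevNode hV
  ok := hL

theorem swap_apply_of_mem {α : Type*} [DecidableEq α] {V : Set α} {a p : α} (ha : a ∉ V)
    (hp : p ∉ V) : ∀ v ∈ V, swap a p v = v := fun _ hv =>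
  swap_apply_of_ne_of_ne (fun e => ha (e ▸ hv)) fun e => hp (e ▸ hv)

/-- Inserting `p` after `a` changes the predecessor map exactly by the transposition of `a` and `p`,
as required by `State.equivalent_of_insert`. -/
theorem plainState_equivalent_insert {J : Type*} [DecidableEq (J × ℝ)] {V : Finset (J × ℝ)}
    {p a : J × ℝ} (hpV : p ∉ V) (ha : a ∈ V) (hV : Normalized (insert p V))
    (hprev : IsPrev (insert p V) p a) {L₁ L₂ L L' : List (PureLetter (J × ℝ))}
    (hL : ∀ l ∈ L, l.Ok (V : Set (J × ℝ)))
    (hL' : ∀ l ∈ L', l.Ok (↑(insert p V) : Set (J × ℝ)))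
    (h : L = L₁ ++ L₂) (h' : L' = L₁ ++ L₂.map (PureLetter.map (swap a p))) :
    (plainState V (hV.mono (Finset.subset_insert _ _)) L hL).Equivalent
      (plainState (insert p V) hV L' hL') := by
  have hpp : prevNode (insert p V) p = a :=
    hprev.eq_prevNode hV (Finset.mem_insert_self _ _)
  refine State.equivalent_of_insert (L₁ := L₁) (L₂ := L₂) hpV ha rfl h h' hpp (fun v hv => ?_) rfl fun _ _ => rfl
  change prevNode (insert p V) v = swap a p (prevNode V v)
  have hv' : v ∈ V := hv
  have hap : a ≠ p := fun e => hpV (e ▸ ha)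
  by_cases hvp : prevNode (insert p V) v = p
  · rw [(gap_prevNode_insert hV hpV (by rwa [hpp]) hv' hvp).1, hpp, hvp, swap_apply_left]
  · rw [prevNode_insert_of_ne hV hv' hvp, swap_apply_of_ne_of_ne _ hvp]
    intro e
    have := (bijOn_prevNode hV).injOn (x₁ := v) (x₂ := p) (by simp [hv']) (by simp)
      (e.trans hpp.symm)
    exact hpV (this ▸ hv')

namespace Lift

variable {L : LinkDiagram} {O : ℂ} (Λ : Lift L O) {α : ℝ}

/-- The strands on the ray. -/
noncomputable def rayNodes (α : ℝ) : Finset (Fin L.numComp × ℝ) := (Λ.finite_onRay α).toFinset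

theorem mem_rayNodes {v : Fin L.numComp × ℝ} : v ∈ Λ.rayNodes α ↔ v ∈ Λ.onRay α := by
  simp [rayNodes]

theorem strand_mem_rayNodes (x : Fin L.numComp × ℝ) : Λ.strand α x ∈ Λ.rayNodes α :=
  Λ.mem_rayNodes.2 (Λ.strand_mem α x)

theorem normalized_rayNodes : Normalized (Λ.rayNodes α) := fun _ hv => (Λ.mem_rayNodes.1 hv).1

theorem strand_ne_of_time_eq {x y : Fin L.numComp × ℝ} (hx : x.2 ∈ Set.Ico (0 : ℝ) 1)
    (hy : y.2 ∈ Set.Ico (0 : ℝ) 1) (hxy : x ≠ y) (h : Λ.time α x = Λ.time α y) :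
    Λ.strand α x ≠ Λ.strand α y := by
  intro e
  refine hxy (L.eq_of_domain hx hy ?_)
  have h1 := Λ.samePoint_coord α x
  have h2 := Λ.samePoint_coord α y
  rw [e, h] at h1
  rw [samePoint_iff] at *
  exact h1.symm.trans h2

variable (α) in
/-- The events happen one after the other, at points which are not on the ray. -/
structure Ordered (ks : List (EventKind (Fin L.numComp × ℝ))) : Prop where
  valid : ∀ k ∈ ks, k.Valid
  domain : ∀ k ∈ ks, ∀ x ∈ k.points, x.2 ∈ Set.Ico (0 : ℝ) 1
  pos : ∀ k ∈ ks, ∀ x ∈ k.points, 0 < Λ.time α x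
  eq : ∀ k ∈ ks, ∀ x ∈ k.points, ∀ y ∈ k.points, Λ.time α x = Λ.time α y
  sorted : ks.Pairwise fun k k' => ∀ x ∈ k.points, ∀ y ∈ k'.points,
    x ≠ y ∧ Λ.time α x ≤ Λ.time α y

variable {Λ} in
theorem Ordered.of_cons {k : EventKind (Fin L.numComp × ℝ)}
    {ks : List (EventKind (Fin L.numComp × ℝ))} (h : Λ.Ordered α (k :: ks)) : Λ.Ordered α ks :=
  ⟨fun k hk => h.valid k (by simp [hk]), fun k hk => h.domain k (by simp [hk]),
    fun k hk => h.pos k (by simp [hk]), fun k hk => h.eq k (by simp [hk]),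
    (List.pairwise_cons.1 h.sorted).2⟩

/-- The letters of the events, as letters of the strands on the ray. -/
noncomputable def strandLetters (α : ℝ) (ks : List (EventKind (Fin L.numComp × ℝ))) :
    List (PureLetter (Fin L.numComp × ℝ)) :=
  ks.flatMap fun k => (k.map (Λ.strand α)).pureLetters

variable {Λ}

theorem Ordered.strandLetters_ok {ks : List (EventKind (Fin L.numComp × ℝ))}
    (h : Λ.Ordered α ks) :
    ∀ l ∈ Λ.strandLetters α ks, l.Ok (Λ.rayNodes α : Set (Fin L.numComp × ℝ)) := by
  intro l hl
  obtain ⟨k, hk, hl⟩ := List.mem_flatMap.1 hl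
  refine EventKind.ok_of_mem_pureLetters ?_ hl ?_
  · have h1 := h.valid k hk
    have h2 := h.domain k hk
    have h3 := h.eq k hk
    cases k with
    | wen a => trivial
    | cross d a b =>
      exact Λ.strand_ne_of_time_eq (h2 a (by simp [EventKind.points]))
        (h2 b (by simp [EventKind.points])) h1
        (h3 a (by simp [EventKind.points]) b (by simp [EventKind.points]))
  · intro a ha
    rcases k with ⟨d, x, y⟩ | x <;>
      simp only [EventKind.map, EventKind.points, List.mem_cons, List.not_mem_nil, or_false] at ha
    · rcases ha with rfl | rfl <;> exact Λ.strand_mem_rayNodes _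
    · rw [ha]
      exact Λ.strand_mem_rayNodes _

open Classical in
/-- The points of events. -/
noncomputable def _root_.ExtWelded.eventPoints {β : Type*} (ks : List (EventKind β)) : Finset β :=
  (ks.flatMap EventKind.points).toFinset

theorem _root_.ExtWelded.mem_eventPoints {β : Type*} {ks : List (EventKind β)} {x : β} :
    x ∈ eventPoints ks ↔ ∃ k ∈ ks, x ∈ k.points := by
  simp [eventPoints]

theorem Ordered.letters_ok {ks : List (EventKind (Fin L.numComp × ℝ))} (h : Λ.Ordered α ks) :
    ∀ l ∈ ks.flatMap EventKind.pureLetters,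
      l.Ok (eventPoints ks : Set (Fin L.numComp × ℝ)) := by
  intro l hl
  obtain ⟨k, hk, hl⟩ := List.mem_flatMap.1 hl
  exact EventKind.ok_of_mem_pureLetters (h.valid k hk) hl fun a ha =>
    mem_eventPoints.2 ⟨k, hk, ha⟩

open Classical in
theorem Ordered.normalized {ks : List (EventKind (Fin L.numComp × ℝ))} (h : Λ.Ordered α ks) :
    Normalized (eventPoints ks ∪ Λ.rayNodes α) := by
  intro v hv
  rcases Finset.mem_union.1 hv with hv | hv
  · obtain ⟨k, hk, hv⟩ := mem_eventPoints.1 hv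
    exact h.domain k hk v hv
  · exact Λ.normalized_rayNodes v hv

open Classical in
/-- Insertion of a point that precedes the points `A`. -/
theorem plainState_insert {A : Finset (Fin L.numComp × ℝ)} {p : Fin L.numComp × ℝ}
    (hp : p.2 ∈ Set.Ico (0 : ℝ) 1) (hpt : 0 < Λ.time α p) (hpA : p ∉ A)
    (hA : ∀ x ∈ A, Λ.time α p ≤ Λ.time α x) (hN : Normalized (A ∪ Λ.rayNodes α))
    (hN' : Normalized (insert p A ∪ Λ.rayNodes α))
    {L₁ L₂ M M' : List (PureLetter (Fin L.numComp × ℝ))}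
    (hM : ∀ l ∈ M, l.Ok (↑(A ∪ Λ.rayNodes α) : Set (Fin L.numComp × ℝ)))
    (hM' : ∀ l ∈ M', l.Ok (↑(insert p A ∪ Λ.rayNodes α) : Set (Fin L.numComp × ℝ)))
    (h : M = L₁ ++ L₂) (h' : M' = L₁ ++ L₂.map (PureLetter.map (swap (Λ.strand α p) p))) :
    (plainState (A ∪ Λ.rayNodes α) hN M hM).Equivalent
      (plainState (insert p A ∪ Λ.rayNodes α) hN' M' hM') := by
  have e : insert p A ∪ Λ.rayNodes α = insert p (A ∪ Λ.rayNodes α) := Finset.insert_union _ _ _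
  have hray : ∀ v ∈ Λ.rayNodes α, Λ.time α v = 0 := fun v hv =>
    (Λ.coord_of_mem (Λ.mem_rayNodes.1 hv)).2
  have hpV : p ∉ A ∪ Λ.rayNodes α := by
    rw [Finset.mem_union, not_or]
    refine ⟨hpA, fun h1 => ?_⟩
    rw [hray p h1] at hpt
    exact lt_irrefl _ hpt
  have hprev : IsPrev (insert p (A ∪ Λ.rayNodes α)) p (Λ.strand α p) := by
    refine Λ.isPrev_of_time (by simp [Λ.strand_mem_rayNodes]) (Λ.strand_mem α p) hpt
      (Λ.time_lt α p).le (Λ.samePoint_coord α p) fun w hw => ?_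
    rcases Finset.mem_insert.1 hw with rfl | hw
    · exact Or.inr le_rfl
    · rcases Finset.mem_union.1 hw with hw | hw
      · exact Or.inr (hA w hw)
      · exact Or.inl (hray w hw)
  simp only [e] at hM' hN' ⊢
  exact plainState_equivalent_insert hpV (by simp [Λ.strand_mem_rayNodes]) hN' hprev hM hM' h h'

-- Gives each event nodes of its own, so that the letters become disjoint. Later events come first:
-- then inserting the points of the current event renames no letter except those of this event.
open Classical in
theorem Ordered.insert_events {ks : List (EventKind (Fin L.numComp × ℝ))} (h : Λ.Ordered α ks)
    {pre : List (PureLetter (Fin L.numComp × ℝ))}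
    (hM : ∀ l ∈ pre ++ Λ.strandLetters α ks,
      l.Ok (Λ.rayNodes α : Set (Fin L.numComp × ℝ)))
    (hM' : ∀ l ∈ pre ++ ks.flatMap EventKind.pureLetters,
      l.Ok (↑(eventPoints ks ∪ Λ.rayNodes α) : Set (Fin L.numComp × ℝ))) :
    (plainState (Λ.rayNodes α) Λ.normalized_rayNodes _ hM).Equivalent
      (plainState (eventPoints ks ∪ Λ.rayNodes α) h.normalized _ hM') := by
  induction ks generalizing pre with
  | nil =>
    have e : eventPoints [] ∪ Λ.rayNodes α = Λ.rayNodes α := by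
      ext v
      simp [mem_eventPoints]
    intro x y hx hy
    simp only [e] at hy
    exact hx.markovEq hy
  | cons k ks ih =>
    have ho := h.of_cons
    have hpre : ∀ l ∈ pre, l.Ok (Λ.rayNodes α : Set (Fin L.numComp × ℝ)) := fun l hl =>
      hM l (by simp [hl])
    have hM₁ : ∀ l ∈ (pre ++ (k.map (Λ.strand α)).pureLetters) ++ Λ.strandLetters α ks,
        l.Ok (Λ.rayNodes α : Set (Fin L.numComp × ℝ)) := by
      intro l hl
      refine hM l ?_
      simpa [strandLetters] using hl
    have hsub₁ : (eventPoints ks : Set (Fin L.numComp × ℝ)) ⊆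
        ↑(eventPoints ks ∪ Λ.rayNodes α) := by simp
    have hsub₂ : (Λ.rayNodes α : Set (Fin L.numComp × ℝ)) ⊆
        ↑(eventPoints ks ∪ Λ.rayNodes α) := by simp
    have hM₂ : ∀ l ∈ (pre ++ (k.map (Λ.strand α)).pureLetters) ++
        ks.flatMap EventKind.pureLetters,
        l.Ok (↑(eventPoints ks ∪ Λ.rayNodes α) : Set (Fin L.numComp × ℝ)) := by
      intro l hl
      rcases List.mem_append.1 hl with hl | hl
      · exact (hM₁ l (List.mem_append_left _ hl)).mono hsub₂
      · exact (ho.letters_ok l hl).mono hsub₁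
    -- The letters of `k`, still on the strands of the ray, join the prefix while the later events
    -- are treated.
    refine State.Equivalent.trans (fun x y hx hy => ?_) ((ih ho hM₁ hM₂).trans ?_)
    · refine State.Rep.markovEq hx ?_
      have e : (pre ++ (k.map (Λ.strand α)).pureLetters) ++ Λ.strandLetters α ks =
          pre ++ Λ.strandLetters α (k :: ks) := by simp [strandLetters]
      simp only [e] at hy
      exact hy
    have hlater : ∀ x ∈ k.points, ∀ y ∈ eventPoints ks,
        x ≠ y ∧ Λ.time α x ≤ Λ.time α y := by
      intro x hx y hy
      obtain ⟨k', hk', hy⟩ := mem_eventPoints.1 hy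
      exact (List.pairwise_cons.1 h.sorted).1 k' hk' x hx y hy
    have hray : ∀ x ∈ k.points, ∀ v ∈ Λ.rayNodes α, x ≠ v := by
      rintro x hx v hv rfl
      have := h.pos k (by simp) x hx
      rw [(Λ.coord_of_mem (Λ.mem_rayNodes.1 hv)).2] at this
      exact lt_irrefl _ this
    have hks : ∀ x ∈ k.points, ∀ v ∈ (eventPoints ks : Set (Fin L.numComp × ℝ)),
        swap (Λ.strand α x) x v = v := by
      intro x hx
      refine swap_apply_of_mem (fun h1 => ?_) fun h1 => (hlater x hx x h1).1 rfl
      obtain ⟨k', hk', h1⟩ := mem_eventPoints.1 h1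
      have := ho.pos k' hk' _ h1
      rw [(Λ.coord_of_mem (Λ.strand_mem α x)).2] at this
      exact lt_irrefl _ this
    -- Later letters already use their own points, so the renaming does not touch them.
    have hmap : ∀ x ∈ k.points, (ks.flatMap EventKind.pureLetters).map
        (PureLetter.map (swap (Λ.strand α x) x)) = ks.flatMap EventKind.pureLetters :=
      fun x hx => map_eq_self_of_ok (hks x hx) ho.letters_ok
    cases k with
    | wen a =>
      have ha : a ∈ (EventKind.wen a).points := by simp [EventKind.points]
      have e : eventPoints (.wen a :: ks) = insert a (eventPoints ks) := by
        ext v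
        simp [mem_eventPoints, EventKind.points]
      have hn := h.normalized
      simp only [e] at hM' hn ⊢
      refine plainState_insert (L₁ := pre) (L₂ := .tau (Λ.strand α a) ::
        ks.flatMap EventKind.pureLetters) (h.domain _ (by simp) a ha)
        (h.pos _ (by simp) a ha) (fun h1 => (hlater a ha a h1).1 rfl)
        (fun x hx => (hlater a ha x hx).2) ho.normalized hn hM₂ hM' ?_ ?_
      · simp [EventKind.map, EventKind.pureLetters]
      · rw [List.map_cons, hmap a ha]
        simp [EventKind.pureLetters, PureLetter.map]
    | cross d a b =>
      have ha : a ∈ (EventKind.cross d a b).points := by simp [EventKind.points]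
      have hb : b ∈ (EventKind.cross d a b).points := by simp [EventKind.points]
      have hab : a ≠ b := h.valid _ (List.mem_cons_self)
      have e : eventPoints (.cross d a b :: ks) = insert a (insert b (eventPoints ks)) := by
        ext v
        simp [mem_eventPoints, EventKind.points, or_assoc]
      have hn := h.normalized
      have htime := h.eq _ (List.mem_cons_self) a ha b hb
      have hne := Λ.strand_ne_of_time_eq (h.domain _ (by simp) a ha)
        (h.domain _ (by simp) b hb) hab htime
      simp only [e] at hM' hn ⊢
      have hn₁ : Normalized (insert b (eventPoints ks) ∪ Λ.rayNodes α) :=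
        hn.mono (Finset.union_subset_union_left (Finset.subset_insert _ _))
      -- A crossing needs two insertions; halfway, its strand through `b` is renamed and the one
      -- through `a` is not.
      let mid := pre ++ ((EventKind.cross d (Λ.strand α a) b).pureLetters ++
        ks.flatMap EventKind.pureLetters)
      have hmid : ∀ l ∈ mid,
          l.Ok (↑(insert b (eventPoints ks) ∪ Λ.rayNodes α) : Set (Fin L.numComp × ℝ)) := by
        intro l hl
        rcases List.mem_append.1 hl with hl | hl
        · exact (hpre l hl).mono (by rw [Finset.coe_union]; exact Set.subset_union_right)
        rcases List.mem_append.1 hl with hl | hl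
        · refine EventKind.ok_of_mem_pureLetters
            (k := .cross d (Λ.strand α a) b) (hray b hb _ (Λ.strand_mem_rayNodes a)).symm hl ?_
          intro v hv
          simp only [EventKind.points, List.mem_cons, List.not_mem_nil, or_false] at hv
          rcases hv with rfl | rfl
          · simp [Λ.strand_mem_rayNodes]
          · simp
        · exact (ho.letters_ok l hl).mono fun v hv => by
            simp [Finset.mem_coe.1 hv]
      have hs1 : swap (Λ.strand α b) b (Λ.strand α a) = Λ.strand α a :=
        swap_apply_of_ne_of_ne hne (hray b hb _ (Λ.strand_mem_rayNodes a)).symm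
      have hs2 : swap (Λ.strand α a) a b = b :=
        swap_apply_of_ne_of_ne (hray b hb _ (Λ.strand_mem_rayNodes a)) hab.symm
      refine (plainState_insert (L₁ := pre) (M' := mid)
        (L₂ := (EventKind.cross d (Λ.strand α a) (Λ.strand α b)).pureLetters ++
        ks.flatMap EventKind.pureLetters) (h.domain _ (by simp) b hb)
        (h.pos _ (by simp) b hb) (fun h1 => (hlater b hb b h1).1 rfl)
        (fun x hx => (hlater b hb x hx).2) ho.normalized hn₁ hM₂ hmid ?_ ?_).trans
        (plainState_insert (L₁ := pre) (L₂ := (EventKind.cross d (Λ.strand α a) b).pureLetters ++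
        ks.flatMap EventKind.pureLetters) (h.domain _ (by simp) a ha)
        (h.pos _ (by simp) a ha) ?_ (fun x hx => ?_) hn₁ hn hmid hM' rfl ?_)
      · simp [EventKind.map]
      · rw [List.map_append, ← EventKind.pureLetters_map, hmap b hb, EventKind.map, hs1,
          swap_apply_left]
      · rw [Finset.mem_insert, not_or]
        exact ⟨hab, fun h1 => (hlater a ha a h1).1 rfl⟩
      · rcases Finset.mem_insert.1 hx with rfl | hx
        · exact htime.le
        · exact (hlater a ha x hx).2
      · rw [List.map_append, ← EventKind.pureLetters_map, hmap a ha, EventKind.map, hs2,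
          swap_apply_left]
        simp

end Lift

end Insertion

/-! ### The motion of the strands of a braided diagram -/

section BraidedMotion

theorem cross_div_div (a b c : ℂ) : cross (a / c) (b / c) = cross a b / Complex.normSq c := by
  by_cases hc : Complex.normSq c = 0
  · simp [Complex.normSq_eq_zero.1 hc, cross]
  · simp only [cross, Complex.div_re, Complex.div_im]
    field_simp
    rw [Complex.normSq_apply]
    ring

namespace LinkDiagram

variable (L : LinkDiagram)

theorem finite_wenPoints : L.wenPoints.Finite := by
  refine (Set.finite_iUnion fun j => (L.wen_finite j).image (L.curve j)).subset ?_
  rintro p ⟨j, t, ht, rfl⟩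
  refine Set.mem_iUnion.2 ⟨j, Int.fract t, ⟨?_, Int.fract_nonneg t, Int.fract_lt_one t⟩, ?_⟩
  · rw [← L.periodic_wen.add_int j _ ⌊t⌋, Int.fract_add_floor]
    exact ht
  · rw [← L.curve_add_int j _ ⌊t⌋, Int.fract_add_floor]

/-- The double points and the wen marks. -/
def specialPoints : Set ℂ := L.doublePoints ∪ L.wenPoints

theorem finite_specialPoints : L.specialPoints.Finite := L.finite_double.union L.finite_wenPoints

/-- The point `p` is a double point or wen mark of the given kind. -/
def KindAt (p : ℂ) : EventKind (Fin L.numComp × ℝ) → Prop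
  | .cross d x y => d = L.deco p ∧ x.2 ∈ Set.Ico (0 : ℝ) 1 ∧ y.2 ∈ Set.Ico (0 : ℝ) 1 ∧ x ≠ y ∧
      L.curve x.1 x.2 = p ∧ L.curve y.1 y.2 = p ∧
      0 < cross (deriv (L.curve y.1) y.2) (deriv (L.curve x.1) x.2)
  | .wen x => x.2 ∈ Set.Ico (0 : ℝ) 1 ∧ L.curve x.1 x.2 = p ∧ x.2 ∈ L.wen x.1

theorem mem_doublePoints {x y : Fin L.numComp × ℝ} (hx : x.2 ∈ Set.Ico (0 : ℝ) 1)
    (hy : y.2 ∈ Set.Ico (0 : ℝ) 1) (hxy : x ≠ y) {p : ℂ} (hxp : L.curve x.1 x.2 = p)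
    (hyp : L.curve y.1 y.2 = p) : p ∈ L.doublePoints :=
  ⟨x, y, fun e => hxy (L.eq_of_domain hx hy e), hxp, hyp⟩

theorem exists_kindAt {p : ℂ} (hp : p ∈ L.specialPoints) : ∃ k, L.KindAt p k := by
  rcases hp with hp | ⟨j, t, ht, rfl⟩
  · obtain ⟨x₀, -⟩ := id hp
    obtain ⟨x, hx, -, hxp⟩ := L.exists_other_branch hp x₀
    obtain ⟨y, hy, hyx, hyp⟩ := L.exists_other_branch hp x
    rcases lt_or_gt_of_ne (L.cross_ne_zero hx hy hyx.symm (hxp.trans hyp.symm)) with h | h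
    · rw [cross_swap] at h
      exact ⟨.cross (L.deco p) x y, rfl, hx, hy, hyx.symm, hxp, hyp, by linarith⟩
    · exact ⟨.cross (L.deco p) y x, rfl, hy, hx, hyx, hyp, hxp, h⟩
  · refine ⟨.wen (toDomain (j, t)), toDomain_mem _, L.curve_toDomain _, ?_⟩
    change Int.fract t ∈ L.wen j
    rwa [← L.periodic_wen.add_int j _ ⌊t⌋, Int.fract_add_floor]

theorem exists_kinds (l : List ℂ) (hl : ∀ p ∈ l, p ∈ L.specialPoints) :
    ∃ ps : List (ℂ × EventKind (Fin L.numComp × ℝ)), ps.map Prod.fst = l ∧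
      ∀ e ∈ ps, L.KindAt e.1 e.2 := by
  induction l with
  | nil => exact ⟨[], rfl, by simp⟩
  | cons p l ih =>
    obtain ⟨ps, rfl, h⟩ := ih fun q hq => hl q (by simp [hq])
    obtain ⟨k, hk⟩ := L.exists_kindAt (hl p (by simp))
    refine ⟨(p, k) :: ps, rfl, fun e he => ?_⟩
    rcases List.mem_cons.1 he with rfl | he
    exacts [hk, h e he]

variable {L}

namespace KindAt

variable {p : ℂ} {k : EventKind (Fin L.numComp × ℝ)}

theorem valid (h : L.KindAt p k) : k.Valid := by
  cases k with
  | cross d a b => exact h.2.2.2.1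
  | wen a => trivial

theorem of_mem_points (h : L.KindAt p k) {x : Fin L.numComp × ℝ} (hx : x ∈ k.points) :
    x.2 ∈ Set.Ico (0 : ℝ) 1 ∧ L.curve x.1 x.2 = p := by
  rcases k with ⟨d, a, b⟩ | a <;>
    simp only [EventKind.points, List.mem_cons, List.not_mem_nil, or_false] at hx
  · obtain ⟨-, ha, hb, -, hap, hbp, -⟩ := h
    rcases hx with rfl | rfl
    exacts [⟨ha, hap⟩, ⟨hb, hbp⟩]
  · rw [hx]
    exact ⟨h.1, h.2.1⟩

theorem notMem_doublePoints {a : Fin L.numComp × ℝ} (h : L.KindAt p (.wen a)) :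
    p ∉ L.doublePoints := by
  rw [← h.2.1]
  exact L.wen_not_double _ _ h.2.2

theorem mem_points (h : L.KindAt p k) {x : Fin L.numComp × ℝ} (hx : x.2 ∈ Set.Ico (0 : ℝ) 1)
    (hxp : L.curve x.1 x.2 = p) : x ∈ k.points := by
  cases k with
  | cross d a b =>
    obtain ⟨-, ha, hb, hab, hap, hbp, -⟩ := h
    simpa [EventKind.points] using
      L.eq_or_eq_of_curve_eq ha hb hx hab (hap.trans hbp.symm) (hap.trans hxp.symm)
  | wen a =>
    by_contra hne
    simp only [EventKind.points, List.mem_singleton] at hne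
    exact h.notMem_doublePoints (L.mem_doublePoints hx h.1 hne hxp h.2.1)

end KindAt

end LinkDiagram

namespace Lift

variable {L : LinkDiagram} {O : ℂ} (Λ : Lift L O) {α : ℝ}

/-- The positions in the direction of a given point. -/
theorem sub_eq_mul_exp_iff {x : Fin L.numComp × ℝ} {z : ℂ} {r : ℝ} (hr : 0 < r) :
    L.curve x.1 x.2 - O = r * Complex.exp z ↔
      (∃ m : ℤ, Λ.angle x.1 x.2 = z.im + 2 * Real.pi * m) ∧
        Real.log ‖L.curve x.1 x.2 - O‖ = Real.log r + z.re := by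
  have h1 : (r : ℂ) * Complex.exp z = Complex.exp ((Real.log r : ℝ) + z) := by
    rw [Complex.exp_add, ← Complex.ofReal_exp, Real.exp_log hr]
  rw [h1, ← Λ.exp_log, Complex.norm_exp, Real.log_exp, Complex.exp_eq_exp_iff_exists_int,
    Λ.angle_eq]
  constructor
  · rintro ⟨m, hm⟩
    rw [hm]
    constructor
    · refine ⟨m, ?_⟩
      simp [Complex.mul_im]
      ring
    · simp [Complex.mul_re]
  · rintro ⟨⟨m, hm⟩, h⟩
    refine ⟨m, Complex.ext ?_ ?_⟩
    · rw [h]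
      simp [Complex.mul_re]
    · rw [hm]
      simp [Complex.mul_im]
      ring

theorem angleFrom_eq_time (α : ℝ) (x : Fin L.numComp × ℝ) :
    angleFrom O (Complex.exp (α * Complex.I)) (L.curve x.1 x.2) = Λ.time α x := by
  obtain ⟨m, hm⟩ := Λ.exists_angle_eq α x
  rw [angleFrom, ← Λ.exp_log, ← Complex.exp_sub, Complex.arg_exp, toIcoMod_eq_iff]
  refine ⟨⟨Λ.time_nonneg α x, by simpa using Λ.time_lt α x⟩,
    m - toIocDiv Real.two_pi_pos (-Real.pi) (Λ.log x.1 x.2 - α * Complex.I).im, ?_⟩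
  rw [toIocMod, Complex.sub_im, ← Λ.angle_eq, hm]
  simp only [Complex.mul_im, Complex.ofReal_re, Complex.I_im, mul_one, Complex.ofReal_im,
    Complex.I_re, mul_zero, add_zero, zsmul_eq_mul]
  push_cast
  ring

theorem strandsOnRay_eq (α : ℝ) :
    strandsOnRay L O (Complex.exp (α * Complex.I)) = (Λ.rayNodes α).card := by
  rw [strandsOnRay, rayNodes, ← Set.ncard_eq_toFinset_card _ (Λ.finite_onRay α)]
  congr 1
  ext x
  refine and_congr_right fun _ => ⟨?_, ?_⟩
  · rintro ⟨r, hr, h⟩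
    simpa using ((Λ.sub_eq_mul_exp_iff hr).1 h).1
  · rintro h
    have hpos : 0 < ‖L.curve x.1 x.2 - O‖ := by
      rw [← Λ.exp_log, Complex.norm_exp]
      exact Real.exp_pos _
    exact ⟨_, hpos, (Λ.sub_eq_mul_exp_iff hpos).2 ⟨by simpa using h, by simp⟩⟩

/-- Points on the ray through `x` correspond to strands by turning from the initial ray by the angle
of `x`, and the factor `r` is the exponential of the difference of the logarithmic distances. -/
theorem strandsOutside_eq (α : ℝ) (x : Fin L.numComp × ℝ) :
    strandsOutside L O (L.curve x.1 x.2) = ((Λ.rayNodes α).filter fun v =>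
      Λ.radius (Λ.strand α x) (Λ.time α x) < Λ.radius v (Λ.time α x)).card := by
  set t := Λ.time α x with ht
  have h0 := Λ.time_nonneg α x
  have h1 := Λ.time_lt α x
  have hre : (Λ.log x.1 x.2).re = Λ.radius (Λ.strand α x) t := by
    rw [Λ.radius_coord, Λ.re_log]
  obtain ⟨m, hm⟩ := Λ.exists_angle_eq α x
  have hinj : Set.InjOn (fun v => toDomain (Λ.pt v t)) ↑((Λ.rayNodes α).filter fun v =>
      Λ.radius (Λ.strand α x) t < Λ.radius v t) := by
    intro v hv w hw hvw
    rw [Finset.coe_filter] at hv hw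
    exact (Λ.coord_unique (Λ.mem_rayNodes.1 hv.1) (Λ.mem_rayNodes.1 hw.1) h0 h1 h0 h1
      (samePoint_iff.2 hvw)).1
  rw [strandsOutside, ← Set.ncard_coe_finset, ← hinj.ncard_image]
  congr 1
  ext c
  constructor
  · rintro ⟨hc, r, hr, h⟩
    have hr0 : 0 < r := one_pos.trans hr
    rw [← Λ.exp_log x.1, Λ.sub_eq_mul_exp_iff hr0] at h
    obtain ⟨⟨l, hl⟩, h2⟩ := h
    rw [← Λ.angle_eq] at hl
    have htc : Λ.time α c = t := Λ.time_eq_of_angle (m := m + l) h0 h1 (by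
      rw [hl, hm]
      push_cast
      ring)
    refine ⟨Λ.strand α c, ?_, ?_⟩
    · rw [Finset.coe_filter]
      refine ⟨Λ.strand_mem_rayNodes c, ?_⟩
      have h3 := Λ.radius_coord α c
      rw [htc, h2, hre] at h3
      rw [h3]
      linarith [Real.log_pos hr]
    · have h3 := samePoint_iff.1 (Λ.samePoint_coord α c)
      rw [htc, toDomain_eq_self hc] at h3
      exact h3
  · rintro ⟨v, hv, rfl⟩
    rw [Finset.coe_filter] at hv
    obtain ⟨hv, hlt⟩ := hv
    refine ⟨toDomain_mem _, Real.exp (Λ.radius v t - Λ.radius (Λ.strand α x) t), ?_, ?_⟩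
    · exact Real.one_lt_exp_iff.2 (by linarith)
    · rw [← Λ.exp_log x.1, L.curve_toDomain, Λ.sub_eq_mul_exp_iff (Real.exp_pos _),
        ← Λ.radius_eq, Real.log_exp, hre, Λ.angle_pt, ← Λ.angle_eq, hm]
      obtain ⟨l, hl⟩ := (Λ.mem_rayNodes.1 hv).2
      refine ⟨⟨l - m, ?_⟩, by ring⟩
      rw [hl]
      push_cast
      ring

/-- At a double point, the strands change their order. -/
theorem radius_deriv (h : L.IsBraidedAround O) {x y : Fin L.numComp × ℝ}
    (hxy : L.curve x.1 x.2 = L.curve y.1 y.2)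
    (hc : 0 < cross (deriv (L.curve y.1) y.2) (deriv (L.curve x.1) x.2)) :
    ∃ c : ℝ, 0 < c ∧ HasDerivAt
      (fun t => Λ.radius (Λ.strand α y) t - Λ.radius (Λ.strand α x) t) c (Λ.time α x) := by
  have hd : ∀ x, HasDerivAt (Λ.radius (Λ.strand α x))
      ((deriv (L.curve x.1) x.2 / (L.curve x.1 x.2 - O)).re /
        (deriv (L.curve x.1) x.2 / (L.curve x.1 x.2 - O)).im) (Λ.time α x) := by
    intro x
    have h1 := Λ.hasDerivAt_radius h (Λ.strand α x) (Λ.time α x)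
    have h2 := L.curve_eq_of_samePoint (Λ.samePoint_coord α x)
    have h3 := L.deriv_eq_of_samePoint (Λ.samePoint_coord α x)
    dsimp only [pt] at h2 h3
    rwa [h2, h3] at h1
  have him : ∀ x : Fin L.numComp × ℝ,
      0 < (deriv (L.curve x.1) x.2 / (L.curve x.1 x.2 - O)).im := fun x => by
    rw [im_div_eq_cross]
    exact div_pos (h.monotone _ _) (Complex.normSq_pos.2 (sub_ne_zero.2 (h.avoids _ _)))
  have hy := hd y
  rw [← Λ.time_eq_of_curve_eq hxy] at hy
  refine ⟨_, ?_, hy.sub (hd x)⟩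
  have h1 := him x
  have h2 := him y
  -- The slopes are quotients of real by imaginary parts with positive denominators, so the sign of
  -- their difference is that of this determinant; division by the common `curve - O` does not
  -- affect it.
  have h3 : 0 < cross (deriv (L.curve y.1) y.2 / (L.curve x.1 x.2 - O))
      (deriv (L.curve x.1) x.2 / (L.curve x.1 x.2 - O)) := by
    rw [cross_div_div]
    exact div_pos hc (Complex.normSq_pos.2 (sub_ne_zero.2 (h.avoids _ _)))
  rw [hxy] at h1 h3 ⊢
  rw [cross] at h3
  rw [sub_pos, div_lt_div_iff₀ h1 h2]
  linarith

end Lift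

theorem eventually_lt_of_hasDerivAt_pos {f g : ℝ → ℝ} {c t : ℝ} (hc : 0 < c)
    (h : HasDerivAt (fun x => g x - f x) c t) (h0 : f t = g t) :
    (∀ᶠ x in 𝓝[<] t, g x < f x) ∧ ∀ᶠ x in 𝓝[>] t, f x < g x := by
  have h1 := (hasDerivAt_iff_tendsto_slope.1 h).eventually (lt_mem_nhds hc)
  have key : ∀ x, slope (fun x => g x - f x) t x = (x - t)⁻¹ * (g x - f x) := fun x => by
    simp [slope, h0]
  constructor
  · have h2 : ∀ᶠ x in 𝓝[<] t, 0 < slope (fun x => g x - f x) t x :=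
      h1.filter_mono (nhdsWithin_mono _ fun x hx => ne_of_lt hx)
    filter_upwards [h2, self_mem_nhdsWithin] with x hx hxt
    rw [key] at hx
    have h3 : (x - t)⁻¹ < 0 := inv_lt_zero.2 (sub_neg.2 hxt)
    nlinarith
  · have h2 : ∀ᶠ x in 𝓝[>] t, 0 < slope (fun x => g x - f x) t x :=
      h1.filter_mono (nhdsWithin_mono _ fun x hx => ne_of_gt hx)
    filter_upwards [h2, self_mem_nhdsWithin] with x hx hxt
    rw [key] at hx
    have h3 : 0 < (x - t)⁻¹ := inv_pos.2 (sub_pos.2 hxt)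
    nlinarith

end BraidedMotion

/-! ### The braid of a braided diagram -/

section BraidWord

open Equiv

namespace EventKind

variable {α β : Type*} {k : EventKind α} {v w : α}

theorem points_map (f : α → β) (k : EventKind α) : (k.map f).points = k.points.map f := by
  cases k <;> rfl

theorem strand_map (f : α → β) (k : EventKind α) : (k.map f).strand = f k.strand := by
  cases k <;> rfl

theorem strand_mem_points (k : EventKind α) : k.strand ∈ k.points := by
  cases k <;> simp [strand, points]

theorem IsPair.mem_points (h : k.IsPair v w) : v ∈ k.points ∧ w ∈ k.points := by
  cases k with
  | cross d a b => rcases h with ⟨rfl, rfl⟩ | ⟨rfl, rfl⟩ <;> simp [points]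
  | wen a => exact h.elim

theorem isPair_of_mem_points (hv : v ∈ k.points) (hw : w ∈ k.points) (hvw : v ≠ w) :
    k.IsPair v w := by
  cases k with
  | cross d a b =>
    simp only [points, List.mem_cons, List.not_mem_nil, or_false] at hv hw
    rcases hv with rfl | rfl <;> rcases hw with rfl | rfl
    exacts [absurd rfl hvw, Or.inl ⟨rfl, rfl⟩, Or.inr ⟨rfl, rfl⟩, absurd rfl hvw]
  | wen a =>
    simp only [points, List.mem_singleton] at hv hw
    exact absurd (hv.trans hw.symm) hvw

end EventKind

namespace Lift

variable {L : LinkDiagram} {O : ℂ} (Λ : Lift L O) {α : ℝ}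

/-- The angle from the ray in the direction `exp (i α)`. -/
noncomputable def angleAt (O : ℂ) (α : ℝ) (p : ℂ) : ℝ :=
  angleFrom O (Complex.exp (α * Complex.I)) p

/-- The double points and wen marks, in the order in which they are met when turning around `O`. -/
structure IsSchedule (L : LinkDiagram) (O : ℂ) (α : ℝ)
    (ps : List (ℂ × EventKind (Fin L.numComp × ℝ))) : Prop where
  nodup : (ps.map Prod.fst).Nodup
  mem : ∀ p, p ∈ ps.map Prod.fst ↔ p ∈ L.specialPoints
  kind : ∀ e ∈ ps, L.KindAt e.1 e.2
  sorted : ps.Pairwise fun e e' => angleAt O α e.1 ≤ angleAt O α e'.1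
  pos : ∀ e ∈ ps, 0 < angleAt O α e.1

theorem exists_schedule (Λ : Lift L O) : ∃ (α : ℝ) (ps : List (ℂ × EventKind (Fin L.numComp × ℝ))),
    IsSchedule L O α ps := by
  classical
  have hp := Real.two_pi_pos
  -- Only finitely many directions contain a double point or a wen mark, so some ray avoids them
  -- all.
  obtain ⟨α, hα, hα'⟩ := ((Set.Ico_infinite hp).sdiff
    (L.finite_specialPoints.image (angleAt O 0))).nonempty
  let r : ℂ → ℂ → Prop := fun p q => angleAt O α p ≤ angleAt O α q
  have : Std.Total r := ⟨fun p q => le_total _ _⟩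
  have : IsTrans ℂ r := ⟨fun p q s => le_trans⟩
  let l := L.finite_specialPoints.toFinset.toList.insertionSort r
  have hl : ∀ p, p ∈ l ↔ p ∈ L.specialPoints := fun p => by simp [l]
  obtain ⟨ps, hps, hk⟩ := L.exists_kinds l fun p hp => (hl p).1 hp
  refine ⟨α, ps, ?_, by rw [hps]; exact hl, hk, ?_, fun e he => ?_⟩
  · rw [hps]
    exact (List.perm_insertionSort r _).nodup_iff.2 (Finset.nodup_toList _)
  · have h1 : (ps.map Prod.fst).Pairwise r := by
      rw [hps]
      exact List.pairwise_insertionSort r _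
    exact (List.pairwise_map (R := r)).1 h1
  · have h1 := hk e he
    obtain ⟨h2, h3⟩ := h1.of_mem_points e.2.strand_mem_points
    have hs : e.1 ∈ L.specialPoints := by
      rw [← hl, ← hps]
      exact List.mem_map_of_mem he
    rw [← h3, angleAt, Λ.angleFrom_eq_time]
    refine lt_of_le_of_ne (Λ.time_nonneg α _) fun h4 => hα' ⟨e.1, hs, ?_⟩
    obtain ⟨m, hm⟩ := Λ.exists_angle_eq α e.2.strand
    rw [← h3, angleAt, Λ.angleFrom_eq_time]
    exact Λ.time_eq_of_angle (m := m) hα.1 hα.2 (by rw [hm, ← h4]; ring)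

/-- The events on the strands that start at the ray. -/
noncomputable def events (α : ℝ) (ps : List (ℂ × EventKind (Fin L.numComp × ℝ))) :
    List (ℝ × EventKind (Fin L.numComp × ℝ)) :=
  ps.map fun e => (angleAt O α e.1, e.2.map (Λ.strand α))

variable {ps : List (ℂ × EventKind (Fin L.numComp × ℝ))}

theorem _root_.ExtWelded.LinkDiagram.KindAt.time_eq {p : ℂ}
    {k : EventKind (Fin L.numComp × ℝ)} (h : L.KindAt p k)
    {x : Fin L.numComp × ℝ} (hx : x ∈ k.points) : Λ.time α x = angleAt O α p := by
  rw [← (h.of_mem_points hx).2, angleAt, Λ.angleFrom_eq_time]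

theorem IsSchedule.curve_pt {e : ℂ × EventKind (Fin L.numComp × ℝ)} (h : IsSchedule L O α ps)
    (he : e ∈ ps) {v : Fin L.numComp × ℝ} (hv : v ∈ (e.2.map (Λ.strand α)).points) :
    L.curve (Λ.pt v (angleAt O α e.1)).1 (Λ.pt v (angleAt O α e.1)).2 = e.1 := by
  rw [EventKind.points_map] at hv
  obtain ⟨x, hx, rfl⟩ := List.mem_map.1 hv
  have hk := h.kind e he
  rw [← hk.time_eq Λ hx, L.curve_eq_of_samePoint (Λ.samePoint_coord α x)]
  exact (hk.of_mem_points hx).2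

theorem IsSchedule.angle_lt {e : ℂ × EventKind (Fin L.numComp × ℝ)} (h : IsSchedule L O α ps)
    (Λ : Lift L O) (he : e ∈ ps) : angleAt O α e.1 < 2 * Real.pi := by
  rw [← (h.kind e he).time_eq Λ e.2.strand_mem_points]
  exact Λ.time_lt _ _

theorem IsSchedule.mem_strands {e : ℂ × EventKind (Fin L.numComp × ℝ)} (h : IsSchedule L O α ps)
    (he : e ∈ ps) {c : Fin L.numComp × ℝ} (hc : c ∈ Λ.onRay α) {t : ℝ} (ht : 0 ≤ t)
    (ht' : t < 2 * Real.pi)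
    (hp : L.curve (Λ.pt c t).1 (Λ.pt c t).2 = e.1) :
    c ∈ (e.2.map (Λ.strand α)).points := by
  rw [EventKind.points_map]
  have h1 := samePoint_toDomain (Λ.pt c t)
  refine List.mem_map.2 ⟨toDomain (Λ.pt c t), (h.kind e he).mem_points (toDomain_mem _)
    (by rwa [L.curve_toDomain]), ?_⟩
  refine (Λ.coord_eq hc ht ht' ?_).1
  rw [samePoint_iff] at h1 ⊢
  exact h1.symm

theorem curve_pt_eq {v w : Fin L.numComp × ℝ} (hv : v ∈ Λ.onRay α) (hw : w ∈ Λ.onRay α) {t : ℝ}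
    (hr : Λ.radius v t = Λ.radius w t) :
    L.curve (Λ.pt v t).1 (Λ.pt v t).2 = L.curve (Λ.pt w t).1 (Λ.pt w t).2 := by
  obtain ⟨m, hm⟩ := hv.2
  obtain ⟨l, hl⟩ := hw.2
  have hpos : ∀ x : Fin L.numComp × ℝ, 0 < ‖L.curve x.1 x.2 - O‖ := fun x => by
    rw [← Λ.exp_log, Complex.norm_exp]
    exact Real.exp_pos _
  refine Λ.curve_eq_of_angle (m := m - l) ?_ ?_
  · rw [Λ.angle_pt, Λ.angle_pt, hm, hl]
    push_cast
    ring
  · rw [Λ.radius_eq, Λ.radius_eq] at hr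
    exact Real.log_injOn_pos (hpos _) (hpos _) hr

/-- Two strands have the same distance at an angle exactly when they pass through the same point,
that is, at a double point; `radius_deriv` gives the side on which each of them is before and after.
-/
theorem IsSchedule.motion (h : IsSchedule L O α ps) (hL : L.IsBraidedAround O) :
    Motion (Λ.rayNodes α) Λ.radius (2 * Real.pi) (Λ.events α ps) := by
  have hcross : ∀ e ∈ ps, ∀ d a b, e.2.map (Λ.strand α) = .cross d a b →
      a ∈ Λ.rayNodes α ∧ b ∈ Λ.rayNodes α ∧ a ≠ b ∧
      Λ.radius a (angleAt O α e.1) = Λ.radius b (angleAt O α e.1) ∧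
      (∀ᶠ t in 𝓝[<] (angleAt O α e.1), Λ.radius b t < Λ.radius a t) ∧
      ∀ᶠ t in 𝓝[>] (angleAt O α e.1), Λ.radius a t < Λ.radius b t := by
    rintro ⟨p, k⟩ he d a b hab
    have hk := h.kind _ he
    have hc := fun v => h.curve_pt Λ (v := v) he
    dsimp only at hk hab hc ⊢
    cases k with
    | wen x => simp [EventKind.map] at hab
    | cross d' x y =>
      simp only [EventKind.map, EventKind.cross.injEq] at hab
      obtain ⟨rfl, rfl, rfl⟩ := hab
      have hx : x ∈ (EventKind.cross d' x y).points := by simp [EventKind.points]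
      have hy : y ∈ (EventKind.cross d' x y).points := by simp [EventKind.points]
      have hxt := hk.time_eq Λ (α := α) hx
      have hyt := hk.time_eq Λ (α := α) hy
      have heq : Λ.radius (Λ.strand α x) (angleAt O α p) =
          Λ.radius (Λ.strand α y) (angleAt O α p) := by
        rw [Λ.radius_eq, Λ.radius_eq, hc _ (by simp [EventKind.map, EventKind.points]),
          hc _ (by simp [EventKind.map, EventKind.points])]
      obtain ⟨-, hxd, hyd, hxy, hxp, hyp, hpos⟩ := hk
      obtain ⟨c, hc0, hcd⟩ := Λ.radius_deriv (α := α) hL (hxp.trans hyp.symm) hpos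
      rw [hxt] at hcd
      exact ⟨Λ.strand_mem_rayNodes _, Λ.strand_mem_rayNodes _,
        Λ.strand_ne_of_time_eq hxd hyd hxy (hxt.trans hyt.symm), heq,
        eventually_lt_of_hasDerivAt_pos hc0 hcd heq⟩
  refine
    { cont := fun v _ => Λ.continuous_radius v
      nonneg := Real.two_pi_pos.le
      sorted := List.pairwise_map.2 h.sorted
      distinct := ?_
      range := ?_
      mem := ?_
      mem_wen := ?_
      eq := ?_
      ne := ?_
      before := ?_
      after := ?_
      zeros := ?_ }
  -- The same strand at the same angle is at one point of the plane, and the points of the schedule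
  -- are distinct.
  · refine List.pairwise_map.2 ((List.pairwise_map.1 h.nodup).imp_of_mem ?_)
    intro e e' he he' hne v w hp hp' heq
    have h1 := h.curve_pt Λ he hp.mem_points.1
    have h2 := h.curve_pt Λ he' hp'.mem_points.1
    dsimp only at heq
    rw [heq] at h1
    exact hne (h1.symm.trans h2)
  · intro e₀ he₀
    obtain ⟨e, he, rfl⟩ := List.mem_map.1 he₀
    exact ⟨h.pos e he, h.angle_lt Λ he⟩
  · intro e₀ he₀ d a b hab
    obtain ⟨e, he, rfl⟩ := List.mem_map.1 he₀
    have := hcross e he d a b hab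
    exact ⟨this.1, this.2.1, this.2.2.1⟩
  · intro e₀ he₀ a ha
    obtain ⟨⟨p, k⟩, he, rfl⟩ := List.mem_map.1 he₀
    cases k with
    | cross d x y => simp [EventKind.map] at ha
    | wen x =>
      simp only [EventKind.map, EventKind.wen.injEq] at ha
      exact ha ▸ Λ.strand_mem_rayNodes x
  · intro e₀ he₀ d a b hab
    obtain ⟨e, he, rfl⟩ := List.mem_map.1 he₀
    exact (hcross e he d a b hab).2.2.2.1
  · intro e₀ he₀ c hc hr
    obtain ⟨e, he, rfl⟩ := List.mem_map.1 he₀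
    have hs := (e.2.map (Λ.strand α)).strand_mem_points
    have hs' : (e.2.map (Λ.strand α)).strand ∈ Λ.onRay α := by
      rw [EventKind.strand_map]
      exact Λ.strand_mem _ _
    have h1 := (Λ.curve_pt_eq (Λ.mem_rayNodes.1 hc) hs' hr).trans (h.curve_pt Λ he hs)
    have h2 := h.mem_strands Λ he (Λ.mem_rayNodes.1 hc) (h.pos e he).le (h.angle_lt Λ he) h1
    by_cases heq : c = (e.2.map (Λ.strand α)).strand
    · exact Or.inl heq
    · exact Or.inr (EventKind.isPair_of_mem_points hs h2 (Ne.symm heq))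
  · intro e₀ he₀ d a b hab
    obtain ⟨e, he, rfl⟩ := List.mem_map.1 he₀
    exact (hcross e he d a b hab).2.2.2.2.1
  · intro e₀ he₀ d a b hab
    obtain ⟨e, he, rfl⟩ := List.mem_map.1 he₀
    exact (hcross e he d a b hab).2.2.2.2.2
  · intro v hv w hw hvw t ht hr
    have hv' := Λ.mem_rayNodes.1 hv
    have hw' := Λ.mem_rayNodes.1 hw
    have h1 := Λ.curve_pt_eq hv' hw' hr
    have h2 : L.curve (Λ.pt v t).1 (Λ.pt v t).2 ∈ L.specialPoints :=
      Or.inl ⟨Λ.pt v t, Λ.pt w t, fun hs =>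
        hvw (L.eq_of_domain hv'.1 hw'.1 (Λ.samePoint_of_samePoint_pt hs)), rfl, h1.symm⟩
    obtain ⟨e, he, hep⟩ := List.mem_map.1 ((h.mem _).2 h2)
    have htime : Λ.time α (Λ.pt v t) = angleAt O α e.1 := by
      rw [hep, angleAt, Λ.angleFrom_eq_time]
    obtain ⟨m, hm⟩ := hv'.2
    -- At `t = 2π` the double point would lie on the initial ray, which avoids all double points.
    have ht2 : t < 2 * Real.pi := by
      refine lt_of_le_of_ne ht.2 fun h3 => ?_
      have := Λ.time_eq_of_angle (x := Λ.pt v t) (α := α) (β := 0) (m := m + 1) le_rfl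
        Real.two_pi_pos (by
          rw [Λ.angle_pt, hm, h3]
          push_cast
          ring)
      have hpos := h.pos e he
      rw [← htime, this] at hpos
      exact lt_irrefl _ hpos
    have h3 := Λ.time_eq_of_angle (x := Λ.pt v t) (α := α) (β := t) (m := m) ht.1 ht2 (by
      rw [Λ.angle_pt, hm]
      ring)
    refine ⟨_, List.mem_map_of_mem he, ?_, htime.symm.trans h3⟩
    exact EventKind.isPair_of_mem_points (h.mem_strands Λ he hv' ht.1 ht2 hep.symm)
      (h.mem_strands Λ he hw' ht.1 ht2 (h1.symm.trans hep.symm)) hvw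

theorem IsSchedule.strandsOutside_eq_rank (h : IsSchedule L O α ps)
    {e : ℂ × EventKind (Fin L.numComp × ℝ)} (he : e ∈ ps) :
    strandsOutside L O e.1 =
      rank (Λ.rayNodes α) Λ.radius (angleAt O α e.1, e.2.map (Λ.strand α)) := by
  have hk := h.kind e he
  have h1 := Λ.strandsOutside_eq α e.2.strand
  rw [(hk.of_mem_points e.2.strand_mem_points).2, hk.time_eq Λ e.2.strand_mem_points] at h1
  rw [h1, rank]
  simp only [EventKind.strand_map]

/-- The letter of a double point or wen mark. -/
theorem IsSchedule.exists_letter (h : IsSchedule L O α ps) (hL : L.IsBraidedAround O)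
    {e : ℂ × EventKind (Fin L.numComp × ℝ)} (he : e ∈ ps) :
    ∃ l : Letter (Λ.rayNodes α).card, IsLetterAt L O e.1 l ∧
      l.toGroup = (e.2.map (Λ.strand α)).toGroup (Λ.rayNodes α).card
        (rank (Λ.rayNodes α) Λ.radius (angleAt O α e.1, e.2.map (Λ.strand α))) := by
  classical
  have hM := h.motion Λ hL
  have he' : (angleAt O α e.1, e.2.map (Λ.strand α)) ∈ Λ.events α ps :=
    List.mem_map_of_mem he
  have hk := h.kind e he
  have ho := h.strandsOutside_eq_rank Λ he
  have heq := hM.eq _ he'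
  have hmem := hM.mem _ he'
  have hmw := hM.mem_wen _ he'
  obtain ⟨p, k⟩ := e
  dsimp only at *
  rw [← ho]
  cases k with
  | wen x =>
    have hlt : strandsOutside L O p < (Λ.rayNodes α).card := by
      rw [ho]
      refine Finset.card_lt_card ⟨Finset.filter_subset _ _, fun hsub => ?_⟩
      exact lt_irrefl _ (Finset.mem_filter.1 (hsub (Λ.strand_mem_rayNodes x))).2
    exact ⟨.tau ⟨_, hlt⟩, ⟨⟨x.1, x.2, hk.2.2, hk.2.1⟩, rfl⟩, tu_of _⟩
  | cross d x y =>
    obtain ⟨ha, hb, hab⟩ := hmem d _ _ rfl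
    have hr := heq d _ _ rfl
    -- Neither strand of the crossing is strictly farther than the crossing itself; leaving out both
    -- gives the bound that the index of a crossing must satisfy.
    have hlt : strandsOutside L O p < (Λ.rayNodes α).card - 1 := by
      rw [ho, ← Finset.card_erase_of_mem ha]
      refine Finset.card_lt_card ⟨fun c hc => ?_, fun hsub => ?_⟩
      · rw [Finset.mem_filter] at hc
        refine Finset.mem_erase.2 ⟨?_, hc.1⟩
        rintro rfl
        exact lt_irrefl _ hc.2
      · have := (Finset.mem_filter.1 (hsub (Finset.mem_erase.2 ⟨hab.symm, hb⟩))).2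
        rw [← hr] at this
        exact lt_irrefl _ this
    obtain ⟨hd, hx, hy, hxy, hxp, hyp, -⟩ := hk
    have hp := L.mem_doublePoints hx hy hxy hxp hyp
    cases d with
    | pos => exact ⟨.sigma ⟨_, hlt⟩, ⟨hp, hd.symm, rfl⟩, sg_of _⟩
    | neg => exact ⟨.sigmaInv ⟨_, hlt⟩, ⟨hp, hd.symm, rfl⟩, congrArg (·⁻¹) (sg_of _)⟩
    | welded => exact ⟨.rho ⟨_, hlt⟩, ⟨hp, hd.symm, rfl⟩, rh_of _⟩

theorem _root_.ExtWelded.exists_forall₂ {β γ : Type*} {r : β → γ → Prop} {l : List β}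
    (h : ∀ a ∈ l, ∃ b, r a b) : ∃ l', List.Forall₂ r l l' := by
  induction l with
  | nil => exact ⟨[], .nil⟩
  | cons a l ih =>
    obtain ⟨b, hb⟩ := h a (by simp)
    obtain ⟨l', hl'⟩ := ih fun a ha => h a (by simp [ha])
    exact ⟨b :: l', .cons hb hl'⟩

/-- The braid diagram obtained by cutting a braided diagram open. -/
theorem IsSchedule.exists_isClosureOf (h : IsSchedule L O α ps) (hL : L.IsBraidedAround O) :
    ∃ b : BraidDiagram (Λ.rayNodes α).card, IsClosureOf L b ∧
      b.toGroup = ((Λ.events α ps).map fun e => e.2.toGroup (Λ.rayNodes α).card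
        (rank (Λ.rayNodes α) Λ.radius e)).prod := by
  obtain ⟨b, hb⟩ := exists_forall₂ fun e he => h.exists_letter Λ hL he
  refine ⟨b, ⟨O, Complex.exp (α * Complex.I), ps.map Prod.fst, hL, Complex.exp_ne_zero _,
    Λ.strandsOnRay_eq α, h.nodup, h.mem, fun p hp => ?_, List.pairwise_map.2 h.sorted, ?_⟩, ?_⟩
  · obtain ⟨e, he, rfl⟩ := List.mem_map.1 hp
    exact h.pos e he
  · rw [List.forall₂_map_left_iff]
    exact hb.imp fun _ _ hbb => hbb.1
  · rw [BraidDiagram.toGroup, events, List.map_map]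
    congr 1
    have := hb.imp fun _ _ hbb => hbb.2
    clear hb h
    induction this with
    | nil => rfl
    | cons h1 _ ih =>
      rw [List.map_cons, List.map_cons, h1, ih]
      rfl

end Lift

end BraidWord

/-! ### The Gauss data of a braided diagram determine its braid -/

section Conclusion

open Equiv

/-- An order-preserving enumeration of a finite set is unique. -/
theorem eq_of_lt_iff_lt {α : Type*} {V : Finset α} {n : ℕ} {f g : α → ℕ}
    (hf : Set.BijOn f V (Set.Iio n)) (hg : Set.BijOn g V (Set.Iio n))
    (h : ∀ v ∈ V, ∀ w ∈ V, v ≠ w → (f v < f w ↔ g v < g w)) {v : α} (hv : v ∈ V) : f v = g v := by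
  rw [← card_filter_lt hf hv, ← card_filter_lt hg hv]
  congr 1
  refine Finset.filter_congr fun c hc => ?_
  by_cases hcv : c = v
  · simp [hcv]
  · exact h c hc v hv hcv

/-- Wens at the beginning of the braid are recorded as signs. -/
theorem State.equivalent_of_taus {α : Type*} [DecidableEq α] {S T : State α} {ws : List α}
    (hws : ws.Nodup) (hn : S.nodes = T.nodes) (hL : S.letters = ws.map .tau ++ T.letters)
    (hP : ∀ v ∈ T.nodes, S.prev v = T.prev v)
    (hs : ∀ v ∈ T.nodes, T.sign v = S.sign v + if v ∈ ws then 1 else 0) : S.Equivalent T := by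
  induction ws generalizing S with
  | nil =>
    refine State.equivalent_of_map id (hn ▸ Set.bijOn_id _) (hn ▸ hP) (fun v hv => ?_) ?_
      (Or.inr ?_)
    · have := hs v (hn ▸ hv)
      simpa using this.symm
    all_goals
      rw [map_eq_self_of_ok (V := Set.univ) (f := id) (fun _ _ => rfl)
        (fun l hl => (S.ok l hl).mono (Set.subset_univ _))]
      simp [hL]
  | cons a ws ih =>
    let S' : State α :=
      { S with
        letters := ws.map .tau ++ T.letters
        sign := fun v => S.sign v + if v = a then 1 else 0
        ok := fun l hl => S.ok l (by rw [hL]; exact List.mem_cons_of_mem _ hl) }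
    refine State.Equivalent.trans (T := S') (State.equivalent_of_tau (a := a) rfl (by simp [hL, S'])
      (fun _ _ => rfl) fun _ _ => rfl) (ih (List.nodup_cons.1 hws).2 hn rfl hP fun v hv => ?_)
    rw [hs v hv, add_assoc]
    congr 1
    by_cases hva : v = a
    · simp [hva, (List.nodup_cons.1 hws).1]
    · simp [hva]

namespace Lift

variable {L : LinkDiagram} {O : ℂ} (Λ : Lift L O) {α : ℝ}
  {ps : List (ℂ × EventKind (Fin L.numComp × ℝ))}

theorem IsSchedule.ordered (h : IsSchedule L O α ps) : Λ.Ordered α (ps.map Prod.snd) := by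
  have key : ∀ k ∈ ps.map Prod.snd, ∃ p, (p, k) ∈ ps := by
    intro k hk
    obtain ⟨e, he, rfl⟩ := List.mem_map.1 hk
    exact ⟨e.1, he⟩
  refine ⟨fun k hk => ?_, fun k hk x hx => ?_, fun k hk x hx => ?_, fun k hk x hx y hy => ?_, ?_⟩
  · obtain ⟨p, hp⟩ := key k hk
    exact (h.kind _ hp).valid
  · obtain ⟨p, hp⟩ := key k hk
    exact ((h.kind _ hp).of_mem_points hx).1
  · obtain ⟨p, hp⟩ := key k hk
    rw [(h.kind _ hp).time_eq Λ hx]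
    exact h.pos _ hp
  · obtain ⟨p, hp⟩ := key k hk
    rw [(h.kind _ hp).time_eq Λ hx, (h.kind _ hp).time_eq Λ hy]
  · rw [List.pairwise_map]
    refine (h.sorted.and (List.pairwise_map.1 h.nodup)).imp_of_mem ?_
    rintro e e' he he' ⟨h1, h2⟩ x hx y hy
    refine ⟨?_, ?_⟩
    · rintro rfl
      exact h2 (((h.kind _ he).of_mem_points hx).2.symm.trans ((h.kind _ he').of_mem_points hy).2)
    · rwa [(h.kind _ he).time_eq Λ hx, (h.kind _ he').time_eq Λ hy]

/-- Turning around `O` once leads from the previous strand to a strand. -/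
theorem samePoint_pt_prevNode {v : Fin L.numComp × ℝ} (hv : v ∈ Λ.rayNodes α) :
    SamePoint (Λ.pt (prevNode (Λ.rayNodes α) v) (2 * Real.pi)) v := by
  have hs := samePoint_toDomain (Λ.pt v (-(2 * Real.pi)))
  set w := toDomain (Λ.pt v (-(2 * Real.pi))) with hw
  have h1 := Λ.samePoint_pt hs (2 * Real.pi)
  rw [pt_pt, neg_add_cancel, pt_zero] at h1
  have hwr : w ∈ Λ.onRay α := by
    obtain ⟨k, hk⟩ := Λ.angle_of_samePoint hs
    obtain ⟨m, hm⟩ := (Λ.mem_rayNodes.1 hv).2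
    refine ⟨toDomain_mem _, k + m - 1, ?_⟩
    rw [hk, Λ.angle_pt, hm]
    push_cast
    ring
  have hprev := Λ.isPrev_of_time (Λ.mem_rayNodes.2 hwr) hwr Real.two_pi_pos le_rfl h1
    fun u hu => Or.inl (Λ.coord_of_mem (Λ.mem_rayNodes.1 hu)).2
  rwa [hprev.eq_prevNode Λ.normalized_rayNodes hv]

theorem _root_.ExtWelded.wens_zero (n : ℕ) : wens n 0 = 1 := by
  simp [wens]

/-- It remains to identify the permutation of the word with the predecessor map: after a full turn
the strand from `prevNode v` arrives at `v`. -/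
theorem IsSchedule.exists_rep (h : IsSchedule L O α ps) (hL : L.IsBraidedAround O) :
    ∃ b : BraidDiagram (Λ.rayNodes α).card, IsClosureOf L b ∧
      (plainState (Λ.rayNodes α) Λ.normalized_rayNodes (Λ.strandLetters α (ps.map Prod.snd))
        (h.ordered Λ).strandLetters_ok).Rep ⟨_, b.toGroup⟩ := by
  obtain ⟨b, hb, hbg⟩ := h.exists_isClosureOf Λ hL
  have hM := h.motion Λ hL
  obtain ⟨f, hf, hfr⟩ := exists_ranking (Λ.rayNodes α) (fun v => Λ.radius v 0) (by
    intro v hv w hw hvw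
    by_contra hne
    obtain ⟨e, he, -, h0⟩ := hM.zeros v hv w hw hne 0 ⟨le_rfl, Real.two_pi_pos.le⟩ hvw
    have := (hM.range e he).1
    rw [h0] at this
    exact lt_irrefl _ this)
  obtain ⟨π, hπ, hprod, hend⟩ := hM.exists_perm hf hfr
  refine ⟨b, hb, f, π, 0, hf, hπ, fun v hv => ?_, fun _ _ => rfl, ?_⟩
  · change v ∈ Λ.rayNodes α at hv
    change π (f v) = f (prevNode (Λ.rayNodes α) v)
    have hP := bijOn_prevNode (Λ.normalized_rayNodes (α := α))
    have hrad : ∀ v ∈ Λ.rayNodes α,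
        Λ.radius (prevNode (Λ.rayNodes α) v) (2 * Real.pi) = Λ.radius v 0 := by
      intro v hv
      rw [Λ.radius_eq, Λ.radius_eq, L.curve_eq_of_samePoint (Λ.samePoint_pt_prevNode hv), pt_zero]
    have hg : Set.BijOn (fun v => π⁻¹ (f (prevNode (Λ.rayNodes α) v))) (Λ.rayNodes α)
        (Set.Iio (Λ.rayNodes α).card) := by
      refine ⟨fun v hv => lowPerm_lt (inv_mem hπ) (hf.mapsTo (hP.mapsTo hv)),
        fun v hv w hw hvw => hP.injOn hv hw (hf.injOn (hP.mapsTo hv) (hP.mapsTo hw)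
          (π⁻¹.injective hvw)), fun i hi => ?_⟩
      obtain ⟨v, hv, hvi⟩ := (hf.comp hP).surjOn (show π i ∈ Set.Iio _ from lowPerm_lt hπ hi)
      refine ⟨v, hv, ?_⟩
      change π⁻¹ ((f ∘ prevNode (Λ.rayNodes α)) v) = i
      rw [hvi]
      exact Equiv.symm_apply_apply _ _
    -- Both enumerations list the strands by decreasing distance, one on the initial ray, the other
    -- after the turn, so they agree.
    have := eq_of_lt_iff_lt hf hg (fun v hv w hw hvw => by
      rw [hfr v hv w hw, hend _ (hP.mapsTo hv) _ (hP.mapsTo hw) fun e => hvw (hP.injOn hv hw e),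
        hrad v hv, hrad w hw]) hv
    rw [this]
    exact Equiv.apply_symm_apply _ _
  · change b.toGroup = ((Λ.strandLetters α (ps.map Prod.snd)).map _).prod * _ * wens _ 0
    rw [wens_zero, mul_one, hbg, hprod]
    simp only [events, strandLetters, List.flatMap_map]

variable (L) in
/-- The parameters of the wen marks. -/
noncomputable def _root_.ExtWelded.LinkDiagram.wenList : List (Fin L.numComp × ℝ) :=
  (Set.Finite.toFinset (s := {x : Fin L.numComp × ℝ | x.2 ∈ L.wen x.1 ∧ x.2 ∈ Set.Ico (0 : ℝ) 1})
    (((Set.finite_iUnion fun j => (L.wen_finite j).image fun t => (j, t))).subset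
      fun x hx => Set.mem_iUnion.2 ⟨x.1, x.2, hx, rfl⟩)).toList

theorem _root_.ExtWelded.LinkDiagram.mem_wenList {x : Fin L.numComp × ℝ} :
    x ∈ L.wenList ↔ x.2 ∈ L.wen x.1 ∧ x.2 ∈ Set.Ico (0 : ℝ) 1 := by
  simp [LinkDiagram.wenList]

/-- The letters of the wen marks and of the real crossings. -/
theorem IsSchedule.mem_letters (h : IsSchedule L O α ps)
    {l : PureLetter (Fin L.numComp × ℝ)} :
    l ∈ (ps.map Prod.snd).flatMap EventKind.pureLetters ↔
      l ∈ L.wenList.map .tau ++ L.finite_crossingLetters.toFinset.toList := by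
  rw [List.mem_append, List.mem_map, Finset.mem_toList, Set.Finite.mem_toFinset, List.mem_flatMap]
  constructor
  · rintro ⟨k, hk, hl⟩
    obtain ⟨⟨p, k⟩, he, rfl⟩ := List.mem_map.1 hk
    have hk := h.kind _ he
    cases k with
    | wen x =>
      simp only [EventKind.pureLetters, List.mem_singleton] at hl
      exact Or.inl ⟨x, L.mem_wenList.2 ⟨hk.2.2, hk.1⟩, hl.symm⟩
    | cross d x y =>
      obtain ⟨hd, hx, hy, hxy, hxp, hyp, hc⟩ := hk
      dsimp only at hd hxp hyp
      refine Or.inr ?_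
      have hp := L.mem_doublePoints hx hy hxy hxp hyp
      have hreal : d ≠ .welded → p ∈ L.realCrossings := fun h => ⟨hp, hd ▸ h⟩
      have hport : d ≠ .welded → l = .chi d.sgn x y → l ∈ L.crossingLetters := by
        rintro h1 rfl
        refine ⟨x, ⟨hx, hxp ▸ hreal h1⟩, y, ⟨hy, hyp ▸ hreal h1⟩, hxp.trans hyp.symm, hc, ?_⟩
        rw [hxp, ← hd]
      rcases d with _ | _ | _
      · exact hport (by simp) (by simpa [EventKind.pureLetters, Decoration.sgn] using hl)
      · exact hport (by simp) (by simpa [EventKind.pureLetters, Decoration.sgn] using hl)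
      · simp [EventKind.pureLetters] at hl
  · have hex : ∀ p ∈ L.specialPoints, ∃ k, (p, k) ∈ ps := by
      intro p hp
      obtain ⟨e, he, rfl⟩ := List.mem_map.1 ((h.mem p).2 hp)
      exact ⟨e.2, he⟩
    rintro (⟨x, hx, rfl⟩ | ⟨x, hx, y, hy, hxy, hc, rfl⟩)
    · obtain ⟨hw, hd⟩ := L.mem_wenList.1 hx
      obtain ⟨k, hk⟩ := hex (L.curve x.1 x.2) (Or.inr ⟨x.1, x.2, hw, rfl⟩)
      refine ⟨k, List.mem_map_of_mem (f := Prod.snd) hk, ?_⟩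
      have hkind := h.kind _ hk
      have hxk := hkind.mem_points hd rfl
      cases k with
      | wen a =>
        simp only [EventKind.points, List.mem_singleton] at hxk
        simp [EventKind.pureLetters, hxk]
      | cross d a b =>
        obtain ⟨-, ha, hb, hab, hap, hbp, -⟩ := hkind
        exact absurd (L.mem_doublePoints ha hb hab hap hbp) (L.wen_not_double _ _ hw)
    · have hne : x ≠ y := by
        rintro rfl
        rw [cross_self] at hc
        exact lt_irrefl _ hc
      obtain ⟨k, hk⟩ := hex (L.curve x.1 x.2) (Or.inl hx.2.1)
      refine ⟨k, List.mem_map_of_mem (f := Prod.snd) hk, ?_⟩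
      have hkind := h.kind _ hk
      have hxk := hkind.mem_points hx.1 rfl
      have hyk := hkind.mem_points hy.1 hxy.symm
      cases k with
      | wen a => exact absurd hx.2.1 hkind.notMem_doublePoints
      | cross d a b =>
        obtain ⟨hd, ha, hb, hab, hap, hbp, hc'⟩ := hkind
        dsimp only at hd
        simp only [EventKind.points, List.mem_cons, List.not_mem_nil, or_false] at hxk hyk
        rcases hxk with rfl | rfl <;> rcases hyk with rfl | rfl
        · exact absurd rfl hne
        · have hw := hx.2.2
          rw [← hd] at hw ⊢
          rcases d with _ | _ | _
          · simp [EventKind.pureLetters, Decoration.sgn]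
          · simp [EventKind.pureLetters, Decoration.sgn]
          · exact absurd rfl hw
        · rw [cross_swap] at hc
          linarith
        · exact absurd rfl hne

theorem _root_.ExtWelded.LinkDiagram.letters_pairwise_disj (L : LinkDiagram) :
    (L.wenList.map PureLetter.tau ++ L.finite_crossingLetters.toFinset.toList).Pairwise
      PureLetter.Disj := by
  have hmem : ∀ l ∈ L.finite_crossingLetters.toFinset.toList, l ∈ L.crossingLetters :=
    fun l hl => by simpa using hl
  rw [List.pairwise_append]
  refine ⟨?_, ?_, ?_⟩
  · exact List.pairwise_map.2 ((Finset.nodup_toList _).imp fun hab => Ne.symm hab)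
  · exact (Finset.nodup_toList _).imp_of_mem fun {l l'} hl hl' hne =>
      L.crossingLetters_disj (hmem l hl) (hmem l' hl') hne
  · intro l hl l' hl'
    obtain ⟨x, hx, rfl⟩ := List.mem_map.1 hl
    obtain ⟨a, ha, b, hb, -, -, rfl⟩ := hmem l' hl'
    have key : ∀ a ∈ L.ports, a ≠ x := by
      rintro a ha rfl
      exact L.wen_not_double _ _ (L.mem_wenList.1 hx).1 ha.2.1
    exact ⟨key a ha, key b hb⟩

theorem _root_.ExtWelded.LinkDiagram.letters_nodup (L : LinkDiagram) :
    (L.wenList.map PureLetter.tau ++ L.finite_crossingLetters.toFinset.toList).Nodup := by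
  refine List.Nodup.append ((Finset.nodup_toList _).map fun a b h => PureLetter.tau.inj h)
    (Finset.nodup_toList _) ?_
  intro l hl hl'
  obtain ⟨x, -, rfl⟩ := List.mem_map.1 hl
  simp [LinkDiagram.crossingLetters] at hl'

theorem IsSchedule.letters_nodup (h : IsSchedule L O α ps) (Λ : Lift L O) :
    ((ps.map Prod.snd).flatMap EventKind.pureLetters).Nodup := by
  have ho := h.ordered Λ
  rw [List.nodup_flatMap]
  refine ⟨fun k _ => ?_, ho.sorted.imp_of_mem fun {k k'} hk hk' hkk => ?_⟩
  · rcases k with ⟨_ | _ | _, a, b⟩ | a <;> simp [EventKind.pureLetters]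
  · intro l hl hl'
    have h1 := EventKind.ok_of_mem_pureLetters (ho.valid k hk) hl (V := {x | x ∈ k.points})
      fun _ hx => hx
    have h2 := EventKind.ok_of_mem_pureLetters (ho.valid k' hk') hl' (V := {x | x ∈ k'.points})
      fun _ hx => hx
    cases l with
    | chi ε a b => exact (hkk a h1.1 a h2.1).1 rfl
    | tau a => exact (hkk a h1 a h2).1 rfl

/-- The braid of a braided diagram represents its Gauss data. -/
theorem exists_gaussState_equivalent (hL : L.IsBraidedAround O) :
    ∃ (n : ℕ) (b : BraidDiagram n) (S : State (Fin L.numComp × ℝ))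
      (base : Fin L.numComp → ℝ) (hbase : ∀ j, base j ∈ Set.Ico (0 : ℝ) 1),
      IsClosureOf L b ∧ S.Rep ⟨n, b.toGroup⟩ ∧ S.Equivalent (L.gaussState base hbase) := by
  classical
  obtain ⟨Λ⟩ := nonempty_lift hL
  obtain ⟨α, ps, h⟩ := Λ.exists_schedule
  obtain ⟨b, hb, hrep⟩ := h.exists_rep Λ hL
  have ho := h.ordered Λ
  -- Base points are taken on the initial ray, so that the Gauss nodes are among the nodes already
  -- present.
  let base : Fin L.numComp → ℝ := fun j => (Λ.strand α (j, 0)).2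
  have hbase : ∀ j, base j ∈ Set.Ico (0 : ℝ) 1 := fun j => (Λ.strand_mem α (j, 0)).1
  have hbase' : ∀ j, (j, base j) ∈ Λ.rayNodes α := by
    intro j
    have h1 : (Λ.strand α (j, 0)).1 = j := (Λ.samePoint_coord α (j, 0)).1
    have h2 : (j, base j) = Λ.strand α (j, 0) := Prod.ext h1.symm rfl
    rw [h2]
    exact Λ.strand_mem_rayNodes _
  set V := eventPoints (ps.map Prod.snd) ∪ Λ.rayNodes α with hV
  have hpoint : ∀ x : Fin L.numComp × ℝ, x.2 ∈ Set.Ico (0 : ℝ) 1 →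
      L.curve x.1 x.2 ∈ L.specialPoints → x ∈ V := by
    intro x hx hxs
    obtain ⟨e, he, hex⟩ := List.mem_map.1 ((h.mem _).2 hxs)
    exact Finset.mem_union_left _ (mem_eventPoints.2 ⟨e.2, List.mem_map_of_mem he,
      (h.kind e he).mem_points hx hex.symm⟩)
  have hsub : L.gaussNodes base ⊆ V := by
    intro v hv
    rcases L.mem_gaussNodes.1 hv with h1 | ⟨-, h1⟩
    · exact hpoint v h1.1 (Or.inl h1.2.1)
    · have : v = (v.1, base v.1) := Prod.ext rfl h1
      rw [this]
      exact Finset.mem_union_right _ (hbase' _)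
  have hU : V ∪ L.gaussNodes base = V := Finset.union_eq_left.2 hsub
  have hN : Normalized (V ∪ L.gaussNodes base) := hU.symm ▸ ho.normalized
  have hcomp : ∀ a ∈ V, ∃ v ∈ L.gaussNodes base, v.1 = a.1 := by
    intro a _
    by_cases hl : a.1 ∈ L.loops
    · exact ⟨(a.1, base a.1), L.mem_gaussNodes.2 (Or.inr ⟨hl, rfl⟩), rfl⟩
    · simp only [LinkDiagram.loops, Set.mem_ofPred_eq, not_forall, not_not] at hl
      obtain ⟨t, ht⟩ := hl
      exact ⟨toDomain (a.1, t), L.mem_gaussNodes.2 (Or.inl (L.toDomain_mem_ports ht)), rfl⟩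
  set C := L.finite_crossingLetters.toFinset.toList with hC
  have hmemC : ∀ l ∈ C, l ∈ L.crossingLetters := fun l hl => by simpa [C] using hl
  have hCok : ∀ l ∈ C, l.Ok (L.gaussNodes base : Set (Fin L.numComp × ℝ)) := fun l hl =>
    (L.crossingLetters_ok (hmemC l hl)).mono fun _ hv => L.mem_gaussNodes.2 (Or.inl hv)
  have hCok' : ∀ l ∈ C, l.Ok (↑(V ∪ L.gaussNodes base) : Set (Fin L.numComp × ℝ)) :=
    fun l hl => (hCok l hl).mono (by simp)
  have hM₁ : ∀ l ∈ (ps.map Prod.snd).flatMap EventKind.pureLetters,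
      l.Ok (V : Set (Fin L.numComp × ℝ)) := fun l hl =>
    (ho.letters_ok l hl).mono (by simp [V])
  have hM₂ : ∀ l ∈ L.wenList.map PureLetter.tau ++ C, l.Ok (V : Set (Fin L.numComp × ℝ)) :=
    fun l hl => hM₁ l (h.mem_letters.2 hl)
  refine ⟨_, b, _, base, hbase, hb, hrep, ?_⟩
  refine (ho.insert_events (pre := []) ho.strandLetters_ok hM₁).trans ?_
  -- The letters are now disjoint and may be rearranged, with all wens in front.
  refine State.Equivalent.trans (T := plainState V ho.normalized _ hM₂) ?_ ?_
  · have hid : ((ps.map Prod.snd).flatMap EventKind.pureLetters).map (PureLetter.map id) =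
        (ps.map Prod.snd).flatMap EventKind.pureLetters :=
      map_eq_self_of_ok (fun _ _ => rfl) hM₁
    refine State.equivalent_of_map id (Set.bijOn_id _) (fun _ _ => rfl) (fun _ _ => rfl) ?_
      (Or.inl L.letters_pairwise_disj)
    change (((ps.map Prod.snd).flatMap EventKind.pureLetters).map (PureLetter.map id)).Perm _
    rw [hid]
    exact (List.perm_ext_iff_of_nodup (h.letters_nodup Λ) L.letters_nodup).2 fun l => h.mem_letters
  refine State.Equivalent.trans ?_
    (circleState_equivalent_of_subset L.periodic_wen (L.normalized_gaussNodes hbase) hN hCok hCok'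
      hcomp)
  -- All wens are nodes, so the sign of a node only tells whether it is a wen; this is what remains
  -- after the wen letters have been absorbed.
  refine State.equivalent_of_taus (ws := L.wenList) (Finset.nodup_toList _) hU.symm rfl
    (fun v _ => ?_) fun v hv => ?_
  · simp only [plainState, circleState, hU]
  · change v ∈ V ∪ L.gaussNodes base at hv
    change wenSign L.wen (V ∪ L.gaussNodes base) v = 0 + _
    rw [zero_add, wenSign_of_subset L.periodic_wen (fun j t ht ht' => ?_) hv]
    · have : v ∈ L.wenList ↔ v.2 ∈ L.wen v.1 := by
        rw [L.mem_wenList]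
        exact and_iff_left (hN v hv)
      simp only [this]
    · rw [hU]
      exact hpoint (j, t) ht' (Or.inr ⟨j, t, ht, rfl⟩)

end Lift

/-- The braids of `L` and `L'` represent states equivalent to the Gauss states of their diagrams,
and both of these are equivalent to that of `K`. -/
theorem BraidingProcess.markovRelated {K L L' : LinkDiagram} (hL : BraidingProcess K L)
    (hL' : BraidingProcess K L') : MarkovRelated L L' := by
  obtain ⟨-, O, -, -, hO⟩ := id hL
  obtain ⟨-, O', -, -, hO'⟩ := id hL'
  obtain ⟨n, b, S, base, hbase, hb, hS, hSL⟩ := Lift.exists_gaussState_equivalent hO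
  obtain ⟨n', b', S', base', hbase', hb', hS', hSL'⟩ := Lift.exists_gaussState_equivalent hO'
  have h0 : ∀ j : Fin K.numComp, (fun _ => 0 : Fin K.numComp → ℝ) j ∈ Set.Ico (0 : ℝ) 1 :=
    fun _ => ⟨le_rfl, one_pos⟩
  have h := (hSL.trans (hL.gaussState_equivalent h0 hbase).symm).trans
    ((hL'.gaussState_equivalent h0 hbase').trans hSL'.symm)
  exact ⟨n, n', b, b', hb, hb', h _ _ hS hS' b b' rfl rfl⟩

end Conclusion

end ExtWelded

/-- For an extended welded link diagram `K`, a braided diagram obtained from `K` by the braiding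
process is uniquely determined up to the extended Markov moves (M0) and (M2). -/
theorem corollary3p5 (K L L' : ExtWelded.LinkDiagram)
    (hL : ExtWelded.BraidingProcess K L) (hL' : ExtWelded.BraidingProcess K L') :
    ExtWelded.MarkovRelated L L' := by
  exact hL.markovRelated hL'
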